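/- **Setting.** Let $\kappa>0$, $1<\gamma<3$, $d\in\mathbb N$, $A^1,\dots,A^d>0$, and put $\theta=\frac{\gamma-1}{2}$, $\lambda=\frac1{\gamma-1}-\frac12$, $a=\frac{2\sqrt{\gamma\kappa}}{\gamma-1}$, $J_\lambda=\int_{-1}^1(1-z^2)^\lambda\,dz$, $c=a^{-2/(\gamma-1)}/J_\lambda$, $\chi(\rho,\xi)=c\,(a^2\rho^{\gamma-1}-\xi^2)_+^\lambda$. For $\rho\ge 0$, $u,\xi\in\mathbb R$ the Maxwellian is $$M(\rho,u,\xi)=\big(\chi(\rho,\xi-u),\ ((1-\theta)u+\theta\xi)\,\chi(\rho,\xi-u)\big)\in\mathbb R^2,$$ and $\omega_1(\rho,u)=u-a\rho^\theta$, $\omega_2(\rho,u)=u+a\rho^\theta$. Let $D=\{f\in\mathbb R^2: f_0>0\text{ or }f_0=f_1=0\}$. For $f\in D\setminus\{0\}$ let $(\rho(f,\xi),u(f,\xi))$ be the inverse relation to $f=M(\rho,u,\xi)$, i.e. $u(f,\xi)=\frac{f_1/f_0-\theta\xi}{1-\theta}$, $\rho(f,\xi)=a^{-\frac2{\gamma-1}}\big((\frac{f_1/f_0-\xi}{1-\theta})^2+(f_0/c)^{1/\lambda}\big)^{\frac1{\gamma-1}}$,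 and $\omega_k(f,\xi)=\omega_k(\rho(f,\xi),u(f,\xi))$. The kinetic energy is $$H(f,\xi)=\tfrac{\theta}{1-\theta}\tfrac{\xi^2}{2}f_0+\tfrac{\theta}{2c^{1/\lambda}}\tfrac{f_0^{1+1/\lambda}}{1+1/\lambda}+\tfrac1{1-\theta}\tfrac12\tfrac{f_1^2}{f_0}-\tfrac{\theta}{1-\theta}\xi f_1\quad(f\ne0),\qquad H(0,\xi)=0,$$ and for $S:\mathbb R\to\mathbb R$ the kinetic entropy is $H_S(f,\xi)=\int_{\mathbb R}\Phi(\rho(f,\xi),u(f,\xi),\xi,v)S(v)\,dv$ for $f\ne0$, $H_S(0,\xi)=0$, with $$\Phi(\rho,u,\xi,v)=\tfrac{(1-\theta)^2}{\theta}\tfrac{c}{J_\lambda}\mathbf 1_{\omega_1<\xi<\omega_2}\mathbf 1_{\omega_1<v<\omega_2}|\xi-v|^{2\lambda-1}\int_1^{z}(y^2-1)^{\lambda-1}dy,\quad z=\tfrac{(\xi+v)(\omega_1+\omega_2)-2(\omega_1\omega_2+\xi v)}{(\omega_2-\omega_1)|\xi-v|}.$$ With $d\mu=|\xi|\,d\xi$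 (respectively $|\xi|\,d\xi\,dt$), a *coupling function* is any map $\Psi:(0,\infty)\times L^1_\mu((-\infty,0)_\xi,D)^d\to L^1_\mu((0,\infty)_\xi,D)^d$, $(t,g)\mapsto\Psi[t,g]$. "loc, $t$" means integrability and convergence over compact subsets of $J$, where $J=(0,\infty)$ or $J=[0,\infty)$ (the statement holds for either choice). For $\omega^i_{\min}<\omega^i_{\max}$ let $S^i_\omega(v)=(v-\omega^i_{\max})_+^2+(\omega^i_{\min}-v)_+^2$ and $\tilde D^i_\xi=\{f\in D: f=0\text{ or }\omega^i_{\min}\le\omega_1(f,\xi)\le\omega_2(f,\xi)\le\omega^i_{\max}\}$. Call data $g$ *invariant* if $g^i(\xi)\in\tilde D^i_\xi$ for a.e. $\xi$ and all $i$. We say that $\Psi$ satisfies the *assumptions of the macroscopic existence theorem* with $(\omega^i_{\min},\omega^i_{\max})_i$ and nonnegative $b_0,b_H\in L^1(\mathrm{loc},t)$ if 1. (continuity) $g\mapsto\big((t,\xi)\mapsto\Psi[t,g(t,\cdot)](\xi)\big)$ is a well-defined continuous map from $L^1_\mu((0,\infty)_{\mathrm{loc},t}\times(-\infty,0)_\xi,D)^d$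 to $L^1_\mu((0,\infty)_{\mathrm{loc},t}\times(0,\infty)_\xi,D)^d$; 2. (bounds) for a.e. $t>0$ and all $g\in L^1_\mu((-\infty,0)_\xi,D)^d$ (both sides possibly $+\infty$ in the last two inequalities) $$\sum_iA^i\int_0^\infty|\xi|\,\Psi^i_0[t,g]\,d\xi\le\sum_iA^i\int_{-\infty}^0|\xi|\,g^i_0\,d\xi+b_0(t),$$ $$\sum_iA^i\int_0^\infty|\xi|\,H(\Psi^i[t,g],\xi)\,d\xi\le\sum_iA^i\int_{-\infty}^0|\xi|\,H(g^i,\xi)\,d\xi+b_H(t),$$ $$\sum_iA^i\int_0^\infty|\xi|\,H_{S^i_\omega}(\Psi^i[t,g],\xi)\,d\xi\le\sum_iA^i\int_{-\infty}^0|\xi|\,H_{S^i_\omega}(g^i,\xi)\,d\xi.$$ **Proposition.** Let $\Psi$ be any coupling function. (a) The map $(\rho,u)\mapsto\int_0^\infty\xi M(\rho,u,\xi)\,d\xi$ is a bijection from $\{\rho>0,\ \omega_2(\rho,u)>0\}$ onto $\{f\in\mathbb R^2:f_0>0\}$. For all $t>0$ and $g\in L^1_\mu((-\infty,0)_\xi,D)^d$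 there is exactly one $\hat\Psi[t,g]\in L^1_\mu((0,\infty)_\xi,D)^d$ such that, for each $i$, there are $\hat\rho^i\ge0$, $\hat u^i\in\mathbb R$ with $$\hat\Psi^i[t,g](\xi)=M(\hat\rho^i,\hat u^i,\xi)\ \text{ for a.e. }\xi>0,\qquad\int_0^\infty\xi\,M(\hat\rho^i,\hat u^i,\xi)\,d\xi=\int_0^\infty\xi\,\Psi^i[t,g](\xi)\,d\xi.$$ Thus the Maxwellian coupling function $\hat\Psi$ is well defined. (b) Suppose that $\Psi$ satisfies the assumptions of the macroscopic existence theorem with $(\omega^i_{\min},\omega^i_{\max})_i,b_0,b_H$. Then, with the same $\omega^i_{\min},\omega^i_{\max},b_0,b_H$: - $\hat\Psi$ satisfies the three bounds in 2 for a.e. $t>0$ and all $g\in L^1_\mu((-\infty,0)_\xi,D)^d$; - for a.e. $t>0$, $\hat\Psi[t,\cdot]$ maps invariant data to invariant data; - $\hat\Psi$ satisfies the continuity property 1 on the set of those $g$ for which $g(t,\cdot)$ is invariant for a.e. $t>0$; - consequently $\hat\Psi$ satisfies the assumptions of the macroscopic existence theorem up to a change of its values on non-invariant data, on which the solutions in that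 theorem do not depend: there is a coupling function $\check\Psi$, again with Maxwellian values, such that $\check\Psi[t,g]=\hat\Psi[t,g]$ for all $t>0$ and all invariant $g$, and $\check\Psi$ satisfies all the assumptions 1 and 2 (for all data $g$). -/

import Mathlib

open MeasureTheory Set Filter Topology
open scoped ENNReal

namespace IsentropicNetwork

noncomputable section

/-! ### State space and kinetic trace spaces -/

/-- The set `D` of admissible kinetic values `f = (f₀, f₁)`. -/
def stateD : Set (ℝ × ℝ) := {f | 0 < f.1 ∨ (f.1 = 0 ∧ f.2 = 0)}

/-- The measure `|ξ| dξ` on the incoming velocities `(-∞, 0)`. -/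
def muIn : Measure ℝ :=
  (volume.restrict (Iio 0)).withDensity fun ξ => ENNReal.ofReal |ξ|

/-- The measure `|ξ| dξ` on the outgoing velocities `(0, ∞)`. -/
def muOut : Measure ℝ :=
  (volume.restrict (Ioi 0)).withDensity fun ξ => ENNReal.ofReal |ξ|

/-- The space of (classes of) `ν`-integrable functions of `ξ` with values in `D` almost
everywhere.  With `ν = muIn, muOut` these are `L¹_μ((-∞,0), D)` and `L¹_μ((0,∞), D)`. -/
abbrev L1D (ν : Measure ℝ) : Type := {g : Lp (ℝ × ℝ) 1 ν // ∀ᵐ ξ ∂ν, g ξ ∈ stateD}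

/-! ### The Maxwellian -/

def theta (γ : ℝ) : ℝ := (γ - 1) / 2

def lam (γ : ℝ) : ℝ := 1 / (γ - 1) - 1 / 2

def aConst (γ κ : ℝ) : ℝ := 2 * √(γ * κ) / (γ - 1)

def jConst (γ : ℝ) : ℝ := ∫ z in (-1 : ℝ)..1, (1 - z ^ 2) ^ lam γ

def cConst (γ κ : ℝ) : ℝ := aConst γ κ ^ (-2 / (γ - 1)) / jConst γ

def chi (γ κ ρ ξ : ℝ) : ℝ :=
  cConst γ κ * (max (aConst γ κ ^ 2 * ρ ^ (γ - 1) - ξ ^ 2) 0) ^ lam γ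

/-- The vector-valued Maxwellian `M(ρ, u, ξ)`. -/
def maxwellian (γ κ ρ u ξ : ℝ) : ℝ × ℝ :=
  (chi γ κ ρ (ξ - u), ((1 - theta γ) * u + theta γ * ξ) * chi γ κ ρ (ξ - u))

/-! ### Kinetic Riemann invariants and kinetic entropies -/

/-- The velocity `u(f, ξ)` of the inverse relation to `f = M(ρ, u, ξ)`. -/
def kinU (γ : ℝ) (f : ℝ × ℝ) (ξ : ℝ) : ℝ := (f.2 / f.1 - theta γ * ξ) / (1 - theta γ)

/-- The density `ρ(f, ξ)` of the inverse relation to `f = M(ρ, u, ξ)`. -/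
def kinRho (γ κ : ℝ) (f : ℝ × ℝ) (ξ : ℝ) : ℝ :=
  aConst γ κ ^ (-2 / (γ - 1)) *
    (((f.2 / f.1 - ξ) / (1 - theta γ)) ^ 2 + (f.1 / cConst γ κ) ^ (1 / lam γ)) ^ (1 / (γ - 1))

/-- The macroscopic Riemann invariant `ω₁ = u - a ρ^θ`. -/
def omega1 (γ κ ρ u : ℝ) : ℝ := u - aConst γ κ * ρ ^ theta γ

/-- The macroscopic Riemann invariant `ω₂ = u + a ρ^θ`. -/
def omega2 (γ κ ρ u : ℝ) : ℝ := u + aConst γ κ * ρ ^ theta γ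

def kinOmega1 (γ κ : ℝ) (f : ℝ × ℝ) (ξ : ℝ) : ℝ := omega1 γ κ (kinRho γ κ f ξ) (kinU γ f ξ)

def kinOmega2 (γ κ : ℝ) (f : ℝ × ℝ) (ξ : ℝ) : ℝ := omega2 γ κ (kinRho γ κ f ξ) (kinU γ f ξ)

/-- The function `Υ_{λ-1}(z) = ∫₁ᶻ (y² - 1)^{λ-1} dy`. -/
def upsilon (γ z : ℝ) : ℝ := ∫ y in (1 : ℝ)..z, (y ^ 2 - 1) ^ (lam γ - 1)

/-- The argument `z` of `Υ_{λ-1}` in the entropy kernel, as a function of `ω₁, ω₂, ξ, v`. -/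
def kernelArg (w₁ w₂ ξ v : ℝ) : ℝ :=
  ((ξ + v) * (w₁ + w₂) - 2 * (w₁ * w₂ + ξ * v)) / ((w₂ - w₁) * |ξ - v|)

open Classical in
/-- The entropy kernel `Φ(ρ, u, ξ, v)`. -/
def entropyKernel (γ κ ρ u ξ v : ℝ) : ℝ :=
  if (omega1 γ κ ρ u < ξ ∧ ξ < omega2 γ κ ρ u) ∧ (omega1 γ κ ρ u < v ∧ v < omega2 γ κ ρ u) then
    (1 - theta γ) ^ 2 / theta γ * (cConst γ κ / jConst γ) * |ξ - v| ^ (2 * lam γ - 1) *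
      upsilon γ (kernelArg (omega1 γ κ ρ u) (omega2 γ κ ρ u) ξ v)
  else 0

open Classical in
/-- The kinetic entropy `H_S(f, ξ)`. -/
def kinEntropy (γ κ : ℝ) (S : ℝ → ℝ) (f : ℝ × ℝ) (ξ : ℝ) : ℝ :=
  if f = 0 then 0
  else ∫ v, entropyKernel γ κ (kinRho γ κ f ξ) (kinU γ f ξ) ξ v * S v

/-- The kinetic energy `H(f, ξ)`; for `f = 0` the formula returns `0`. -/
def kinEnergy (γ κ : ℝ) (f : ℝ × ℝ) (ξ : ℝ) : ℝ :=
  theta γ / (1 - theta γ) * (ξ ^ 2 / 2) * f.1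
    + theta γ / (2 * cConst γ κ ^ (1 / lam γ)) * (f.1 ^ (1 + 1 / lam γ) / (1 + 1 / lam γ))
    + 1 / (1 - theta γ) * (1 / 2) * (f.2 ^ 2 / f.1)
    - theta γ / (1 - theta γ) * ξ * f.2

/-- The convex function `S_ω(v) = (v - ω_max)₊² + (ω_min - v)₊²`. -/
def sOmega (wmin wmax v : ℝ) : ℝ := (max (v - wmax) 0) ^ 2 + (max (wmin - v) 0) ^ 2

/-- The kinetic invariant domain `D̃_ξ`. -/
def invDomain (γ κ wmin wmax ξ : ℝ) : Set (ℝ × ℝ) :=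
  {f | f ∈ stateD ∧ (f = 0 ∨ (wmin ≤ kinOmega1 γ κ f ξ ∧
    kinOmega1 γ κ f ξ ≤ kinOmega2 γ κ f ξ ∧ kinOmega2 γ κ f ξ ≤ wmax))}

/-! ### Coupling functions -/

/-- A coupling function `Ψ[t, g]` for `d` pipelines.  Only its values at times `t > 0` matter. -/
abbrev Coupling (d : ℕ) : Type := ℝ → (Fin d → L1D muIn) → (Fin d → L1D muOut)

/-- The data with `gⁱ(ξ)` in the `i`-th kinetic invariant domain for almost every `ξ`. -/
def invariantData (γ κ : ℝ) {d : ℕ} (wmin wmax : Fin d → ℝ) (ν : Measure ℝ) :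
    Set (Fin d → L1D ν) :=
  {g | ∀ i, ∀ᵐ ξ ∂ν, (g i).1 ξ ∈ invDomain γ κ (wmin i) (wmax i) ξ}

/-- The half-flux sum `∑ᵢ Aⁱ ∫ |ξ| hⁱ(gⁱ(ξ), ξ) dξ` of nonnegative quantities `hⁱ`
(the weight `|ξ|` is contained in `ν`); the value `∞` is allowed. -/
def totalFlux {d : ℕ} (A : Fin d → ℝ) (ν : Measure ℝ) (h : Fin d → ℝ × ℝ → ℝ → ℝ)
    (g : Fin d → L1D ν) : ℝ≥0∞ :=
  ∑ i, ENNReal.ofReal (A i) * ∫⁻ ξ, ENNReal.ofReal (h i ((g i).1 ξ) ξ) ∂ν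

/-- Elements of `L¹_μ(J_loc × {ξ}, D)^d`, written as functions of time with values in the
`L¹_μ`-space in `ξ` (Fubini identification): integrable over every compact subset of `J`. -/
def IsLocL1 {d : ℕ} {ν : Measure ℝ} (J : Set ℝ) (G : ℝ → Fin d → L1D ν) : Prop :=
  ∀ i, LocallyIntegrableOn (fun t => (G t i).1) J volume

/-- Convergence in `L¹_μ(J_loc × {ξ}, D)^d`. -/
def TendstoLocL1 {d : ℕ} {ν : Measure ℝ} (J : Set ℝ) (G : ℕ → ℝ → Fin d → L1D ν)
    (G' : ℝ → Fin d → L1D ν) : Prop :=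
  ∀ K ⊆ J, IsCompact K → ∀ i,
    Tendsto (fun n => ∫⁻ t in K, ‖(G n t i).1 - (G' t i).1‖ₑ) atTop (𝓝 0)

/-- The superposition map `G ↦ ((t, ξ) ↦ Ψ[t, G(t, ·)](ξ))` is well defined and continuous on
those `G` in `L¹_μ(J_loc × (-∞,0), D)^d` which take values in `𝒢` for almost every time.
The topology is metrizable, so sequential continuity is continuity. -/
structure ContinuousCoupling {d : ℕ} (J : Set ℝ) (𝒢 : Set (Fin d → L1D muIn))
    (Ψ : Coupling d) : Prop where
  isLocL1 : ∀ G : ℝ → Fin d → L1D muIn, IsLocL1 J G →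
    (∀ᵐ t ∂volume.restrict (Ioi 0), G t ∈ 𝒢) → IsLocL1 J fun t => Ψ t (G t)
  tendsto : ∀ (G : ℕ → ℝ → Fin d → L1D muIn) (G' : ℝ → Fin d → L1D muIn),
    (∀ n, IsLocL1 J (G n)) → (∀ n, ∀ᵐ t ∂volume.restrict (Ioi 0), G n t ∈ 𝒢) →
    IsLocL1 J G' → (∀ᵐ t ∂volume.restrict (Ioi 0), G' t ∈ 𝒢) →
    TendstoLocL1 J G G' → TendstoLocL1 J (fun n t => Ψ t (G n t)) fun t => Ψ t (G' t)

/-- The bounds on mass production and energy production at the junction, and the kinetic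
invariance inequality. -/
structure FluxBounds (γ κ : ℝ) {d : ℕ} (A : Fin d → ℝ) (wmin wmax : Fin d → ℝ)
    (b₀ bH : ℝ → ℝ) (Ψ : Coupling d) : Prop where
  mass : ∀ᵐ t ∂volume.restrict (Ioi 0), ∀ g : Fin d → L1D muIn,
    totalFlux A muOut (fun _ f _ => f.1) (Ψ t g)
      ≤ totalFlux A muIn (fun _ f _ => f.1) g + ENNReal.ofReal (b₀ t)
  energy : ∀ᵐ t ∂volume.restrict (Ioi 0), ∀ g : Fin d → L1D muIn,
    totalFlux A muOut (fun _ => kinEnergy γ κ) (Ψ t g)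
      ≤ totalFlux A muIn (fun _ => kinEnergy γ κ) g + ENNReal.ofReal (bH t)
  invariance : ∀ᵐ t ∂volume.restrict (Ioi 0), ∀ g : Fin d → L1D muIn,
    totalFlux A muOut (fun i => kinEntropy γ κ (sOmega (wmin i) (wmax i))) (Ψ t g)
      ≤ totalFlux A muIn (fun i => kinEntropy γ κ (sOmega (wmin i) (wmax i))) g

/-- All assumptions on the coupling function in the existence theorem for the macroscopic
equation. -/
structure MacroscopicAssumptions (γ κ : ℝ) {d : ℕ} (A : Fin d → ℝ) (J : Set ℝ)
    (wmin wmax : Fin d → ℝ) (b₀ bH : ℝ → ℝ) (Ψ : Coupling d) : Prop where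
  wmin_lt_wmax : ∀ i, wmin i < wmax i
  b₀_nonneg : ∀ t > 0, 0 ≤ b₀ t
  b₀_loc : LocallyIntegrableOn b₀ J volume
  bH_nonneg : ∀ t > 0, 0 ≤ bH t
  bH_loc : LocallyIntegrableOn bH J volume
  continuous : ContinuousCoupling J univ Ψ
  bounds : FluxBounds γ κ A wmin wmax b₀ bH Ψ

/-! ### The Maxwellian coupling -/

/-- The half-flux `∫₀^∞ ξ M(ρ, u, ξ) dξ` of a Maxwellian. -/
def halfFlux (γ κ ρ u : ℝ) : ℝ × ℝ := ∫ ξ, maxwellian γ κ ρ u ξ ∂muOut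

/-- `h` is a Maxwellian on `ξ > 0` in each pipeline. -/
def IsMaxwellian (γ κ : ℝ) {d : ℕ} (h : Fin d → L1D muOut) : Prop :=
  ∀ i, ∃ ρ u : ℝ, 0 ≤ ρ ∧ ∀ᵐ ξ ∂muOut, (h i).1 ξ = maxwellian γ κ ρ u ξ

/-- In each pipeline `h` is a Maxwellian `M(ρ̂, û, ·)` on `ξ > 0`, where `(ρ̂, û)` satisfies
`∫₀^∞ ξ M(ρ̂, û, ξ) dξ = ∫₀^∞ ξ p(ξ) dξ`. -/
def IsMaxwellianOutflow (γ κ : ℝ) {d : ℕ} (p h : Fin d → L1D muOut) : Prop :=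
  ∀ i, ∃ ρ u : ℝ, 0 ≤ ρ ∧ (∀ᵐ ξ ∂muOut, (h i).1 ξ = maxwellian γ κ ρ u ξ) ∧
    halfFlux γ κ ρ u = ∫ ξ, (p i).1 ξ ∂muOut

/-- `Ψh` is the Maxwellian coupling function belonging to `Ψ`. -/
def IsMaxwellianCoupling (γ κ : ℝ) {d : ℕ} (Ψ Ψh : Coupling d) : Prop :=
  ∀ t > 0, ∀ g, IsMaxwellianOutflow γ κ (Ψ t g) (Ψh t g)

end

end IsentropicNetwork

open IsentropicNetwork

namespace IsentropicNetwork

noncomputable section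

/-! ### Positive powers -/

/-! Everything rests on one variational fact. For a fixed Maxwellian M and each functional H that
occurs (mass, energy, entropy of S_ω) there are slopes T₀, T₁, independent of ξ, with H(f,ξ) ≥
H(M(ξ),ξ) + T₀(f₀ - M₀(ξ)) + T₁(f₁ - M₁(ξ)) for all f in D. If M and an outflow p have the same
half-flux, integration in |ξ|dξ removes the linear term, so passing from p to M does not increase
the functional (`lintegral_le_of_subgradient`, `IsMaxwellianOutflow.lintegral_le`). The bounds for Ψ
are thereby inherited. For the mass T = (1,0); for the energy the inequality is a completed square
plus Young's inequality (`kinEnergy_subgradient`).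

For the entropy, S_ω is a superposition of (v-k)₊ over k > ω_max and of (k-v)₊ over k < ω_min, so
only (v-k)₊ has to be treated. In Riemann invariants the kernel is an integral over the larger
invariant; Tonelli and explicit antiderivatives give `kinK = maxw0 * entPair - dualEnt` (`kinK_eq`).
With the kinetic value held fixed, the gap to the supporting plane is a function `relEnt` of the
supporting state (x,y). Were it negative somewhere, it would have a negative minimum in the interior
of a compact region; there the critical equations say that the Maxwellian of (x,y) takes the given
value at ξ. This determines (x,y), and for that state the gap is zero, a contradiction
(`exists_critical`, `maxw_inj`, `relEnt_nonneg`). Integration over k yields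
`kinS_sOmega_subgradient`.

The half-flux is injective because the energy slopes are monotone: the difference of the slopes of
two Maxwellians, paired with the difference of the Maxwellians, is a sum of nonnegative terms
(`radMaxw_monotonicity`). With r = aρ^θ and m = u/r the half-flux is homogeneous in r, so its
inversion reduces to the single function `fluxRatio` on (-1,∞), which is continuous, injective and
runs from -∞ to ∞. The inverse is continuous, and `integral_norm_radMaxw_le_of_flux` extends
continuity, as an L¹-valued map, to the vacuum (`exists_maxwellianOfFlux`).

Invariant data have zero entropy flux, so the Maxwellian outflow has zero entropy flux as well; as
the kernel is strictly positive inside its support, its Riemann invariants lie in the prescribed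
interval. For the continuity in time, the outflow is a fixed continuous map of the flux Ψ[t,g], but
the general norm bound is not linear. On invariant data the quotient f₁/f₀ is bounded, which gives a
linear bound and allows dominated convergence along subsequences
(`tendsto_lintegral_sub_of_dominated`). Finally, Ψ̌ is Ψ̂ composed with a continuous retraction onto
invariant data that lowers f₀ at fixed f₁/f₀; it increases neither mass nor energy and makes the
entropy flux vanish (`exists_dataRetraction`). -/

/-- The function `x₊ ^ l`. -/
def posPow (l x : ℝ) : ℝ := (max x 0) ^ l

lemma posPow_nonneg (l x : ℝ) : 0 ≤ posPow l x := Real.rpow_nonneg (le_max_right _ _) _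

lemma posPow_of_nonneg {x : ℝ} (l : ℝ) (hx : 0 ≤ x) : posPow l x = x ^ l := by
  rw [posPow, max_eq_left hx]

lemma posPow_of_nonpos {l x : ℝ} (hl : 0 < l) (hx : x ≤ 0) : posPow l x = 0 := by
  rw [posPow, max_eq_right hx, Real.zero_rpow hl.ne']

lemma posPow_pos {x : ℝ} (l : ℝ) (hx : 0 < x) : 0 < posPow l x := by
  rw [posPow_of_nonneg l hx.le]; exact Real.rpow_pos_of_pos hx l

lemma posPow_pos_iff {l x : ℝ} (hl : 0 < l) : 0 < posPow l x ↔ 0 < x := by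
  refine ⟨fun h => ?_, posPow_pos l⟩
  by_contra hx
  rw [posPow_of_nonpos hl (not_lt.1 hx)] at h
  exact h.false

lemma posPow_mono {l : ℝ} (hl : 0 < l) : Monotone (posPow l) := fun _ _ h =>
  Real.rpow_le_rpow (le_max_right _ _) (max_le_max_right _ h) hl.le

lemma continuous_posPow {l : ℝ} (hl : 0 < l) : Continuous (posPow l) :=
  (continuous_id.max continuous_const).rpow_const fun _ => Or.inr hl.le

lemma posPow_mul {x : ℝ} (l y : ℝ) (hx : 0 ≤ x) : posPow l (x * y) = x ^ l * posPow l y := by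
  have : max (x * y) 0 = x * max y 0 := by rw [mul_max_of_nonneg _ _ hx, mul_zero]
  rw [posPow, this, Real.mul_rpow hx (le_max_right _ _), posPow]

lemma posPow_add_one {l : ℝ} (hl : 0 < l) (x : ℝ) : posPow (l + 1) x = x * posPow l x := by
  rcases le_or_gt x 0 with hx | hx
  · rw [posPow_of_nonpos (by linarith) hx, posPow_of_nonpos hl hx, mul_zero]
  · rw [posPow_of_nonneg _ hx.le, posPow_of_nonneg _ hx.le, Real.rpow_add_one hx.ne', mul_comm]

lemma hasDerivAt_posPow {l : ℝ} (hl : 0 < l) (x : ℝ) :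
    HasDerivAt (posPow (l + 1)) ((l + 1) * posPow l x) x := by
  have key : ∀ x : ℝ, 0 ≤ x → HasDerivAt (fun y : ℝ => y ^ (l + 1)) ((l + 1) * posPow l x) x := by
    intro x hx
    have := Real.hasDerivAt_rpow_const (x := x) (p := l + 1) (Or.inr (by linarith))
    rwa [add_sub_cancel_right, ← posPow_of_nonneg l hx] at this
  rcases lt_trichotomy x 0 with hx | hx | hx
  · rw [posPow_of_nonpos hl hx.le, mul_zero]
    refine (hasDerivAt_const x (0 : ℝ)).congr_of_eventuallyEq ?_
    filter_upwards [Iio_mem_nhds hx] with y hy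
    exact posPow_of_nonpos (by linarith) (le_of_lt hy)
  -- At the origin both one-sided derivatives vanish because `l > 0`, so they can be glued.
  · subst hx
    have h1 : HasDerivWithinAt (posPow (l + 1)) ((l + 1) * posPow l 0) (Ici 0) 0 :=
      (key 0 le_rfl).hasDerivWithinAt.congr (fun y hy => posPow_of_nonneg _ hy)
        (posPow_of_nonneg _ le_rfl)
    have h2 : HasDerivWithinAt (posPow (l + 1)) ((l + 1) * posPow l 0) (Iic 0) 0 := by
      rw [posPow_of_nonpos hl le_rfl, mul_zero]
      exact (hasDerivAt_const (0 : ℝ) (0 : ℝ)).hasDerivWithinAt.congr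
        (fun y hy => posPow_of_nonpos (by linarith) hy) (posPow_of_nonpos (by linarith) le_rfl)
    have := h2.union h1
    rwa [Iic_union_Ici, hasDerivWithinAt_univ] at this
  · refine (key x hx.le).congr_of_eventuallyEq ?_
    filter_upwards [Ioi_mem_nhds hx] with y hy
    exact posPow_of_nonneg _ (le_of_lt hy)

/-! ### Incomplete beta integrals -/

/-- The exponent `θ = 1 / (2 λ + 1)`. -/
def th (l : ℝ) : ℝ := 1 / (2 * l + 1)

lemma th_pos {l : ℝ} (hl : 0 < l) : 0 < th l := by unfold th; positivity

lemma th_lt_one {l : ℝ} (hl : 0 < l) : th l < 1 := by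
  unfold th; rw [div_lt_one (by positivity)]; linarith

lemma two_mul_th {l : ℝ} (hl : 0 < l) : 2 * l * th l = 1 - th l := by
  unfold th; field_simp; ring

/-- The integral `∫_z^1 (1 - y²)₊ ^ l dy`. -/
def betaTail (l z : ℝ) : ℝ := ∫ y in z..1, posPow l (1 - y ^ 2)

/-- The integral `∫_{-1}^1 (1 - y²) ^ l dy`. -/
def betaFull (l : ℝ) : ℝ := betaTail l (-1)

lemma continuous_weight {l : ℝ} (hl : 0 < l) : Continuous fun y : ℝ => posPow l (1 - y ^ 2) :=
  (continuous_posPow hl).comp (by fun_prop)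

lemma hasDerivAt_betaTail {l : ℝ} (hl : 0 < l) (z : ℝ) :
    HasDerivAt (betaTail l) (-posPow l (1 - z ^ 2)) z :=
  intervalIntegral.integral_hasDerivAt_left ((continuous_weight hl).intervalIntegrable _ _)
    ((continuous_weight hl).stronglyMeasurableAtFilter _ _) (continuous_weight hl).continuousAt

lemma continuous_betaTail {l : ℝ} (hl : 0 < l) : Continuous (betaTail l) :=
  continuous_iff_continuousAt.2 fun z => (hasDerivAt_betaTail hl z).continuousAt

lemma integral_eq_zero_of_forall {f : ℝ → ℝ} {a b : ℝ} (h : ∀ x ∈ uIcc a b, f x = 0) :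
    ∫ x in a..b, f x = 0 := by
  rw [intervalIntegral.integral_congr (g := fun _ => (0 : ℝ)) h]; simp

lemma betaTail_of_one_le {l z : ℝ} (hl : 0 < l) (hz : 1 ≤ z) : betaTail l z = 0 := by
  refine integral_eq_zero_of_forall fun y hy => posPow_of_nonpos hl ?_
  rw [uIcc_of_ge hz] at hy
  nlinarith [hy.1]

lemma betaTail_of_le_neg_one {l z : ℝ} (hl : 0 < l) (hz : z ≤ -1) :
    betaTail l z = betaFull l := by
  have h0 : ∫ y in z..(-1), posPow l (1 - y ^ 2) = 0 := by
    refine integral_eq_zero_of_forall fun y hy => posPow_of_nonpos hl ?_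
    rw [uIcc_of_le hz] at hy
    nlinarith [hy.2]
  have := intervalIntegral.integral_add_adjacent_intervals (a := z) (b := -1) (c := 1)
    ((continuous_weight hl).intervalIntegrable (μ := volume) _ _)
    ((continuous_weight hl).intervalIntegrable _ _)
  rw [h0, zero_add] at this
  exact this.symm

lemma betaTail_antitone {l : ℝ} (hl : 0 < l) : Antitone (betaTail l) :=
  antitone_of_hasDerivAt_nonpos (fun z => hasDerivAt_betaTail hl z)
    fun _ => neg_nonpos.2 (posPow_nonneg l _)

lemma betaTail_nonneg {l : ℝ} (hl : 0 < l) (z : ℝ) : 0 ≤ betaTail l z := by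
  rcases le_total 1 z with h | h
  · rw [betaTail_of_one_le hl h]
  · rw [← betaTail_of_one_le hl le_rfl]; exact betaTail_antitone hl h

lemma betaTail_le {l : ℝ} (hl : 0 < l) (z : ℝ) : betaTail l z ≤ betaFull l := by
  rcases le_total (-1) z with h | h
  · exact betaTail_antitone hl h
  · rw [betaTail_of_le_neg_one hl h]

lemma betaFull_pos {l : ℝ} (hl : 0 < l) : 0 < betaFull l := by
  refine intervalIntegral.intervalIntegral_pos_of_pos_on
    ((continuous_weight hl).intervalIntegrable _ _) (fun y hy => posPow_pos l ?_) (by norm_num)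
  nlinarith [hy.1, hy.2]

/-- The integral `∫_1^z (y² - 1)₊ ^ l dy`. -/
def upsPos (l z : ℝ) : ℝ := ∫ y in (1 : ℝ)..z, posPow l (y ^ 2 - 1)

lemma hasDerivAt_upsPos {l : ℝ} (hl : 0 < l) (z : ℝ) :
    HasDerivAt (upsPos l) (posPow l (z ^ 2 - 1)) z := by
  have hc : Continuous fun y : ℝ => posPow l (y ^ 2 - 1) :=
    (continuous_posPow hl).comp (by fun_prop)
  exact intervalIntegral.integral_hasDerivAt_right (hc.intervalIntegrable _ _)
    (hc.stronglyMeasurableAtFilter _ _) hc.continuousAt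

lemma continuous_upsPos {l : ℝ} (hl : 0 < l) : Continuous (upsPos l) :=
  continuous_iff_continuousAt.2 fun z => (hasDerivAt_upsPos hl z).continuousAt

lemma upsPos_eq_zero {l z : ℝ} (hl : 0 < l) (h1 : -1 ≤ z) (h2 : z ≤ 1) : upsPos l z = 0 := by
  refine integral_eq_zero_of_forall fun y hy => posPow_of_nonpos hl ?_
  rw [uIcc_of_ge h2] at hy
  nlinarith [hy.1, hy.2]

lemma upsPos_nonneg {l z : ℝ} (hl : 0 < l) (h1 : -1 ≤ z) : 0 ≤ upsPos l z := by
  rcases le_total 1 z with h | h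
  · exact intervalIntegral.integral_nonneg h fun y _ => posPow_nonneg _ _
  · rw [upsPos_eq_zero hl h1 h]

/-! ### Riemann invariant coordinates

A state with Riemann invariants `a < b` has the Maxwellian `(maxwell₀, meanVel * maxwell₀)`. -/

/-- The normalized position of `k` in the interval `[a, b]`. -/
def zed (k a b : ℝ) : ℝ := (2 * k - a - b) / (b - a)

/-- The mass component of the entropy variable of the entropy `(v - k)₊`. -/
def entVar1 (l k a b : ℝ) : ℝ := betaTail l (zed k a b) / betaFull l

/-- The momentum component of the entropy variable of the entropy `(v - k)₊`. -/
def entVar0 (l k a b : ℝ) : ℝ :=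
  th l * ((b - a) / 2) * posPow (l + 1) (1 - zed k a b ^ 2) / betaFull l - k * entVar1 l k a b

/-- The first eigenvalue of the flux. -/
def eig1 (l a b : ℝ) : ℝ := ((1 + th l) * a + (1 - th l) * b) / 2

/-- The second eigenvalue of the flux. -/
def eig2 (l a b : ℝ) : ℝ := ((1 - th l) * a + (1 + th l) * b) / 2

/-- The derivative of `entVar1` in `a`; `tauB` is the one in `b`. They are the common factors in the
derivatives of `entVar0`, `entVar1` and `dualEnt`, and being positive for `a < k < b` they cancel
from the critical-point equations. -/
def tauA (l k a b : ℝ) : ℝ :=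
  posPow l (1 - zed k a b ^ 2) * (1 - zed k a b) / (b - a) / betaFull l

def tauB (l k a b : ℝ) : ℝ :=
  posPow l (1 - zed k a b ^ 2) * (1 + zed k a b) / (b - a) / betaFull l

/-- The density of the Maxwellian with Riemann invariants `a`, `b`. -/
def maxw0 (l c ξ a b : ℝ) : ℝ := c * posPow l ((ξ - a) * (b - ξ))

/-- The quotient of the components of the Maxwellian with Riemann invariants `a`, `b`. -/
def meanVel (l ξ a b : ℝ) : ℝ := (1 - th l) * ((a + b) / 2) + th l * ξ

/-- The Legendre dual of the kinetic entropy belonging to `(v - k)₊`. -/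
def dualEnt (l c ξ k a b : ℝ) : ℝ :=
  th l * c / betaFull l * |ξ - k| ^ (2 * l + 1) * upsPos l (kernelArg a b ξ k)

/-! ### Derivatives of entropy variables and dual entropy along the Riemann invariants. -/

lemma hasDerivAt_zed_right {a b : ℝ} (k : ℝ) (h : a < b) :
    HasDerivAt (fun s => zed k a s) (-(1 + zed k a b) / (b - a)) b := by
  have hb : b - a ≠ 0 := by linarith
  have := (((hasDerivAt_id b).const_sub (2 * k - a)).div ((hasDerivAt_id b).sub_const a) hb)
  refine this.congr_deriv ?_
  unfold zed; simp only [id]; field_simp; ring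

lemma hasDerivAt_zed_left {a b : ℝ} (k : ℝ) (h : a < b) :
    HasDerivAt (fun s => zed k s b) (-(1 - zed k a b) / (b - a)) a := by
  have hb : b - a ≠ 0 := by linarith
  have := ((((hasDerivAt_id a).const_sub (2 * k)).sub_const b).div
    ((hasDerivAt_id a).const_sub b) hb)
  refine this.congr_deriv ?_
  unfold zed; simp only [id]; field_simp; ring

lemma zed_mul {a b : ℝ} (k : ℝ) (h : a < b) : zed k a b * (b - a) = 2 * k - a - b := by
  have hb : b - a ≠ 0 := by linarith
  unfold zed; field_simp

lemma hasDerivAt_entVar1_right {l a b : ℝ} (hl : 0 < l) (k : ℝ) (h : a < b) :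
    HasDerivAt (fun s => entVar1 l k a s) (tauB l k a b) b := by
  have := ((hasDerivAt_betaTail hl _).comp b (hasDerivAt_zed_right k h)).div_const (betaFull l)
  refine this.congr_deriv ?_
  unfold tauB; ring

lemma hasDerivAt_entVar1_left {l a b : ℝ} (hl : 0 < l) (k : ℝ) (h : a < b) :
    HasDerivAt (fun s => entVar1 l k s b) (tauA l k a b) a := by
  have := ((hasDerivAt_betaTail hl _).comp a (hasDerivAt_zed_left k h)).div_const (betaFull l)
  refine this.congr_deriv ?_
  unfold tauA; ring

lemma th_mul_add_one {l : ℝ} (hl : 0 < l) : th l * (l + 1) = (1 + th l) / 2 := by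
  have := two_mul_th hl; linarith

/-- The algebra shared by both derivatives of `entVar0`: `x = b - a`, `y = 2k - a - b`, `p` is the
weight, and the sign `s` is `1` for the larger and `-1` for the smaller invariant. -/
lemma entVar0_deriv_aux {l z x y k p J s t : ℝ} (hx : x ≠ 0) (hJ : J ≠ 0)
    (ht : t * (l + 1) = (1 + t) / 2) (hz : z * x = y) (hs : s ^ 2 = 1) :
    (t * (s / 2) * ((1 - z ^ 2) * p) + t * (x / 2) * ((l + 1) * p * (2 * z * (1 + s * z) / x))) / J
      - k * (p * (1 + s * z) / x / J) =
    -(k - y / 2 - s * t * x / 2) * (p * (1 + s * z) / x / J) := by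
  subst hz
  field_simp
  linear_combination p * (1 + s * z) * z * x * 2 * ht - t * p * x * z * hs

/-- The derivative of the pair (`entVar0`, `entVar1`) in `b` is `tauB` times `(-eig1, 1)`, so
pairing it with `(1, w)` produces the factor `w - eig1`. Correspondingly `eig2` belongs to `a`. -/
lemma hasDerivAt_entVar0_right {l a b : ℝ} (hl : 0 < l) (k : ℝ) (h : a < b) :
    HasDerivAt (fun s => entVar0 l k a s) (-eig1 l a b * tauB l k a b) b := by
  have hb : b - a ≠ 0 := by linarith
  have h1 := (hasDerivAt_posPow hl (1 - zed k a b ^ 2)).comp b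
    (((hasDerivAt_zed_right k h).pow 2).const_sub 1)
  have h2 := ((((((hasDerivAt_id b).sub_const a).div_const 2).const_mul (th l)).mul h1).div_const
    (betaFull l)).sub ((hasDerivAt_entVar1_right hl k h).const_mul k)
  refine h2.congr_deriv ?_
  have e := entVar0_deriv_aux (k := k) (p := posPow l (1 - zed k a b ^ 2))
    (s := 1) hb (betaFull_pos hl).ne' (th_mul_add_one hl) (zed_mul k h) (by norm_num)
  rw [← posPow_add_one hl] at e
  simp only [Function.comp, id, tauB, eig1, Pi.pow_apply]
  convert e using 3 <;> push_cast <;> ring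

lemma hasDerivAt_entVar0_left {l a b : ℝ} (hl : 0 < l) (k : ℝ) (h : a < b) :
    HasDerivAt (fun s => entVar0 l k s b) (-eig2 l a b * tauA l k a b) a := by
  have hb : b - a ≠ 0 := by linarith
  have h1 := (hasDerivAt_posPow hl (1 - zed k a b ^ 2)).comp a
    (((hasDerivAt_zed_left k h).pow 2).const_sub 1)
  have h2 := ((((((hasDerivAt_id a).const_sub b).div_const 2).const_mul (th l)).mul h1).div_const
    (betaFull l)).sub ((hasDerivAt_entVar1_left hl k h).const_mul k)
  refine h2.congr_deriv ?_
  have e := entVar0_deriv_aux (k := k) (p := posPow l (1 - zed k a b ^ 2))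
    (s := -1) hb (betaFull_pos hl).ne' (th_mul_add_one hl) (zed_mul k h) (by norm_num)
  rw [← posPow_add_one hl] at e
  simp only [Function.comp, id, tauA, eig2, Pi.pow_apply]
  convert e using 3 <;> push_cast <;> ring

/-- This factorization into a part in `ξ` and a part in `k` is what separates the Maxwellian from
the entropy weight in all kernel derivatives. -/
lemma kernelArg_sub_one {a b ξ k : ℝ} (h : a < b) (hk : k ≠ ξ) :
    kernelArg a b ξ k ^ 2 - 1 =
      4 * ((ξ - a) * (b - ξ)) * ((k - a) * (b - k)) / ((b - a) ^ 2 * (ξ - k) ^ 2) := by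
  have h1 : b - a ≠ 0 := by linarith
  have h2 : ξ - k ≠ 0 := sub_ne_zero.2 hk.symm
  have h3 : |ξ - k| ≠ 0 := abs_ne_zero.2 h2
  rw [kernelArg, div_pow, mul_pow, sq_abs]
  field_simp
  ring

lemma hasDerivAt_kernelArg_right {a b ξ k : ℝ} (h : a < b) (hk : k ≠ ξ) :
    HasDerivAt (fun s => kernelArg a s ξ k)
      (2 * (ξ - a) * (k - a) / ((b - a) ^ 2 * |ξ - k|)) b := by
  have h1 : b - a ≠ 0 := by linarith
  have h3 : |ξ - k| ≠ 0 := abs_ne_zero.2 (sub_ne_zero.2 hk.symm)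
  have hn : HasDerivAt (fun s => (ξ + k) * (a + s) - 2 * (a * s + ξ * k)) ((ξ + k) - 2 * a) b := by
    have := (((hasDerivAt_id b).const_add a).const_mul (ξ + k)).sub
      ((((hasDerivAt_id b).const_mul a).add_const (ξ * k)).const_mul 2)
    exact this.congr_deriv (by ring)
  have hd : HasDerivAt (fun s => (s - a) * |ξ - k|) |ξ - k| b :=
    (((hasDerivAt_id b).sub_const a).mul_const _).congr_deriv (one_mul _)
  refine (hn.div hd (mul_ne_zero h1 h3)).congr_deriv ?_
  field_simp
  ring

lemma hasDerivAt_kernelArg_left {a b ξ k : ℝ} (h : a < b) (hk : k ≠ ξ) :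
    HasDerivAt (fun s => kernelArg s b ξ k)
      (-(2 * (b - ξ) * (b - k)) / ((b - a) ^ 2 * |ξ - k|)) a := by
  have h1 : b - a ≠ 0 := by linarith
  have h3 : |ξ - k| ≠ 0 := abs_ne_zero.2 (sub_ne_zero.2 hk.symm)
  have hn : HasDerivAt (fun s => (ξ + k) * (s + b) - 2 * (s * b + ξ * k)) ((ξ + k) - 2 * b) a := by
    have := (((hasDerivAt_id a).add_const b).const_mul (ξ + k)).sub
      ((((hasDerivAt_id a).mul_const b).add_const (ξ * k)).const_mul 2)
    exact this.congr_deriv (by ring)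
  have hd : HasDerivAt (fun s => (b - s) * |ξ - k|) (-|ξ - k|) a :=
    (((hasDerivAt_id a).const_sub b).mul_const _).congr_deriv (by ring)
  refine (hn.div hd (mul_ne_zero h1 h3)).congr_deriv ?_
  field_simp
  ring

lemma one_sub_zed_sq {a b : ℝ} (k : ℝ) (h : a < b) :
    1 - zed k a b ^ 2 = 4 * ((k - a) * (b - k)) / (b - a) ^ 2 := by
  have h1 : b - a ≠ 0 := by linarith
  unfold zed; field_simp; ring

/-- The product of the weights of `ξ` and `k`. -/
lemma posPow_kernelArg {l a b ξ k : ℝ} (h : a < b) (hk : k ≠ ξ)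
    (hin : 0 ≤ (ξ - a) * (b - ξ) ∨ 0 ≤ (k - a) * (b - k)) :
    |ξ - k| ^ (2 * l + 1) * posPow l (kernelArg a b ξ k ^ 2 - 1) =
      |ξ - k| * (posPow l ((ξ - a) * (b - ξ)) * posPow l (1 - zed k a b ^ 2)) := by
  have h1 : 0 < b - a := by linarith
  have h3 : 0 < |ξ - k| := abs_pos.2 (sub_ne_zero.2 hk.symm)
  have e1 : kernelArg a b ξ k ^ 2 - 1 = (|ξ - k| ^ 2)⁻¹ *
      (((ξ - a) * (b - ξ)) * (1 - zed k a b ^ 2)) := by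
    rw [kernelArg_sub_one h hk, one_sub_zed_sq k h, sq_abs]
    field_simp
  -- For two negative factors the left side would be positive and the right side zero; `hin`
  -- excludes this.
  have e2 : posPow l (((ξ - a) * (b - ξ)) * (1 - zed k a b ^ 2)) =
      posPow l ((ξ - a) * (b - ξ)) * posPow l (1 - zed k a b ^ 2) := by
    rcases hin with hin | hin
    · rw [posPow_mul _ _ hin, posPow_of_nonneg _ hin]
    · have : 0 ≤ 1 - zed k a b ^ 2 := by rw [one_sub_zed_sq k h]; positivity
      rw [mul_comm, posPow_mul _ _ this, posPow_of_nonneg _ this, mul_comm]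
  rw [e1, posPow_mul _ _ (by positivity), e2, Real.rpow_add_one h3.ne', Real.inv_rpow (by positivity),
    Real.rpow_mul h3.le, Real.rpow_two]
  have : (|ξ - k| ^ 2) ^ l ≠ 0 := (Real.rpow_pos_of_pos (by positivity) _).ne'
  field_simp

/-- Envelope identity of Legendre duality: since `meanVel - eig1 = θ (ξ - a)`, the value is `maxw0`
times the derivative of `entPair` with `w` frozen at `meanVel`. -/
lemma hasDerivAt_dualEnt_right {l c a b ξ k : ℝ} (hl : 0 < l) (h : a < b) (hk : k ≠ ξ)
    (hin : 0 ≤ (ξ - a) * (b - ξ) ∨ 0 ≤ (k - a) * (b - k)) :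
    HasDerivAt (fun s => dualEnt l c ξ k a s)
      (tauB l k a b * (th l * (ξ - a) * maxw0 l c ξ a b)) b := by
  have h1 : b - a ≠ 0 := by linarith
  have h3 : |ξ - k| ≠ 0 := abs_ne_zero.2 (sub_ne_zero.2 hk.symm)
  have := ((hasDerivAt_upsPos hl _).comp b (hasDerivAt_kernelArg_right h hk)).const_mul
    (th l * c / betaFull l * |ξ - k| ^ (2 * l + 1))
  refine this.congr_deriv ?_
  have e := posPow_kernelArg (l := l) h hk hin
  have e2 : 1 + zed k a b = 2 * (k - a) / (b - a) := by unfold zed; field_simp; ring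
  have hJ := (betaFull_pos hl).ne'
  rw [tauB, maxw0, e2]
  generalize posPow l ((ξ - a) * (b - ξ)) = p at *
  field_simp
  linear_combination (th l * c * (ξ - a) * (k - a)) * e

lemma hasDerivAt_dualEnt_left {l c a b ξ k : ℝ} (hl : 0 < l) (h : a < b) (hk : k ≠ ξ)
    (hin : 0 ≤ (ξ - a) * (b - ξ) ∨ 0 ≤ (k - a) * (b - k)) :
    HasDerivAt (fun s => dualEnt l c ξ k s b)
      (-(tauA l k a b * (th l * (b - ξ) * maxw0 l c ξ a b))) a := by
  have h1 : b - a ≠ 0 := by linarith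
  have h3 : |ξ - k| ≠ 0 := abs_ne_zero.2 (sub_ne_zero.2 hk.symm)
  have := ((hasDerivAt_upsPos hl _).comp a (hasDerivAt_kernelArg_left h hk)).const_mul
    (th l * c / betaFull l * |ξ - k| ^ (2 * l + 1))
  refine this.congr_deriv ?_
  have e := posPow_kernelArg (l := l) h hk hin
  have e2 : 1 - zed k a b = 2 * (b - k) / (b - a) := by unfold zed; field_simp; ring
  have hJ := (betaFull_pos hl).ne'
  rw [tauA, maxw0, e2]
  generalize posPow l ((ξ - a) * (b - ξ)) = p at *
  field_simp
  linear_combination (-(th l * c * (b - ξ) * (b - k))) * e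

/-! ### The entropy kernel -/

/-- A nonnegative derivative is automatically integrable, so densities like `(s - ξ) ^ (l - 1)`,
unbounded at an endpoint for `l < 1`, need no separate estimate. -/
lemma lintegral_deriv_of_nonneg {g g' : ℝ → ℝ} {p q : ℝ} (hpq : p ≤ q)
    (hc : ContinuousOn g (Icc p q)) (hd : ∀ x ∈ Ioo p q, HasDerivAt g (g' x) x)
    (hn : ∀ x ∈ Ioo p q, 0 ≤ g' x) :
    ∫⁻ x in Ioo p q, ENNReal.ofReal (g' x) = ENNReal.ofReal (g q - g p) := by
  have hi := intervalIntegral.integrableOn_deriv_of_nonneg hc hd hn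
  have hi' : IntegrableOn g' (Ioo p q) := hi.mono_set Ioo_subset_Ioc_self
  rw [← ofReal_integral_eq_lintegral_ofReal hi'
    ((ae_restrict_iff' measurableSet_Ioo).2 (ae_of_all _ hn)), ← integral_Ioc_eq_integral_Ioo,
    ← intervalIntegral.integral_of_le hpq,
    intervalIntegral.integral_eq_sub_of_hasDerivAt_of_le hpq hc hd
      ((intervalIntegrable_iff_integrableOn_Ioc_of_le hpq).2 hi)]

/-- The integral `∫_1^z (y² - 1) ^ (l - 1) dy`. -/
def upsInt (l z : ℝ) : ℝ := ∫ y in (1 : ℝ)..z, (y ^ 2 - 1) ^ (l - 1)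

/-- The only singularity is the factor `(y - 1) ^ (l - 1)`, integrable because `l - 1 > -1`; the
factor `(y + 1) ^ (l - 1)` is continuous. -/
lemma intervalIntegrable_upsInt {l z : ℝ} (hl : 0 < l) (hz : 1 ≤ z) :
    IntervalIntegrable (fun y : ℝ => (y ^ 2 - 1) ^ (l - 1)) volume 1 z := by
  have h1 : IntervalIntegrable (fun y : ℝ => (y - 1) ^ (l - 1)) volume 1 z := by
    have := (intervalIntegral.intervalIntegrable_rpow' (a := 0) (b := z - 1) (r := l - 1)
      (by linarith)).comp_sub_right 1
    simpa using this
  have h2 : ContinuousOn (fun y : ℝ => (y + 1) ^ (l - 1)) (uIcc 1 z) := by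
    rw [uIcc_of_le hz]
    intro y hy
    refine ContinuousAt.continuousWithinAt (ContinuousAt.rpow_const (by fun_prop) (Or.inl ?_))
    linarith [hy.1]
  refine (h1.mul_continuousOn h2).congr ?_
  intro y hy
  rw [uIoc_of_le hz] at hy
  have : y ^ 2 - 1 = (y - 1) * (y + 1) := by ring
  simp only [this]
  rw [Real.mul_rpow] <;> linarith [hy.1]

lemma hasDerivAt_upsInt {l z : ℝ} (hl : 0 < l) (hz : 1 < z) :
    HasDerivAt (upsInt l) ((z ^ 2 - 1) ^ (l - 1)) z := by
  refine intervalIntegral.integral_hasDerivAt_right (intervalIntegrable_upsInt hl hz.le) ?_ ?_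
  · exact (Measurable.stronglyMeasurable (by fun_prop)).stronglyMeasurableAtFilter
  · refine ContinuousAt.rpow_const (by fun_prop) (Or.inl ?_)
    nlinarith

lemma continuousOn_upsInt {l : ℝ} (hl : 0 < l) : ContinuousOn (upsInt l) (Ici 1) := by
  intro z hz
  have h2 : (1 : ℝ) ≤ z + 1 := by linarith [mem_Ici.1 hz]
  have h := intervalIntegral.continuousOn_primitive_interval'
    (intervalIntegrable_upsInt hl h2) left_mem_uIcc
  rw [uIcc_of_le h2] at h
  refine (h z ⟨hz, by linarith⟩).mono_of_mem_nhdsWithin ?_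
  rw [mem_nhdsWithin]
  exact ⟨Iio (z + 1), isOpen_Iio, by simp, fun y hy => ⟨hy.2, le_of_lt hy.1⟩⟩

lemma upsInt_nonneg {l z : ℝ} (hz : 1 ≤ z) : 0 ≤ upsInt l z :=
  intervalIntegral.integral_nonneg hz fun y hy => Real.rpow_nonneg (by nlinarith [hy.1]) _

/-- The entropy kernel in terms of the Riemann invariants. -/
def phi (l c a b ξ v : ℝ) : ℝ :=
  if (a < ξ ∧ ξ < b) ∧ (a < v ∧ v < b) then
    (1 - th l) ^ 2 / th l * (c / betaFull l) * |ξ - v| ^ (2 * l - 1) * upsInt l (kernelArg a b ξ v)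
  else 0

/-- Makes `upsInt` vanish at the lower end of the `s`-integral, so that `ofReal_phi` has no boundary
term. -/
lemma kernelArg_max {a ξ v : ℝ} (hξ : a < ξ) (hv : a < v) (hne : v ≠ ξ) :
    kernelArg a (max ξ v) ξ v = 1 := by
  have h3 : 0 < |ξ - v| := abs_pos.2 (sub_ne_zero.2 hne.symm)
  rcases lt_or_gt_of_ne hne with h | h
  · rw [max_eq_left h.le, kernelArg, abs_of_pos (by linarith), div_eq_one_iff_eq]
    · ring
    · have : ξ - a ≠ 0 := by linarith
      have : ξ - v ≠ 0 := by linarith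
      positivity
  · rw [max_eq_right h.le, kernelArg, abs_of_neg (by linarith), div_eq_one_iff_eq]
    · ring
    · have : v - a ≠ 0 := by linarith
      have : -(ξ - v) ≠ 0 := by linarith
      positivity

lemma one_lt_kernelArg {a b ξ v : ℝ} (hξ : a < ξ) (hv : a < v) (hne : v ≠ ξ)
    (hb : max ξ v < b) : 1 < kernelArg a b ξ v := by
  have hb1 := lt_of_le_of_lt (le_max_left _ _) hb
  have hb2 := lt_of_le_of_lt (le_max_right _ _) hb
  have h3 : 0 < |ξ - v| := abs_pos.2 (sub_ne_zero.2 hne.symm)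
  rw [kernelArg, one_lt_div (mul_pos (by linarith) h3)]
  rcases lt_or_gt_of_ne hne with h | h
  · rw [abs_of_pos (by linarith)]
    nlinarith [mul_pos (sub_pos.2 hv) (sub_pos.2 hb1)]
  · rw [abs_of_neg (by linarith)]
    nlinarith [mul_pos (sub_pos.2 hξ) (sub_pos.2 hb2)]

/-- The density in the representation of the entropy kernel by an integral over the larger
Riemann invariant. -/
def phiDensity (l c a ξ v s : ℝ) : ℝ :=
  c * l * (ξ - a) ^ l * (s - ξ) ^ (l - 1) *
    ((1 - th l) / betaFull l * 4 ^ l * (s - a) ^ (-2 * l) * (v - a) ^ l * (s - v) ^ (l - 1))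

/-- Used with `x = ξ - a`, `y = v - a`, `p = s - ξ`, `q = s - v`, `r = s - a`, `d = |ξ - v|`. The
powers of `d` cancel, hence the density splits into a factor in `(ξ, s)` and one in `(v, s)`. -/
lemma phiDensity_aux {x y p q r d : ℝ} (l : ℝ) (hx : 0 < x) (hy : 0 < y) (hp : 0 < p)
    (hq : 0 < q) (hr : 0 < r) (hd : 0 < d) :
    d ^ (2 * l - 1) * ((4 * (x * p) * (y * q) / (r ^ 2 * d ^ 2)) ^ (l - 1) *
      (2 * x * y / (r ^ 2 * d))) =
      4 ^ l / 2 * x ^ l * y ^ l * p ^ (l - 1) * q ^ (l - 1) * r ^ (-2 * l) := by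
  have e1 : (4 * (x * p) * (y * q) / (r ^ 2 * d ^ 2)) ^ (l - 1) =
      4 ^ (l - 1) * (x ^ (l - 1) * p ^ (l - 1)) * (y ^ (l - 1) * q ^ (l - 1)) /
        (r ^ (2 * (l - 1)) * d ^ (2 * (l - 1))) := by
    rw [Real.div_rpow (by positivity) (by positivity), Real.mul_rpow (by positivity) (by positivity),
      Real.mul_rpow (by positivity) (by positivity), Real.mul_rpow (by positivity) (by positivity),
      Real.mul_rpow (by positivity) (by positivity), Real.mul_rpow (by positivity) (by positivity),
      ← Real.rpow_natCast, ← Real.rpow_natCast, ← Real.rpow_mul hr.le, ← Real.rpow_mul hd.le]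
    norm_num
  have e2 : r ^ (-2 * l) = (r ^ (2 * (l - 1)))⁻¹ * (r ^ 2)⁻¹ := by
    rw [← Real.rpow_neg hr.le, ← Real.rpow_natCast, ← Real.rpow_neg hr.le, ← Real.rpow_add hr]
    congr 1; push_cast; ring
  have e3 : d ^ (2 * l - 1) = d ^ (2 * (l - 1)) * d := by
    rw [← Real.rpow_add_one hd.ne']; congr 1; ring
  have e4 : (4 : ℝ) ^ l = 4 ^ (l - 1) * 4 := by
    rw [← Real.rpow_add_one (by norm_num)]; congr 1; ring
  have e5 : x ^ l = x ^ (l - 1) * x := by rw [← Real.rpow_add_one hx.ne']; congr 1; ring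
  have e6 : y ^ l = y ^ (l - 1) * y := by rw [← Real.rpow_add_one hy.ne']; congr 1; ring
  have h1 : r ^ (2 * (l - 1)) ≠ 0 := (Real.rpow_pos_of_pos hr _).ne'
  have h2 : d ^ (2 * (l - 1)) ≠ 0 := (Real.rpow_pos_of_pos hd _).ne'
  rw [e1, e2, e3, e4, e5, e6]
  field_simp
  ring

/-- The diagonal is excluded because `kernelArg` is there a quotient by zero, with value `0 < 1`; it
is a null set in `v`. -/
lemma phi_nonneg {l c a b ξ v : ℝ} (hl : 0 < l) (hc : 0 < c) (hne : v ≠ ξ) :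
    0 ≤ phi l c a b ξ v := by
  unfold phi
  split_ifs with h
  · have h1 := one_lt_kernelArg h.1.1 h.2.1 hne (max_lt h.1.2 h.2.2)
    have := upsInt_nonneg (l := l) h1.le
    have := th_pos hl
    have := betaFull_pos hl
    positivity
  · exact le_rfl

/-- As a function of the larger Riemann invariant `s` the kernel expression starts from zero at `s =
max ξ v`; its derivative is the product density of `phiDensity_aux`. -/
lemma ofReal_phi {l c a b ξ v : ℝ} (hl : 0 < l) (hc : 0 < c) (hξ : a < ξ) (hξb : ξ < b)
    (hv : a < v) (hvb : v < b) (hne : v ≠ ξ) :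
    ENNReal.ofReal (phi l c a b ξ v) =
      ∫⁻ s in Ioo (max ξ v) b, ENNReal.ofReal (phiDensity l c a ξ v s) := by
  have hm : max ξ v < b := max_lt hξb hvb
  have h3 : 0 < |ξ - v| := abs_pos.2 (sub_ne_zero.2 hne.symm)
  have ht := th_pos hl
  have hJ := betaFull_pos hl
  have ht1 := th_lt_one hl
  have hpos : ∀ s ∈ Ioo (max ξ v) b, a < s ∧ ξ < s ∧ v < s := fun s hs =>
    ⟨hξ.trans (lt_of_le_of_lt (le_max_left _ _) hs.1), lt_of_le_of_lt (le_max_left _ _) hs.1,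
      lt_of_le_of_lt (le_max_right _ _) hs.1⟩
  rw [lintegral_deriv_of_nonneg (g := fun s => (1 - th l) ^ 2 / th l * (c / betaFull l) *
    |ξ - v| ^ (2 * l - 1) * upsInt l (kernelArg a s ξ v)) hm.le]
  · congr 1
    rw [phi, if_pos ⟨⟨hξ, hξb⟩, hv, hvb⟩, kernelArg_max hξ hv hne]
    simp [upsInt]
  · refine ContinuousOn.mul continuousOn_const ((continuousOn_upsInt hl).comp ?_ ?_)
    · intro s hs
      have : a < s := hξ.trans_le ((le_max_left _ _).trans hs.1)
      exact (hasDerivAt_kernelArg_right this hne).continuousAt.continuousWithinAt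
    · intro s hs
      rcases eq_or_lt_of_le hs.1 with h | h
      · rw [← h]; exact (kernelArg_max hξ hv hne).ge
      · exact (one_lt_kernelArg hξ hv hne h).le
  · intro s hs
    obtain ⟨h1, h2, h4⟩ := hpos s hs
    have := ((hasDerivAt_upsInt hl (one_lt_kernelArg hξ hv hne hs.1)).comp s
      (hasDerivAt_kernelArg_right h1 hne)).const_mul ((1 - th l) ^ 2 / th l * (c / betaFull l) *
      |ξ - v| ^ (2 * l - 1))
    refine this.congr_deriv ?_
    have e := phiDensity_aux l (sub_pos.2 hξ) (sub_pos.2 hv) (sub_pos.2 h2) (sub_pos.2 h4)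
      (sub_pos.2 h1) h3
    rw [kernelArg_sub_one h1 hne, ← sq_abs (ξ - v), mul_assoc, e, phiDensity]
    have e2 : (1 - th l) ^ 2 / th l = (1 - th l) * (2 * l) := by
      rw [sq, mul_div_assoc]
      congr 1
      rw [← two_mul_th hl]; field_simp
    rw [e2]
    ring
  · intro s hs
    obtain ⟨h1, h2, h4⟩ := hpos s hs
    have g1 := sub_pos.2 h1
    have g2 := sub_pos.2 h2
    have g3 := sub_pos.2 h4
    have g4 := sub_pos.2 hξ
    have g5 := sub_pos.2 hv
    have g6 := sub_pos.2 ht1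
    unfold phiDensity
    positivity

/-- The density in `v` of the conjugate representation. -/
def vDensity (l a s v : ℝ) : ℝ :=
  (1 - th l) / betaFull l * 4 ^ l * (s - a) ^ (-2 * l) * (v - a) ^ l * (s - v) ^ (l - 1)

/-- Tonelli on the region `a < v < s`, `ξ < s < b`. Thanks to the product form of the density the
inner integral in `v` no longer contains `ξ`. -/
lemma lintegral_phi_mul {l c a b ξ : ℝ} (hl : 0 < l) (hc : 0 < c) (hξ : a < ξ) (hξb : ξ < b)
    {S : ℝ → ℝ} (hS : Measurable S) (hS0 : ∀ v, 0 ≤ S v) :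
    ∫⁻ v, ENNReal.ofReal (phi l c a b ξ v * S v) =
      ∫⁻ s in Ioo ξ b, ENNReal.ofReal (c * l * (ξ - a) ^ l * (s - ξ) ^ (l - 1)) *
        ∫⁻ v in Ioo a s, ENNReal.ofReal (vDensity l a s v * S v) := by
  set D : Set (ℝ × ℝ) := {p | (a < p.1 ∧ p.1 < p.2) ∧ ξ < p.2 ∧ p.2 < b} with hD
  have hDm : MeasurableSet D :=
    ((measurableSet_lt measurable_const measurable_fst).inter
      (measurableSet_lt measurable_fst measurable_snd)).inter
      ((measurableSet_lt measurable_const measurable_snd).inter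
      (measurableSet_lt measurable_snd measurable_const))
  set F : ℝ × ℝ → ℝ≥0∞ := D.indicator fun p =>
    ENNReal.ofReal (phiDensity l c a ξ p.1 p.2 * S p.1) with hF
  have hFm : Measurable F := by
    refine Measurable.indicator (Measurable.ennreal_ofReal ?_) hDm
    refine Measurable.mul ?_ (hS.comp measurable_fst)
    unfold phiDensity
    fun_prop
  have h1 : ∀ᵐ v : ℝ, ENNReal.ofReal (phi l c a b ξ v * S v) = ∫⁻ s, F (v, s) := by
    have : ∀ᵐ v : ℝ, v ≠ ξ := by simp [ae_iff]
    filter_upwards [this] with v hne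
    by_cases hv : a < v ∧ v < b
    · rw [ENNReal.ofReal_mul (phi_nonneg hl hc hne), ofReal_phi hl hc hξ hξb hv.1 hv.2 hne,
        ← lintegral_mul_const' _ _ ENNReal.ofReal_ne_top, ← lintegral_indicator measurableSet_Ioo]
      refine lintegral_congr fun s => ?_
      simp only [hF, indicator, hD, mem_ofPred_eq, mem_Ioo, max_lt_iff]
      by_cases h : (ξ < s ∧ v < s) ∧ s < b
      · rw [if_pos h, if_pos ⟨⟨hv.1, h.1.2⟩, h.1.1, h.2⟩, ENNReal.ofReal_mul' (hS0 v)]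
      · rw [if_neg h, if_neg]
        exact fun h' => h ⟨⟨h'.2.1, h'.1.2⟩, h'.2.2⟩
    · rw [phi, if_neg fun h => hv h.2, zero_mul, ENNReal.ofReal_zero]
      refine (lintegral_eq_zero_of_ae_eq_zero (ae_of_all _ fun s => ?_)).symm
      exact indicator_of_notMem (fun h => hv ⟨h.1.1, h.1.2.trans h.2.2⟩) _
  rw [lintegral_congr_ae h1, lintegral_lintegral_swap (f := fun v s => F (v, s)) hFm.aemeasurable,
    ← lintegral_indicator measurableSet_Ioo]
  refine lintegral_congr fun s => ?_
  by_cases hs : s ∈ Ioo ξ b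
  · rw [indicator_of_mem hs, ← lintegral_const_mul' _ _ ENNReal.ofReal_ne_top,
      ← lintegral_indicator measurableSet_Ioo]
    refine lintegral_congr fun v => ?_
    have hpos : 0 ≤ c * l * (ξ - a) ^ l * (s - ξ) ^ (l - 1) := by
      have := sub_pos.2 hξ
      have := sub_pos.2 hs.1
      positivity
    simp only [hF, indicator, hD, mem_ofPred_eq, mem_Ioo]
    by_cases h : a < v ∧ v < s
    · rw [if_pos h, if_pos ⟨h, hs⟩, ← ENNReal.ofReal_mul hpos]
      congr 1
      rw [phiDensity, vDensity]; ring
    · rw [if_neg h, if_neg fun h' => h h'.1]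
  · rw [indicator_of_notMem hs]
    refine lintegral_eq_zero_of_ae_eq_zero (ae_of_all _ fun v => ?_)
    exact indicator_of_notMem (fun h => hs h.2) _

/-- An antiderivative of `-(1 - θ) (1 + y) ^ l (1 - y) ^ (l - 1)`. -/
def wTail (l y : ℝ) : ℝ := betaTail l y + th l * (1 + y) * posPow l (1 - y ^ 2)

/-- An antiderivative of `-wTail`. -/
def wTail2 (l y : ℝ) : ℝ := betaTail l y * (th l - y) + th l * posPow (l + 1) (1 - y ^ 2)

lemma continuous_wTail {l : ℝ} (hl : 0 < l) : Continuous (wTail l) :=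
  (continuous_betaTail hl).add ((by fun_prop : Continuous fun y : ℝ => th l * (1 + y)).mul
    (continuous_weight hl))

lemma hasDerivAt_wTail {l y : ℝ} (hl : 0 < l) (h1 : -1 < y) (h2 : y < 1) :
    HasDerivAt (wTail l) (-((1 - th l) * ((1 + y) ^ l * (1 - y) ^ (l - 1)))) y := by
  have hp : 0 < 1 - y ^ 2 := by nlinarith
  have hw : HasDerivAt (fun y : ℝ => posPow l (1 - y ^ 2))
      (-(2 * y) * l * (1 - y ^ 2) ^ (l - 1)) y := by
    have : HasDerivAt (fun y : ℝ => 1 - y ^ 2) (-(2 * y)) y := by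
      have := (hasDerivAt_pow 2 y).const_sub 1
      simpa using this
    refine (this.rpow_const (p := l) (Or.inl hp.ne')).congr_of_eventuallyEq ?_
    have hc : ContinuousAt (fun y : ℝ => 1 - y ^ 2) y := by fun_prop
    filter_upwards [hc.eventually (lt_mem_nhds hp)] with x hx
    exact posPow_of_nonneg l (le_of_lt hx)
  have hlin : HasDerivAt (fun y : ℝ => th l * (1 + y)) (th l) y := by
    have := ((hasDerivAt_id y).const_add 1).const_mul (th l)
    simpa using this
  refine ((hasDerivAt_betaTail hl y).add (hlin.mul hw)).congr_deriv ?_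
  have e1 : posPow l (1 - y ^ 2) = (1 + y) * (1 - y) * (1 - y ^ 2) ^ (l - 1) := by
    rw [posPow_of_nonneg l hp.le]
    nth_rewrite 1 [← sub_add_cancel l 1]
    rw [Real.rpow_add_one hp.ne']; ring
  have e2 : (1 + y) ^ l * (1 - y) ^ (l - 1) = (1 + y) * (1 - y ^ 2) ^ (l - 1) := by
    have : 1 - y ^ 2 = (1 + y) * (1 - y) := by ring
    rw [this, Real.mul_rpow (by linarith) (by linarith)]
    nth_rewrite 1 [← sub_add_cancel l 1]
    rw [Real.rpow_add_one (by linarith)]; ring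
  rw [e1, e2]
  have := two_mul_th hl
  linear_combination (-(1 + y) * y * (1 - y ^ 2) ^ (l - 1)) * this

lemma hasDerivAt_wTail2 {l : ℝ} (hl : 0 < l) (y : ℝ) :
    HasDerivAt (wTail2 l) (-wTail l y) y := by
  have h1 : HasDerivAt (fun y : ℝ => 1 - y ^ 2) (-(2 * y)) y := by
    have := (hasDerivAt_pow 2 y).const_sub 1
    simpa using this
  have h2 : HasDerivAt (fun y : ℝ => th l - y) (-1) y := by
    simpa using (hasDerivAt_id y).const_sub (th l)
  refine (((hasDerivAt_betaTail hl y).mul h2).add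
    (((hasDerivAt_posPow hl _).comp y h1).const_mul (th l))).congr_deriv ?_
  rw [wTail]
  linear_combination (-2 * y * posPow l (1 - y ^ 2)) * th_mul_add_one hl

lemma wTail_one {l : ℝ} (hl : 0 < l) : wTail l 1 = 0 := by
  rw [wTail, betaTail_of_one_le hl le_rfl, posPow_of_nonpos hl (by norm_num)]; simp

lemma wTail2_one {l : ℝ} (hl : 0 < l) : wTail2 l 1 = 0 := by
  rw [wTail2, betaTail_of_one_le hl le_rfl, posPow_of_nonpos (by linarith) (by norm_num)]; simp

lemma lintegral_vDensity {l a s : ℝ} (hl : 0 < l) (has : a < s) (k : ℝ) :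
    ∫⁻ v in Ioo a s, ENNReal.ofReal (vDensity l a s v * max (v - k) 0) =
      ENNReal.ofReal ((s - a) / 2 / betaFull l * wTail2 l (zed k a s)) := by
  have hr : 0 < s - a := sub_pos.2 has
  have hJ := betaFull_pos hl
  rcases le_or_gt s k with hk | hk
  · have hz : 1 ≤ zed k a s := by rw [zed, one_le_div hr]; linarith
    rw [wTail2, betaTail_of_one_le hl hz, posPow_of_nonpos (by linarith) (by nlinarith)]
    simp only [zero_mul, mul_zero, add_zero, ENNReal.ofReal_zero]
    refine (setLIntegral_congr_fun measurableSet_Ioo (g := fun _ => 0) fun v hv => ?_).trans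
      (by simp)
    simp [max_eq_right (show v - k ≤ 0 by linarith [hv.2])]
  -- The positive part is active exactly for `v > k`, so the integration starts at `m`.
  set m := max a k with hm
  have hms : m < s := max_lt has hk
  have ham : a ≤ m := le_max_left _ _
  have hkm : k ≤ m := le_max_right _ _
  have hred : ∫⁻ v in Ioo a s, ENNReal.ofReal (vDensity l a s v * max (v - k) 0) =
      ∫⁻ v in Ioo m s, ENNReal.ofReal (vDensity l a s v * (v - k)) := by
    rw [← lintegral_indicator measurableSet_Ioo, ← lintegral_indicator measurableSet_Ioo]
    refine lintegral_congr fun v => ?_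
    by_cases h : v ∈ Ioo m s
    · have h' : v ∈ Ioo a s := ⟨ham.trans_lt h.1, h.2⟩
      rw [indicator_of_mem h, indicator_of_mem h', max_eq_left (by linarith [hkm.trans_lt h.1])]
    · rw [indicator_of_notMem h]
      by_cases h' : v ∈ Ioo a s
      · rw [indicator_of_mem h']
        have : v ≤ k := by
          by_contra hvk
          exact h ⟨max_lt h'.1 (not_le.1 hvk), h'.2⟩
        rw [max_eq_right (by linarith)]; simp
      · rw [indicator_of_notMem h']
  have hzlin : ∀ v, HasDerivAt (fun v => zed v a s) (2 / (s - a)) v := fun v => by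
    have := ((((hasDerivAt_id v).const_mul 2).sub_const a).sub_const s).div_const (s - a)
    simpa [zed] using this
  have hone : zed s a s = 1 := by unfold zed; rw [div_eq_one_iff_eq hr.ne']; ring
  -- Integration by parts against `v - k`: `wTail` integrates the density, `wTail2` integrates
  -- `wTail`, and both vanish at the upper end `zed = 1`.
  rw [hred, lintegral_deriv_of_nonneg (g := fun v => -((v - k) * wTail l (zed v a s)
    + (s - a) / 2 * wTail2 l (zed v a s)) / betaFull l) hms.le]
  · congr 1
    simp only [hone, wTail_one hl, wTail2_one hl]
    -- For `k ≥ a` the factor `v - k` vanishes at the lower end. For `k < a` the lower end is `zed =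
    -- -1`, and the result still agrees because `wTail2` is affine on `(-∞, -1]`.
    rcases le_or_gt a k with h | h
    · rw [hm, max_eq_right h]; field_simp; ring
    · rw [hm, max_eq_left h.le]
      have h1 : zed a a s = -1 := by unfold zed; rw [div_eq_iff hr.ne']; ring
      have h2 : zed k a s ≤ -1 := by rw [zed, div_le_iff₀ hr]; linarith
      have h3 : posPow (l + 1) (1 - zed k a s ^ 2) = 0 := posPow_of_nonpos (by linarith) (by nlinarith)
      rw [h1]
      unfold wTail wTail2
      rw [h3, betaTail_of_le_neg_one hl le_rfl, betaTail_of_le_neg_one hl h2,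
        posPow_of_nonpos (l := l) hl (by norm_num), posPow_of_nonpos (l := l + 1) (by linarith) (by norm_num)]
      have := zed_mul k has
      field_simp
      linear_combination (betaFull l) * this
  · refine Continuous.continuousOn ?_
    have hz : Continuous fun v => zed v a s :=
      continuous_iff_continuousAt.2 fun v => (hzlin v).continuousAt
    have hw2 : Continuous (wTail2 l) :=
      continuous_iff_continuousAt.2 fun v => (hasDerivAt_wTail2 hl v).continuousAt
    exact ((((continuous_id.sub continuous_const).mul ((continuous_wTail hl).comp hz)).add
      (continuous_const.mul (hw2.comp hz))).neg).div_const _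
  · intro v hv
    have h1 : -1 < zed v a s := by rw [zed, lt_div_iff₀ hr]; linarith [ham.trans_lt hv.1]
    have h2 : zed v a s < 1 := by rw [zed, div_lt_one hr]; linarith [hv.2]
    have d := (((((hasDerivAt_id v).sub_const k).mul
      ((hasDerivAt_wTail hl h1 h2).comp v (hzlin v))).add
      (((hasDerivAt_wTail2 hl _).comp v (hzlin v)).const_mul ((s - a) / 2))).neg).div_const
      (betaFull l)
    refine d.congr_deriv ?_
    have e1 : 1 + zed v a s = 2 / (s - a) * (v - a) := by unfold zed; field_simp; ring
    have e2 : 1 - zed v a s = 2 / (s - a) * (s - v) := by unfold zed; field_simp; ring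
    have p1 : 0 < v - a := sub_pos.2 (ham.trans_lt hv.1)
    have p2 : 0 < s - v := sub_pos.2 hv.2
    have e3 : (1 + zed v a s) ^ l * (1 - zed v a s) ^ (l - 1) * (2 / (s - a)) =
        4 ^ l * (s - a) ^ (-2 * l) * (v - a) ^ l * (s - v) ^ (l - 1) := by
      have p3 : 0 < 2 / (s - a) := by positivity
      have e4 : (4 : ℝ) ^ l * (s - a) ^ (-2 * l) = (2 / (s - a)) ^ l * (2 / (s - a)) ^ l := by
        rw [neg_mul, Real.rpow_neg hr.le, Real.rpow_mul hr.le, ← Real.inv_rpow (by positivity),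
          ← Real.mul_rpow (by norm_num) (by positivity), ← Real.mul_rpow p3.le p3.le]
        congr 1
        rw [Real.rpow_two]; field_simp; norm_num
      rw [e1, e2, Real.mul_rpow p3.le p1.le, Real.mul_rpow p3.le p2.le, e4]
      have e6 : (2 / (s - a)) ^ l = (2 / (s - a)) ^ (l - 1) * (2 / (s - a)) := by
        rw [← Real.rpow_add_one p3.ne', sub_add_cancel]
      linear_combination (-(2 / (s - a)) ^ l * (v - a) ^ l * (s - v) ^ (l - 1)) * e6
    have e5 : vDensity l a s v = (1 - th l) / betaFull l * ((1 + zed v a s) ^ l *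
        (1 - zed v a s) ^ (l - 1) * (2 / (s - a))) := by
      rw [e3, vDensity]; ring
    rw [e5]
    simp only [id, Function.comp]
    field_simp
    ring
  · intro v hv
    have p1 : 0 < v - a := sub_pos.2 (ham.trans_lt hv.1)
    have p2 : 0 < s - v := sub_pos.2 hv.2
    have p3 : 0 < v - k := sub_pos.2 (hkm.trans_lt hv.1)
    have p4 := sub_pos.2 (th_lt_one hl)
    unfold vDensity
    positivity

/-! ### Kinetic entropies of the entropies `(v - k)₊` -/

lemma neg_one_le_kernelArg {a b ξ k : ℝ} (h : a < b) (hk : k ≠ ξ)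
    (h1 : k < ξ → 0 ≤ (ξ - a) * (b - k)) (h2 : ξ < k → 0 ≤ (k - a) * (b - ξ)) :
    -1 ≤ kernelArg a b ξ k := by
  have h3 : 0 < |ξ - k| := abs_pos.2 (sub_ne_zero.2 hk.symm)
  rw [kernelArg, le_div_iff₀ (mul_pos (by linarith) h3)]
  rcases lt_or_gt_of_ne hk with h' | h'
  · rw [abs_of_pos (by linarith)]; linarith [h1 h']
  · rw [abs_of_neg (by linarith)]; linarith [h2 h']

lemma kernelArg_le_one {a b ξ k : ℝ} (h : a < b) (hk : k ≠ ξ)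
    (h1 : k < ξ → (k - a) * (b - ξ) ≤ 0) (h2 : ξ < k → (ξ - a) * (b - k) ≤ 0) :
    kernelArg a b ξ k ≤ 1 := by
  have h3 : 0 < |ξ - k| := abs_pos.2 (sub_ne_zero.2 hk.symm)
  rw [kernelArg, div_le_iff₀ (mul_pos (by linarith) h3)]
  rcases lt_or_gt_of_ne hk with h' | h'
  · rw [abs_of_pos (by linarith)]; linarith [h1 h']
  · rw [abs_of_neg (by linarith)]; linarith [h2 h']

/-- The entropy variable of `(v - k)₊` applied to `(1, w)`. -/
def entPair (l k a b w : ℝ) : ℝ := entVar0 l k a b + entVar1 l k a b * w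

/-- Identifies the inner integral of `lintegral_vDensity` as the entropy variable paired with `(1,
eig2)`. -/
lemma entPair_eig2 {l a b : ℝ} (k : ℝ) (h : a < b) :
    entPair l k a b (eig2 l a b) = (b - a) / 2 / betaFull l * wTail2 l (zed k a b) := by
  have hz := zed_mul k h
  unfold entPair entVar0 entVar1 wTail2 eig2
  have : k = (zed k a b * (b - a) + a + b) / 2 := by linarith
  generalize zed k a b = z at *
  rw [this]; ring

lemma hasDerivAt_entPair_right {l a b : ℝ} (hl : 0 < l) (k w : ℝ) (h : a < b) :
    HasDerivAt (fun s => entPair l k a s w) (tauB l k a b * (w - eig1 l a b)) b :=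
  ((hasDerivAt_entVar0_right hl k h).add ((hasDerivAt_entVar1_right hl k h).mul_const w)).congr_deriv
    (by ring)

lemma hasDerivAt_entPair_left {l a b : ℝ} (hl : 0 < l) (k w : ℝ) (h : a < b) :
    HasDerivAt (fun s => entPair l k s b w) (tauA l k a b * (w - eig2 l a b)) a :=
  ((hasDerivAt_entVar0_left hl k h).add ((hasDerivAt_entVar1_left hl k h).mul_const w)).congr_deriv
    (by ring)

lemma entPair_of_le {l a b k : ℝ} (hl : 0 < l) (h : a < b) (hk : k ≤ a) (w : ℝ) :
    entPair l k a b w = w - k := by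
  have hz : zed k a b ≤ -1 := by rw [zed, div_le_iff₀ (by linarith)]; linarith
  rw [entPair, entVar0, entVar1, betaTail_of_le_neg_one hl hz,
    posPow_of_nonpos (by linarith) (by nlinarith), div_self (betaFull_pos hl).ne']
  ring

lemma entPair_of_ge {l a b k : ℝ} (hl : 0 < l) (h : a < b) (hk : b ≤ k) (w : ℝ) :
    entPair l k a b w = 0 := by
  have hz : 1 ≤ zed k a b := by rw [zed, le_div_iff₀ (by linarith)]; linarith
  rw [entPair, entVar0, entVar1, betaTail_of_one_le hl hz,
    posPow_of_nonpos (by linarith) (by nlinarith)]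
  ring

lemma dualEnt_eq_zero {l c a b ξ k : ℝ} (hl : 0 < l) (h1 : -1 ≤ kernelArg a b ξ k)
    (h2 : kernelArg a b ξ k ≤ 1) : dualEnt l c ξ k a b = 0 := by
  rw [dualEnt, upsPos_eq_zero hl h1 h2, mul_zero]

lemma maxw0_nonneg {l c : ℝ} (hc : 0 < c) (ξ a b : ℝ) : 0 ≤ maxw0 l c ξ a b :=
  mul_nonneg hc.le (posPow_nonneg _ _)

/-- The closed form vanishes at `b = ξ`, and its derivative in `b` is the density: the variation of
the entropy variable at fixed `w` cancels against `dualEnt`, and the variation of `meanVel` moves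
the argument of `entPair` from `meanVel` to `eig2`. Nonnegativity is recorded because
`ENNReal.ofReal` would otherwise lose information. -/
lemma lintegral_phi_mul_pos_part {l c a b ξ k : ℝ} (hl : 0 < l) (hc : 0 < c) (hξ : a < ξ)
    (hξb : ξ < b) (hk : k ≠ ξ) :
    ∫⁻ v, ENNReal.ofReal (phi l c a b ξ v * max (v - k) 0) =
      ENNReal.ofReal (maxw0 l c ξ a b * entPair l k a b (meanVel l ξ a b)
        - dualEnt l c ξ k a b) ∧
    0 ≤ maxw0 l c ξ a b * entPair l k a b (meanVel l ξ a b) - dualEnt l c ξ k a b := by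
  have hJ := betaFull_pos hl
  have hcoef : ∀ s ∈ Ioo ξ b, 0 ≤ c * l * (ξ - a) ^ l * (s - ξ) ^ (l - 1) := fun s hs => by
    have := sub_pos.2 hξ
    have := sub_pos.2 hs.1
    positivity
  rw [lintegral_phi_mul hl hc hξ hξb (by fun_prop) fun v => le_max_right _ _]
  rw [setLIntegral_congr_fun measurableSet_Ioo (g := fun s => ENNReal.ofReal
    (c * l * (ξ - a) ^ l * (s - ξ) ^ (l - 1) * entPair l k a s (eig2 l a s)))]
  swap
  · intro s hs
    have has := hξ.trans hs.1
    simp only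
    rw [lintegral_vDensity hl has k, ← entPair_eig2 k has, ENNReal.ofReal_mul (hcoef s hs)]
  have hnn : ∀ s ∈ Ioo ξ b, 0 ≤ entPair l k a s (eig2 l a s) := by
    intro s hs
    have has := hξ.trans hs.1
    have hsa : 0 < s - a := sub_pos.2 has
    rw [entPair_eig2 k has]
    refine mul_nonneg (by positivity) ?_
    have hw1 : ∀ y, 0 ≤ wTail l y := by
      intro y
      rcases le_or_gt (-1) y with h | h
      · have := betaTail_nonneg hl y
        have := th_pos hl
        have := posPow_nonneg l (1 - y ^ 2)
        have : 0 ≤ 1 + y := by linarith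
        unfold wTail; positivity
      · rw [wTail, posPow_of_nonpos hl (by nlinarith), mul_zero, add_zero]
        exact betaTail_nonneg hl y
    have hanti : Antitone (wTail2 l) :=
      antitone_of_hasDerivAt_nonpos (fun y => hasDerivAt_wTail2 hl y) fun y => neg_nonpos.2 (hw1 y)
    rcases le_total (zed k a s) 1 with h | h
    · rw [← wTail2_one hl]; exact hanti h
    · rw [wTail2, betaTail_of_one_le hl h, posPow_of_nonpos (by linarith) (by nlinarith)]; simp
  have hD : ∀ s, ξ < s → HasDerivAt (fun s => maxw0 l c ξ a s)
      (c * l * (ξ - a) ^ l * (s - ξ) ^ (l - 1)) s := by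
    intro s hs
    have h1 : HasDerivAt (fun s : ℝ => c * ((ξ - a) ^ l * (s - ξ) ^ l))
        (c * ((ξ - a) ^ l * (l * (s - ξ) ^ (l - 1)))) s := by
      have := (((hasDerivAt_id s).sub_const ξ).rpow_const (p := l)
        (Or.inl (sub_pos.2 hs).ne')).const_mul ((ξ - a) ^ l) |>.const_mul c
      simpa using this
    refine (h1.congr_of_eventuallyEq ?_).congr_deriv (by ring)
    filter_upwards [lt_mem_nhds hs] with t ht
    rw [maxw0, posPow_mul _ _ (sub_pos.2 hξ).le, posPow_of_nonneg _ (sub_pos.2 ht).le]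
  have h0 : maxw0 l c ξ a ξ = 0 := by
    rw [maxw0, sub_self, mul_zero, posPow_of_nonpos hl le_rfl, mul_zero]
  have h1 : dualEnt l c ξ k a ξ = 0 := by
    refine dualEnt_eq_zero hl (neg_one_le_kernelArg hξ hk (fun h => ?_) fun h => ?_)
      (kernelArg_le_one hξ hk (fun h => ?_) fun h => ?_)
    · exact mul_nonneg (by linarith) (by linarith)
    · simp
    · simp
    · exact mul_nonpos_of_nonneg_of_nonpos (by linarith) (by linarith)
  have hcont : ContinuousOn (fun s => maxw0 l c ξ a s * entPair l k a s (meanVel l ξ a s)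
      - dualEnt l c ξ k a s) (Icc ξ b) := by
    intro s hs
    have has := hξ.trans_le hs.1
    refine ContinuousAt.continuousWithinAt (ContinuousAt.sub (ContinuousAt.mul ?_ ?_) ?_)
    · exact Continuous.continuousAt (continuous_const.mul ((continuous_posPow hl).comp (by fun_prop)))
    · refine (hasDerivAt_entVar0_right hl k has).continuousAt.add
        ((hasDerivAt_entVar1_right hl k has).continuousAt.mul ?_)
      unfold meanVel; fun_prop
    · exact (hasDerivAt_dualEnt_right hl has hk
        (Or.inl (mul_nonneg (by linarith) (by linarith [hs.1])))).continuousAt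
  have hder : ∀ s ∈ Ioo ξ b, HasDerivAt (fun s => maxw0 l c ξ a s *
      entPair l k a s (meanVel l ξ a s) - dualEnt l c ξ k a s)
      (c * l * (ξ - a) ^ l * (s - ξ) ^ (l - 1) * entPair l k a s (eig2 l a s)) s := by
    intro s hs
    have has := hξ.trans hs.1
    have hm : HasDerivAt (fun s => meanVel l ξ a s) ((1 - th l) / 2) s := by
      have := ((((hasDerivAt_id s).const_add a).div_const 2).const_mul (1 - th l)).add_const
        (th l * ξ)
      refine this.congr_deriv (by ring)
    have hp := (hasDerivAt_entVar0_right hl k has).add ((hasDerivAt_entVar1_right hl k has).mul hm)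
    refine (((hD s hs.1).mul hp).sub (hasDerivAt_dualEnt_right hl has hk
        (Or.inl (mul_nonneg (by linarith) (by linarith [hs.1]))))).congr_deriv ?_
    have hs1 := sub_pos.2 hs.1
    have e1 : maxw0 l c ξ a s = c * (ξ - a) ^ l * (s - ξ) ^ (l - 1) * (s - ξ) := by
      rw [maxw0, posPow_mul _ _ (sub_pos.2 hξ).le, posPow_of_nonneg _ hs1.le, mul_assoc _ _ (s - ξ),
        ← Real.rpow_add_one hs1.ne', sub_add_cancel]; ring
    -- The identity `2lθ = 1 - θ` makes the term from `meanVel` equal to the derivative of `maxw0`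
    -- times `entVar1 * θ (s - ξ)`, and `eig2 = meanVel + θ (s - ξ)`.
    have e2 := two_mul_th hl
    simp only [Pi.add_apply, Pi.mul_apply]
    rw [e1]
    unfold entPair eig2 eig1 meanVel
    generalize (ξ - a) ^ l = A
    generalize (s - ξ) ^ (l - 1) = B
    linear_combination (-c * A * B * entVar1 l k a s * (s - ξ) / 2) * e2
  have hge : ∀ s ∈ Ioo ξ b, 0 ≤ c * l * (ξ - a) ^ l * (s - ξ) ^ (l - 1) *
      entPair l k a s (eig2 l a s) := fun s hs => mul_nonneg (hcoef s hs) (hnn s hs)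
  have hmono := monotoneOn_of_deriv_nonneg (convex_Icc ξ b) hcont
    (by
      rw [interior_Icc]
      exact fun s hs => (hder s hs).differentiableAt.differentiableWithinAt)
    (by
      rw [interior_Icc]
      exact fun s hs => by rw [(hder s hs).deriv]; exact hge s hs)
    (left_mem_Icc.2 hξb.le) (right_mem_Icc.2 hξb.le) hξb.le
  have hint := lintegral_deriv_of_nonneg hξb.le hcont hder hge
  simp only [h0, h1, zero_mul, sub_zero] at hmono hint
  exact ⟨hint, hmono⟩

/-! ### Measurability, integrability and moments of the entropy kernel. -/

lemma measurable_phi {l : ℝ} (hl : 0 < l) (c a b : ℝ) :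
    Measurable fun p : ℝ × ℝ => phi l c a b p.1 p.2 := by
  classical
  have hU : Measurable ((Ici (1 : ℝ)).indicator (upsInt l)) := by
    rw [← piecewise_eq_indicator]
    exact (continuousOn_upsInt hl).measurable_piecewise continuousOn_const measurableSet_Ici
  have hz : Measurable fun p : ℝ × ℝ => kernelArg a b p.1 p.2 := by
    unfold kernelArg; fun_prop
  have hset : MeasurableSet {p : ℝ × ℝ | (a < p.1 ∧ p.1 < b) ∧ (a < p.2 ∧ p.2 < b)} :=
    ((measurableSet_lt measurable_const measurable_fst).inter
      (measurableSet_lt measurable_fst measurable_const)).inter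
      ((measurableSet_lt measurable_const measurable_snd).inter
      (measurableSet_lt measurable_snd measurable_const))
  have hd : MeasurableSet {p : ℝ × ℝ | p.2 = p.1} := measurableSet_eq_fun measurable_snd measurable_fst
  -- Off the diagonal `upsInt` is evaluated only on `[1, ∞)`, where it is continuous; on the
  -- diagonal its argument is `0` by division by zero and the factor is a constant.
  have : (fun p : ℝ × ℝ => phi l c a b p.1 p.2) = fun p =>
      if (a < p.1 ∧ p.1 < b) ∧ (a < p.2 ∧ p.2 < b) then
        (1 - th l) ^ 2 / th l * (c / betaFull l) * |p.1 - p.2| ^ (2 * l - 1) *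
          (if p.2 = p.1 then upsInt l 0 else (Ici (1 : ℝ)).indicator (upsInt l)
            (kernelArg a b p.1 p.2)) else 0 := by
    ext p
    rw [phi]
    by_cases h : (a < p.1 ∧ p.1 < b) ∧ (a < p.2 ∧ p.2 < b)
    · rw [if_pos h, if_pos h]
      congr 1
      by_cases h' : p.2 = p.1
      · rw [if_pos h', h']; simp [kernelArg]
      · rw [if_neg h', indicator_of_mem]
        exact (one_lt_kernelArg h.1.1 h.2.1 h' (max_lt h.1.2 h.2.2)).le
    · rw [if_neg h, if_neg h]
  rw [this]
  refine Measurable.ite hset (Measurable.mul (by fun_prop) ?_) measurable_const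
  exact Measurable.ite hd measurable_const (hU.comp hz)

lemma measurable_phi_right {l : ℝ} (hl : 0 < l) (c a b ξ : ℝ) :
    Measurable fun v => phi l c a b ξ v :=
  (measurable_phi hl c a b).comp (measurable_const.prodMk measurable_id)

lemma phi_ae_nonneg {l c : ℝ} (hl : 0 < l) (hc : 0 < c) (a b ξ : ℝ) :
    ∀ᵐ v : ℝ, 0 ≤ phi l c a b ξ v := by
  have : ∀ᵐ v : ℝ, v ≠ ξ := by simp [ae_iff]
  filter_upwards [this] with v hne using phi_nonneg hl hc hne

lemma phi_eq_zero {l c a b ξ v : ℝ} (h : ¬((a < ξ ∧ ξ < b) ∧ (a < v ∧ v < b))) :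
    phi l c a b ξ v = 0 := if_neg h

lemma maxw0_eq_zero {l c a b ξ : ℝ} (hl : 0 < l) (hab : a < b) (h : ¬(a < ξ ∧ ξ < b)) :
    maxw0 l c ξ a b = 0 := by
  rw [maxw0, posPow_of_nonpos hl, mul_zero]
  by_contra hc
  refine h ?_
  rcases pos_and_pos_or_neg_and_neg_of_mul_pos (not_le.1 hc) with h | h
  · constructor <;> linarith [h.1, h.2]
  · linarith [h.1, h.2]

lemma integrable_phi_mul_pos_part {l c a b ξ k : ℝ} (hl : 0 < l) (hc : 0 < c) (hξ : a < ξ)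
    (hξb : ξ < b) (hk : k ≠ ξ) :
    Integrable fun v => phi l c a b ξ v * max (v - k) 0 := by
  refine ⟨((measurable_phi_right hl c a b ξ).mul (by fun_prop)).aestronglyMeasurable, ?_⟩
  rw [hasFiniteIntegral_iff_ofReal, (lintegral_phi_mul_pos_part hl hc hξ hξb hk).1]
  · exact ENNReal.ofReal_lt_top
  · filter_upwards [phi_ae_nonneg hl hc a b ξ] with v hv using mul_nonneg hv (le_max_right _ _)

/-- The kinetic entropy belonging to `(v - k)₊`. -/
def kinK (l c ξ k a b : ℝ) : ℝ := ∫ v, phi l c a b ξ v * max (v - k) 0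

lemma kinK_nonneg {l c : ℝ} (hl : 0 < l) (hc : 0 < c) (ξ k a b : ℝ) : 0 ≤ kinK l c ξ k a b :=
  integral_nonneg_of_ae <| by
    filter_upwards [phi_ae_nonneg hl hc a b ξ] with v hv using mul_nonneg hv (le_max_right _ _)

lemma kinK_eq {l c a b ξ k : ℝ} (hl : 0 < l) (hc : 0 < c) (hξ : a < ξ) (hξb : ξ < b)
    (hk : k ≠ ξ) :
    kinK l c ξ k a b =
      maxw0 l c ξ a b * entPair l k a b (meanVel l ξ a b) - dualEnt l c ξ k a b := by
  have h0 : 0 ≤ᵐ[volume] fun v => phi l c a b ξ v * max (v - k) 0 := by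
    filter_upwards [phi_ae_nonneg hl hc a b ξ] with v hv using mul_nonneg hv (le_max_right _ _)
  have h := lintegral_phi_mul_pos_part hl hc hξ hξb hk
  rw [kinK, integral_eq_lintegral_of_nonneg_ae h0
    (integrable_phi_mul_pos_part hl hc hξ hξb hk).aestronglyMeasurable, h.1,
    ENNReal.toReal_ofReal h.2]

lemma kinK_of_le {l c a b ξ k : ℝ} (hl : 0 < l) (hc : 0 < c) (hξ : a < ξ) (hξb : ξ < b)
    (hk : k ≤ a) : kinK l c ξ k a b = maxw0 l c ξ a b * (meanVel l ξ a b - k) := by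
  have hab := hξ.trans hξb
  have hk' : k ≠ ξ := (hk.trans_lt hξ).ne
  rw [kinK_eq hl hc hξ hξb hk', entPair_of_le hl hab hk, dualEnt_eq_zero hl, sub_zero]
  · exact neg_one_le_kernelArg hab hk' (fun h => mul_nonneg (by linarith) (by linarith))
      fun h => by linarith
  · exact kernelArg_le_one hab hk' (fun h => mul_nonpos_of_nonpos_of_nonneg (by linarith)
      (by linarith)) fun h => by linarith

/-- On the support `v > a`, the weight `1` is the difference of the positive parts with `k = a - 1`
and `k = a`. Integrability and mass of the kernel thus follow from the elementary entropies. -/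
lemma phi_eq_sub (l c a b ξ v : ℝ) : phi l c a b ξ v =
    phi l c a b ξ v * max (v - (a - 1)) 0 - phi l c a b ξ v * max (v - a) 0 := by
  by_cases h : (a < ξ ∧ ξ < b) ∧ (a < v ∧ v < b)
  · rw [max_eq_left (by linarith [h.2.1]), max_eq_left (by linarith [h.2.1])]; ring
  · rw [phi_eq_zero h]; ring

lemma integrable_phi {l c : ℝ} (hl : 0 < l) (hc : 0 < c) (a b ξ : ℝ) :
    Integrable fun v => phi l c a b ξ v := by
  by_cases h : a < ξ ∧ ξ < b
  · have := (integrable_phi_mul_pos_part hl hc h.1 h.2 (k := a - 1) (by linarith [h.1])).sub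
      (integrable_phi_mul_pos_part hl hc h.1 h.2 (k := a) h.1.ne)
    exact this.congr (ae_of_all _ fun v => (phi_eq_sub l c a b ξ v).symm)
  · simp only [phi_eq_zero fun h' => h h'.1]
    exact integrable_zero _ _ _

lemma integral_phi {l c a b : ℝ} (hl : 0 < l) (hc : 0 < c) (hab : a < b) (ξ : ℝ) :
    ∫ v, phi l c a b ξ v = maxw0 l c ξ a b := by
  by_cases h : a < ξ ∧ ξ < b
  · rw [integral_congr_ae (ae_of_all _ fun v => phi_eq_sub l c a b ξ v), integral_sub
      (integrable_phi_mul_pos_part hl hc h.1 h.2 (k := a - 1) (by linarith [h.1]))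
      (integrable_phi_mul_pos_part hl hc h.1 h.2 (k := a) h.1.ne)]
    change kinK l c ξ (a - 1) a b - kinK l c ξ a a b = _
    rw [kinK_of_le hl hc h.1 h.2 (by linarith), kinK_of_le hl hc h.1 h.2 le_rfl]
    ring
  · simp only [phi_eq_zero fun h' => h h'.1, maxw0_eq_zero hl hab h, integral_zero]

/-- A measurable weight which is bounded on `(a, b)` is integrable against the kernel. -/
lemma integrable_phi_mul {l c a b ξ : ℝ} (hl : 0 < l) (hc : 0 < c) {S : ℝ → ℝ} (hS : Measurable S)
    {C : ℝ} (hC : ∀ v, a < v → v < b → |S v| ≤ C) :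
    Integrable fun v => phi l c a b ξ v * S v := by
  refine ((integrable_phi hl hc a b ξ).const_mul C).mono'
    ((measurable_phi_right hl c a b ξ).mul hS).aestronglyMeasurable ?_
  filter_upwards [phi_ae_nonneg hl hc a b ξ] with v hv
  by_cases h : (a < ξ ∧ ξ < b) ∧ (a < v ∧ v < b)
  · rw [norm_mul, Real.norm_of_nonneg hv, mul_comm]
    exact mul_le_mul_of_nonneg_right (hC v h.2.1 h.2.2) hv
  · rw [phi_eq_zero h]; simp

lemma integrable_phi_mul_of_continuous {l c : ℝ} (hl : 0 < l) (hc : 0 < c) (a b ξ : ℝ) {S : ℝ → ℝ}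
    (hS : Continuous S) : Integrable fun v => phi l c a b ξ v * S v := by
  obtain ⟨C, hC⟩ := (isCompact_Icc (a := a) (b := b)).exists_bound_of_continuousOn hS.continuousOn
  exact integrable_phi_mul hl hc hS.measurable fun v h1 h2 => hC v ⟨h1.le, h2.le⟩

/-- On the support `v - a` is its own positive part, so `kinK_of_le` with `k = a` applies; other `k`
differ by a multiple of `integral_phi`. Affine S therefore gives affine functions of the Maxwellian.
-/
lemma integral_phi_mul_sub {l c a b : ℝ} (hl : 0 < l) (hc : 0 < c) (hab : a < b) (ξ k : ℝ) :
    ∫ v, phi l c a b ξ v * (v - k) = maxw0 l c ξ a b * (meanVel l ξ a b - k) := by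
  by_cases h : a < ξ ∧ ξ < b
  · have h1 : ∫ v, phi l c a b ξ v * (v - a) = kinK l c ξ a a b := by
      refine integral_congr_ae (ae_of_all _ fun v => ?_)
      by_cases h' : (a < ξ ∧ ξ < b) ∧ (a < v ∧ v < b)
      · simp only [max_eq_left (show 0 ≤ v - a by linarith [h'.2.1])]
      · simp only [phi_eq_zero h', zero_mul]
    have h2 : ∀ v, phi l c a b ξ v * (v - k) =
        phi l c a b ξ v * (v - a) + (a - k) * phi l c a b ξ v := fun v => by ring
    simp only [h2]
    rw [integral_add (integrable_phi_mul_of_continuous hl hc a b ξ (by fun_prop))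
      ((integrable_phi hl hc a b ξ).const_mul _), integral_const_mul, h1, integral_phi hl hc hab,
      kinK_of_le hl hc h.1 h.2 le_rfl]
    ring
  · simp only [phi_eq_zero fun h' => h h'.1, maxw0_eq_zero hl hab h, zero_mul, integral_zero]

lemma le_kinK {l c a b : ℝ} (hl : 0 < l) (hc : 0 < c) (hab : a < b) (ξ k : ℝ) :
    maxw0 l c ξ a b * (meanVel l ξ a b - k) ≤ kinK l c ξ k a b := by
  rw [← integral_phi_mul_sub hl hc hab, kinK]
  refine integral_mono_ae (integrable_phi_mul_of_continuous hl hc a b ξ (by fun_prop))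
    (integrable_phi_mul_of_continuous hl hc a b ξ (by fun_prop)) ?_
  filter_upwards [phi_ae_nonneg hl hc a b ξ] with v hv
  exact mul_le_mul_of_nonneg_left (le_max_left _ _) hv

/-! ### The subdifferential inequality for the entropies `(v - k)₊` -/

/-- One-sided forms of Fermat's rule are needed because the minimizer may lie on the boundary of the
box, where only one direction is admissible. -/
lemma deriv_nonneg_of_right_min {g : ℝ → ℝ} {d x : ℝ} (hd : HasDerivAt g d x)
    (h : ∀ᶠ y in 𝓝[>] x, g x ≤ g y) : 0 ≤ d := by
  have ht := (hasDerivAt_iff_tendsto_slope.1 hd).mono_left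
    (show 𝓝[>] x ≤ 𝓝[≠] x from nhdsWithin_mono x fun y (hy : x < y) => hy.ne')
  refine ge_of_tendsto ht ?_
  filter_upwards [h, self_mem_nhdsWithin] with y hy hxy
  rw [slope_def_field]
  exact div_nonneg (sub_nonneg.2 hy) (sub_nonneg.2 (le_of_lt hxy))

lemma deriv_nonpos_of_left_min {g : ℝ → ℝ} {d x : ℝ} (hd : HasDerivAt g d x)
    (h : ∀ᶠ y in 𝓝[<] x, g x ≤ g y) : d ≤ 0 := by
  have ht := (hasDerivAt_iff_tendsto_slope.1 hd).mono_left
    (show 𝓝[<] x ≤ 𝓝[≠] x from nhdsWithin_mono x fun y (hy : y < x) => hy.ne)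
  refine le_of_tendsto ht ?_
  filter_upwards [h, self_mem_nhdsWithin] with y hy hxy
  rw [slope_def_field]
  exact div_nonpos_of_nonneg_of_nonpos (sub_nonneg.2 hy) (sub_nonpos.2 (le_of_lt hxy))

/-- The flux of a large Maxwellian dominates linear terms. -/
lemma exists_large_box {l c f : ℝ} (hl : 0 < l) (hc : 0 < c) (hf : 0 < f) (X : ℝ) :
    ∀ᶠ m : ℝ in atTop, ∀ y ≤ m, f * (X - (1 - th l) * m / 2 + (1 + th l) * y / 2) <
      th l * y * (c * posPow l (m * y)) := by
  have ht := th_pos hl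
  have ht1 := th_lt_one hl
  -- The threshold `y = q m` is chosen so that below it `(1 + θ) y / 2 ≤ (1 - θ) m / 4` up to the
  -- trivial case of negative `y`; the left side is then negative.
  set q := (1 - th l) / (2 * (1 + th l)) with hq
  have hq0 : 0 < q := div_pos (by linarith) (by linarith)
  have hC : 0 < th l * c * q * q ^ l := by positivity
  have h1 : ∀ᶠ m : ℝ in atTop, 2 * f / (th l * c * q * q ^ l) < m ^ (2 * l) :=
    (tendsto_rpow_atTop (by linarith : 0 < 2 * l)).eventually_gt_atTop _
  filter_upwards [h1, eventually_gt_atTop 0, eventually_gt_atTop (4 * |X| / (1 - th l)),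
    eventually_gt_atTop |X|] with m hm1 hm0 hm2 hm3 y hy
  have hX := le_abs_self X
  rw [div_lt_iff₀ (by linarith)] at hm2
  rcases le_or_gt y (q * m) with h | h
  · have e1 : (1 + th l) * y / 2 ≤ (1 - th l) * m / 4 := by
      have : (1 + th l) * (q * m) = (1 - th l) * m / 2 := by rw [hq]; field_simp
      nlinarith [mul_le_mul_of_nonneg_left h (by linarith : 0 ≤ 1 + th l)]
    have e2 : f * (X - (1 - th l) * m / 2 + (1 + th l) * y / 2) < 0 :=
      mul_neg_of_pos_of_neg hf (by linarith)
    refine e2.trans_le ?_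
    rcases le_or_gt y 0 with h0 | h0
    · rw [posPow_of_nonpos hl (mul_nonpos_of_nonneg_of_nonpos hm0.le h0)]; simp
    · have := posPow_nonneg l (m * y)
      positivity
  -- Here `y` is comparable to `m`: the right side is at least of order `m ^ (2l + 1)`, while the
  -- left side is at most `2 f m`.
  · have hy0 : 0 < y := lt_trans (by positivity) h
    have e1 : f * (X - (1 - th l) * m / 2 + (1 + th l) * y / 2) ≤ f * (2 * m) := by
      refine mul_le_mul_of_nonneg_left ?_ hf.le
      nlinarith
    refine e1.trans_lt ?_
    rw [div_lt_iff₀ hC] at hm1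
    have e2 : m ^ (2 * l) * q ^ l ≤ posPow l (m * y) := by
      rw [posPow_of_nonneg _ (by positivity), two_mul, Real.rpow_add hm0, mul_assoc,
        ← Real.mul_rpow hm0.le hq0.le, ← Real.mul_rpow hm0.le (by positivity)]
      refine Real.rpow_le_rpow (by positivity) ?_ hl.le
      rw [mul_comm m q]
      exact mul_le_mul_of_nonneg_left h.le hm0.le
    have e3 : th l * (q * m) * (c * (m ^ (2 * l) * q ^ l)) ≤ th l * y * (c * posPow l (m * y)) := by
      have := Real.rpow_pos_of_pos hq0 l
      have := Real.rpow_pos_of_pos hm0 (2 * l)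
      gcongr
    nlinarith

/-- The relative entropy of the state with mass `f` and quotient `w` with respect to the
state with Riemann invariants `x`, `y`. -/
def relEnt (l c ξ k K f w x y : ℝ) : ℝ := K - f * entPair l k x y w + dualEnt l c ξ k x y

lemma hasDerivAt_relEnt_left {l c ξ k x y : ℝ} (hl : 0 < l) (hxy : x < y) (hk : k ≠ ξ)
    (h1 : x ≤ k) (h2 : k ≤ y) (K f w : ℝ) :
    HasDerivAt (fun s => relEnt l c ξ k K f w s y)
      (tauA l k x y * (f * (eig2 l x y - w) - th l * (y - ξ) * maxw0 l c ξ x y)) x :=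
  ((((hasDerivAt_entPair_left hl k w hxy).const_mul f).const_sub K).add
    (hasDerivAt_dualEnt_left hl hxy hk
      (Or.inr (mul_nonneg (by linarith) (by linarith))))).congr_deriv (by ring)

lemma hasDerivAt_relEnt_right {l c ξ k x y : ℝ} (hl : 0 < l) (hxy : x < y) (hk : k ≠ ξ)
    (h1 : x ≤ k) (h2 : k ≤ y) (K f w : ℝ) :
    HasDerivAt (fun s => relEnt l c ξ k K f w x s)
      (tauB l k x y * (th l * (ξ - x) * maxw0 l c ξ x y - f * (w - eig1 l x y))) y :=
  ((((hasDerivAt_entPair_right hl k w hxy).const_mul f).const_sub K).add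
    (hasDerivAt_dualEnt_right hl hxy hk
      (Or.inr (mul_nonneg (by linarith) (by linarith))))).congr_deriv (by ring)

lemma one_sub_zed {a b : ℝ} (k : ℝ) (h : a < b) : 1 - zed k a b = 2 * (b - k) / (b - a) := by
  have : b - a ≠ 0 := by linarith
  unfold zed; field_simp; ring

lemma one_add_zed {a b : ℝ} (k : ℝ) (h : a < b) : 1 + zed k a b = 2 * (k - a) / (b - a) := by
  have : b - a ≠ 0 := by linarith
  unfold zed; field_simp; ring

lemma tauA_pos {l k x y : ℝ} (hl : 0 < l) (h1 : x < k) (h2 : k < y) : 0 < tauA l k x y := by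
  have hxy := h1.trans h2
  have e1 := sub_pos.2 h1
  have e2 := sub_pos.2 h2
  have e3 := sub_pos.2 hxy
  have := betaFull_pos hl
  have : 0 < posPow l (1 - zed k x y ^ 2) := posPow_pos l (by rw [one_sub_zed_sq k hxy]; positivity)
  rw [tauA, one_sub_zed k hxy]
  positivity

lemma tauB_pos {l k x y : ℝ} (hl : 0 < l) (h1 : x < k) (h2 : k < y) : 0 < tauB l k x y := by
  have hxy := h1.trans h2
  have e1 := sub_pos.2 h1
  have e2 := sub_pos.2 h2
  have e3 := sub_pos.2 hxy
  have := betaFull_pos hl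
  have : 0 < posPow l (1 - zed k x y ^ 2) := posPow_pos l (by rw [one_sub_zed_sq k hxy]; positivity)
  rw [tauB, one_add_zed k hxy]
  positivity

lemma dualEnt_nonneg {l c ξ k x y : ℝ} (hl : 0 < l) (hc : 0 < c) (hxy : x < y) (hk : k ≠ ξ)
    (h1 : x ≤ k) (h2 : k ≤ y) : 0 ≤ dualEnt l c ξ k x y := by
  have := th_pos hl
  have := betaFull_pos hl
  have := upsPos_nonneg hl (neg_one_le_kernelArg hxy hk
    (fun h => mul_nonneg (by linarith) (by linarith)) fun h => mul_nonneg (by linarith) (by linarith))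
  rw [dualEnt]
  positivity

/-- Since `entVar1` lies in `[0, 1]`, both lower bounds on `K` absorb the term `f * entVar1 * (w -
k)`, and `dualEnt ≥ 0`. The remainder tends to zero at the diagonal and vanishes at `x = k` and at
`y = k`, which keeps a negative minimum away from these sets. -/
lemma relEnt_ge {l c ξ k K f w x y : ℝ} (hl : 0 < l) (hc : 0 < c) (hxy : x < y)
    (hk : k ≠ ξ) (h1 : x ≤ k) (h2 : k ≤ y) (hK0 : 0 ≤ K) (hK1 : f * (w - k) ≤ K) :
    -(f * (th l * ((y - x) / 2) / betaFull l) * posPow (l + 1) (1 - zed k x y ^ 2))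
      ≤ relEnt l c ξ k K f w x y := by
  have hd := dualEnt_nonneg hl hc hxy hk h1 h2
  have hJ := betaFull_pos hl
  have hB0 : 0 ≤ entVar1 l k x y := div_nonneg (betaTail_nonneg hl _) hJ.le
  have hB1 : entVar1 l k x y ≤ 1 := (div_le_one hJ).2 (betaTail_le hl _)
  rw [relEnt, entPair, entVar0]
  have e : f * entVar1 l k x y * (w - k) ≤ K := by nlinarith
  linarith [show f * (th l * ((y - x) / 2) / betaFull l) * posPow (l + 1) (1 - zed k x y ^ 2) =
    f * (th l * ((y - x) / 2) * posPow (l + 1) (1 - zed k x y ^ 2) / betaFull l) by ring]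

/-- The sum is recovered from `(p + q)² = (p - q)² + 4pq` and its sign. -/
lemma eq_of_sum_prod {p q p' q' : ℝ} (h1 : 0 < p + q) (h2 : 0 < p' + q') (hd : p - q = p' - q')
    (hp : p * q = p' * q') : p = p' := by
  have : (p + q) ^ 2 = (p' + q') ^ 2 := by linear_combination (p - q + p' - q') * hd + 4 * hp
  have := (sq_eq_sq₀ h1.le h2.le).1 this
  linarith

lemma maxw0_pos_iff {l c ξ x y : ℝ} (hl : 0 < l) (hc : 0 < c) (hxy : x < y) :
    0 < maxw0 l c ξ x y ↔ x < ξ ∧ ξ < y := by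
  constructor
  · intro h
    by_contra h'
    rw [maxw0_eq_zero hl hxy h'] at h
    exact h.false
  · intro h
    exact mul_pos hc (posPow_pos l (mul_pos (sub_pos.2 h.1) (sub_pos.2 h.2)))

/-- The Riemann invariants are determined by the value of the Maxwellian at one point. -/
lemma maxw_inj {l c ξ a b x y : ℝ} (hl : 0 < l) (hc : 0 < c) (hξ : a < ξ) (hξb : ξ < b)
    (hxy : x < y) (h0 : maxw0 l c ξ x y = maxw0 l c ξ a b)
    (h1 : meanVel l ξ x y = meanVel l ξ a b) : x = a ∧ y = b := by
  have hpos : 0 < maxw0 l c ξ x y := by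
    rw [h0]; exact (maxw0_pos_iff hl hc (hξ.trans hξb)).2 ⟨hξ, hξb⟩
  have hx := (maxw0_pos_iff hl hc hxy).1 hpos
  have hp : (ξ - x) * (y - ξ) = (ξ - a) * (b - ξ) := by
    have := mul_left_cancel₀ hc.ne' h0
    rw [posPow_of_nonneg _ (mul_pos (sub_pos.2 hx.1) (sub_pos.2 hx.2)).le,
      posPow_of_nonneg _ (mul_pos (sub_pos.2 hξ) (sub_pos.2 hξb)).le] at this
    exact (Real.rpow_left_inj (mul_pos (sub_pos.2 hx.1) (sub_pos.2 hx.2)).le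
      (mul_pos (sub_pos.2 hξ) (sub_pos.2 hξb)).le hl.ne').1 this
  have hs : x + y = a + b := by
    unfold meanVel at h1
    have : (1 - th l) ≠ 0 := by linarith [th_lt_one hl]
    have := mul_left_cancel₀ this (by linarith : (1 - th l) * ((x + y) / 2) = (1 - th l) * ((a + b) / 2))
    linarith
  have := eq_of_sum_prod (by linarith) (by linarith) (by linarith) hp
  constructor <;> linarith

lemma continuousAt_relEnt {l c ξ k K f w : ℝ} (hl : 0 < l) (hk : k ≠ ξ) {p : ℝ × ℝ}
    (hp' : p.2 - p.1 ≠ 0) :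
    ContinuousAt (fun p : ℝ × ℝ => relEnt l c ξ k K f w p.1 p.2) p := by
  have hz : ContinuousAt (fun p : ℝ × ℝ => zed k p.1 p.2) p := by
    unfold zed; exact ContinuousAt.div (by fun_prop) (by fun_prop) hp'
  have h1 : ContinuousAt (fun p : ℝ × ℝ => entVar1 l k p.1 p.2) p :=
    ((continuous_betaTail hl).continuousAt.comp (f := fun p : ℝ × ℝ => zed k p.1 p.2) hz).div_const _
  have h2 : ContinuousAt (fun p : ℝ × ℝ => posPow (l + 1) (1 - zed k p.1 p.2 ^ 2)) p :=
    (continuous_posPow (by linarith : 0 < l + 1)).continuousAt.comp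
      (f := fun p : ℝ × ℝ => 1 - zed k p.1 p.2 ^ 2) (by fun_prop)
  have h3 : ContinuousAt (fun p : ℝ × ℝ => entVar0 l k p.1 p.2) p := by
    unfold entVar0; fun_prop
  have h4 : ContinuousAt (fun p : ℝ × ℝ => kernelArg p.1 p.2 ξ k) p := by
    unfold kernelArg
    exact ContinuousAt.div (by fun_prop) (by fun_prop)
      (mul_ne_zero hp' (abs_ne_zero.2 (sub_ne_zero.2 hk.symm)))
  have h5 : ContinuousAt (fun p : ℝ × ℝ => dualEnt l c ξ k p.1 p.2) p :=
    continuousAt_const.mul ((continuous_upsPos hl).continuousAt.comp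
      (f := fun p : ℝ × ℝ => kernelArg p.1 p.2 ξ k) h4)
  unfold relEnt entPair
  fun_prop

/-- If the relative entropy takes a negative value, then it has a critical point with negative
value. -/
lemma exists_critical {l c ξ k K f w α β : ℝ} (hl : 0 < l) (hc : 0 < c) (hf : 0 < f)
    (hK0 : 0 ≤ K) (hK1 : f * (w - k) ≤ K) (hk : k ≠ ξ) (hα : α < k) (hβ : k < β)
    (hneg : relEnt l c ξ k K f w α β < 0) :
    ∃ x y, x < y ∧ relEnt l c ξ k K f w x y < 0 ∧
      f * (eig2 l x y - w) = th l * (y - ξ) * maxw0 l c ξ x y ∧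
      th l * (ξ - x) * maxw0 l c ξ x y = f * (w - eig1 l x y) := by
  have ht := th_pos hl
  have hJ := betaFull_pos hl
  obtain ⟨e, he⟩ : ∃ e, e = -relEnt l c ξ k K f w α β := ⟨_, rfl⟩
  have he0 : 0 < e := by linarith
  obtain ⟨C, hC⟩ : ∃ C, C = f * (th l / 2 / betaFull l) := ⟨_, rfl⟩
  have hC0 : 0 < C := by rw [hC]; positivity
  -- At distance `δ` from the diagonal `relEnt ≥ -C δ ≥ -e / 2`, above the value `-e` at `(α, β)`;
  -- also `δ ≤ β - α` keeps `(α, β)` admissible.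
  obtain ⟨δ, hδ⟩ : ∃ δ, δ = min (β - α) (e / (2 * C)) := ⟨_, rfl⟩
  have hδ0 : 0 < δ := hδ ▸ lt_min (by linarith) (by positivity)
  have hge : ∀ x y, x < y → x ≤ k → k ≤ y → -(C * (y - x)) ≤ relEnt l c ξ k K f w x y := by
    intro x y hxy h1 h2
    refine le_trans ?_ (relEnt_ge hl hc hxy hk h1 h2 hK0 hK1)
    have hp : posPow (l + 1) (1 - zed k x y ^ 2) ≤ 1 := by
      have := posPow_mono (by linarith : 0 < l + 1) (by nlinarith [sq_nonneg (zed k x y)] :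
        1 - zed k x y ^ 2 ≤ 1)
      rwa [posPow_of_nonneg _ zero_le_one, Real.one_rpow] at this
    have hy : 0 < y - x := sub_pos.2 hxy
    have h3 : f * (th l * ((y - x) / 2) / betaFull l) = C * (y - x) := by rw [hC]; ring
    rw [h3]
    have : 0 < C * (y - x) := by positivity
    nlinarith
  -- `hm1` and `hm2` control the edges `x = ξ - m` and `y = ξ + m`; the other conditions place `α`,
  -- `β` and `k` inside the box.
  obtain ⟨m, hm1, hm2, hm3, hm4, hm5, hm6⟩ := ((exists_large_box hl hc hf (ξ - w)).and
    ((exists_large_box hl hc hf (w - ξ)).and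
    ((eventually_gt_atTop (ξ - α)).and ((eventually_gt_atTop (β - ξ)).and
    ((eventually_gt_atTop (ξ - k)).and (eventually_gt_atTop (k - ξ))))))).exists
  obtain ⟨X, hX⟩ : ∃ X : Set (ℝ × ℝ),
    X = (Icc (ξ - m) k ×ˢ Icc k (ξ + m)) ∩ {p | δ ≤ p.2 - p.1} := ⟨_, rfl⟩
  have hXc : IsCompact X := by
    rw [hX]
    exact (isCompact_Icc.prod isCompact_Icc).inter_right
      (isClosed_le continuous_const (continuous_snd.sub continuous_fst))
  have hXm : ∀ p : ℝ × ℝ, p ∈ X ↔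
      ((ξ - m ≤ p.1 ∧ p.1 ≤ k) ∧ k ≤ p.2 ∧ p.2 ≤ ξ + m) ∧ δ ≤ p.2 - p.1 := by
    intro p; rw [hX]; exact Iff.rfl
  have hmem : (α, β) ∈ X := (hXm _).2 ⟨⟨⟨by linarith, hα.le⟩, ⟨hβ.le, by linarith⟩⟩,
    hδ ▸ min_le_left _ _⟩
  have hcont : ContinuousOn (fun p : ℝ × ℝ => relEnt l c ξ k K f w p.1 p.2) X := by
    intro p hp
    have := ((hXm p).1 hp).2
    exact (continuousAt_relEnt hl hk (by linarith)).continuousWithinAt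
  obtain ⟨⟨x, y⟩, hxyX, hmin'⟩ := hXc.exists_isMinOn ⟨_, hmem⟩ hcont
  have hmin : ∀ p ∈ X, relEnt l c ξ k K f w x y ≤ relEnt l c ξ k K f w p.1 p.2 :=
    isMinOn_iff.1 hmin'
  have hle : ∀ x' y', ξ - m ≤ x' → x' ≤ k → k ≤ y' → y' ≤ ξ + m → δ ≤ y' - x' →
      relEnt l c ξ k K f w x y ≤ relEnt l c ξ k K f w x' y' :=
    fun x' y' h1 h2 h3 h4 h5 => hmin (x', y') ((hXm (x', y')).2 ⟨⟨⟨h1, h2⟩, h3, h4⟩, h5⟩)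
  have hneg' : relEnt l c ξ k K f w x y ≤ -e := by
    have : relEnt l c ξ k K f w x y ≤ relEnt l c ξ k K f w α β := hmin (α, β) hmem
    linarith
  obtain ⟨⟨⟨hx1, hx2⟩, hy1, hy2⟩, hxyδ⟩ := (hXm _).1 hxyX
  simp only at hx1 hx2 hy1 hy2 hxyδ
  have hxy : x < y := by linarith
  have hzero : zed k x y ^ 2 ≠ 1 := by
    intro hz
    have := relEnt_ge hl hc hxy hk hx2 hy1 hK0 hK1
    rw [hz, sub_self, posPow_of_nonpos (by linarith) le_rfl, mul_zero, neg_zero] at this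
    linarith
  have hxk : x < k := by
    refine lt_of_le_of_ne hx2 fun h => hzero ?_
    have h2 : k - x = 0 := by linarith
    have := one_sub_zed_sq k hxy
    rw [h2] at this
    simp at this
    linarith
  have hky : k < y := by
    refine lt_of_le_of_ne hy1 fun h => hzero ?_
    have h2 : y - k = 0 := by linarith
    have := one_sub_zed_sq k hxy
    rw [h2] at this
    simp at this
    linarith
  have hδ' : δ < y - x := by
    refine lt_of_le_of_ne hxyδ fun h => ?_
    have h1 := hge x y hxy hx2 hy1
    rw [← h] at h1
    have h2 : δ * (2 * C) ≤ e := (le_div_iff₀ (by positivity)).1 (hδ ▸ min_le_right _ _)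
    nlinarith
  have hA := tauA_pos hl hxk hky
  have hB := tauB_pos hl hxk hky
  have dA := hasDerivAt_relEnt_left (c := c) hl hxy hk hx2 hy1 K f w
  have dB := hasDerivAt_relEnt_right (c := c) hl hxy hk hx2 hy1 K f w
  -- Moving inwards is admissible since `x < k < y` and `δ < y - x`, even if the minimizer lies on
  -- an outer edge of the box.
  have rA : 0 ≤ f * (eig2 l x y - w) - th l * (y - ξ) * maxw0 l c ξ x y := by
    refine nonneg_of_mul_nonneg_right (deriv_nonneg_of_right_min dA ?_) hA
    have : Iio (min k (y - δ)) ∈ 𝓝 x := Iio_mem_nhds (lt_min hxk (by linarith))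
    filter_upwards [self_mem_nhdsWithin, nhdsWithin_le_nhds this] with s hs1 hs2
    have hs3 := lt_min_iff.1 (mem_Iio.1 hs2)
    exact hle s y (hx1.trans (le_of_lt hs1)) hs3.1.le hy1 hy2 (by linarith [hs3.2])
  have rB : th l * (ξ - x) * maxw0 l c ξ x y - f * (w - eig1 l x y) ≤ 0 := by
    refine nonpos_of_mul_nonpos_right (deriv_nonpos_of_left_min dB ?_) hB
    have : Ioi (max k (x + δ)) ∈ 𝓝 y := Ioi_mem_nhds (max_lt hky (by linarith))
    filter_upwards [self_mem_nhdsWithin, nhdsWithin_le_nhds this] with s hs1 hs2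
    have hs3 := max_lt_iff.1 (mem_Ioi.1 hs2)
    exact hle x s hx1 hx2 hs3.1.le ((le_of_lt hs1).trans hy2) (by linarith [hs3.2])
  -- On the edge `x = ξ - m` the large-box estimate gives the strict opposite of `rA`; the edge for
  -- `y` is symmetric. Afterwards outward moves are admissible as well.
  have hx1' : ξ - m < x := by
    refine lt_of_le_of_ne hx1 fun h => ?_
    have := hm1 (y - ξ) (by linarith)
    rw [← h, maxw0, eig2] at rA
    have e1 : (ξ - (ξ - m)) * (y - ξ) = m * (y - ξ) := by ring
    rw [e1] at rA
    nlinarith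
  have hy2' : y < ξ + m := by
    refine lt_of_le_of_ne hy2 fun h => ?_
    have := hm2 (ξ - x) (by linarith)
    rw [h, maxw0, eig1] at rB
    have e1 : (ξ - x) * (ξ + m - ξ) = m * (ξ - x) := by ring
    rw [e1] at rB
    nlinarith
  have rA' : f * (eig2 l x y - w) - th l * (y - ξ) * maxw0 l c ξ x y ≤ 0 := by
    refine nonpos_of_mul_nonpos_right (deriv_nonpos_of_left_min dA ?_) hA
    filter_upwards [self_mem_nhdsWithin, nhdsWithin_le_nhds (Ioi_mem_nhds hx1')] with s hs1 hs2
    have hs1' : s < x := hs1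
    exact hle s y (le_of_lt hs2) (hs1'.le.trans hx2) hy1 hy2 (by linarith)
  have rB' : 0 ≤ th l * (ξ - x) * maxw0 l c ξ x y - f * (w - eig1 l x y) := by
    refine nonneg_of_mul_nonneg_right (deriv_nonneg_of_right_min dB ?_) hB
    filter_upwards [self_mem_nhdsWithin, nhdsWithin_le_nhds (Iio_mem_nhds hy2')] with s hs1 hs2
    have hs1' : y < s := hs1
    exact hle x s hx1 hx2 (hy1.trans hs1'.le) (le_of_lt hs2) (by linarith)
  exact ⟨x, y, hxy, by linarith, by linarith, by linarith⟩

lemma relEnt_nonneg {l c a b ξ k α β : ℝ} (hl : 0 < l) (hc : 0 < c) (hξ : a < ξ) (hξb : ξ < b)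
    (hk : k ≠ ξ) (hα : α < k) (hβ : k < β) :
    0 ≤ relEnt l c ξ k (kinK l c ξ k a b) (maxw0 l c ξ a b) (meanVel l ξ a b) α β := by
  have hab := hξ.trans hξb
  have hf : 0 < maxw0 l c ξ a b := (maxw0_pos_iff hl hc hab).2 ⟨hξ, hξb⟩
  by_contra! hneg
  obtain ⟨x, y, hxy, hneg', qA, qB⟩ := exists_critical hl hc hf (kinK_nonneg hl hc ξ k a b)
    (le_kinK hl hc hab ξ k) hk hα hβ hneg
  unfold eig2 at qA
  unfold eig1 at qB
  -- Adding the critical equations gives `θ (y - x)` times the difference of the masses; once the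
  -- masses agree, either equation yields the quotient.
  have hM : maxw0 l c ξ x y = maxw0 l c ξ a b := by
    have h1 : th l * (y - x) ≠ 0 := mul_ne_zero (th_pos hl).ne' (by linarith)
    exact mul_left_cancel₀ h1 (by linear_combination qB - qA)
  have hW : meanVel l ξ x y = meanVel l ξ a b := by
    rw [hM] at qA
    refine mul_left_cancel₀ hf.ne' ?_
    rw [meanVel]
    linear_combination qA
  obtain ⟨rfl, rfl⟩ := maxw_inj hl hc hξ hξb hxy hM hW
  rw [relEnt, kinK_eq hl hc hξ hξb hk] at hneg'
  linarith

/-- The kinetic entropy of `(v - k)₊` lies above its supporting plane at a Maxwellian. -/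
lemma kinK_subgradient {l c a b ξ k α β : ℝ} (hl : 0 < l) (hc : 0 < c) (hab : a < b)
    (hk : k ≠ ξ) (hαβ : α < β) :
    kinK l c ξ k α β - maxw0 l c ξ α β * entPair l k α β (meanVel l ξ α β) ≤
      kinK l c ξ k a b - maxw0 l c ξ a b * entPair l k α β (meanVel l ξ a b) := by
  rcases le_or_gt k α with h | h
  · rw [entPair_of_le hl hαβ h, entPair_of_le hl hαβ h]
    have h2 : kinK l c ξ k α β = maxw0 l c ξ α β * (meanVel l ξ α β - k) := by
      rw [← integral_phi_mul_sub hl hc hαβ]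
      refine integral_congr_ae (ae_of_all _ fun v => ?_)
      by_cases h' : (α < ξ ∧ ξ < β) ∧ (α < v ∧ v < β)
      · simp only [max_eq_left (show 0 ≤ v - k by linarith [h'.2.1])]
      · simp only [phi_eq_zero h', zero_mul]
    linarith [le_kinK (k := k) hl hc hab ξ]
  rcases le_or_gt β k with h' | h'
  · rw [entPair_of_ge hl hαβ h', entPair_of_ge hl hαβ h']
    have h2 : kinK l c ξ k α β = 0 := by
      refine integral_eq_zero_of_ae (ae_of_all _ fun v => ?_)
      by_cases h'' : (α < ξ ∧ ξ < β) ∧ (α < v ∧ v < β)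
      · simp only [max_eq_right (show v - k ≤ 0 by linarith [h''.2.2]), mul_zero, Pi.zero_apply]
      · simp only [phi_eq_zero h'', zero_mul, Pi.zero_apply]
    rw [h2]
    linarith [kinK_nonneg hl hc ξ k a b]
  -- For `ξ` inside the support this is `kinK_eq`; outside, `kinK`, `maxw0` and `dualEnt` all
  -- vanish.
  have hL : kinK l c ξ k α β - maxw0 l c ξ α β * entPair l k α β (meanVel l ξ α β) =
      -dualEnt l c ξ k α β := by
    by_cases hin : α < ξ ∧ ξ < β
    · rw [kinK_eq hl hc hin.1 hin.2 hk]; ring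
    · have h1 : kinK l c ξ k α β = 0 := by
        exact integral_eq_zero_of_ae (ae_of_all _ fun v => by
          simp only [phi_eq_zero fun h => hin h.1, zero_mul, Pi.zero_apply])
      rw [h1, maxw0_eq_zero hl hαβ hin, dualEnt_eq_zero hl]
      · simp
      · exact neg_one_le_kernelArg hαβ hk (fun _ => mul_nonneg (by linarith) (by linarith))
          fun _ => mul_nonneg (by linarith) (by linarith)
      · refine kernelArg_le_one hαβ hk (fun h1 => ?_) fun h1 => ?_
        · have : β ≤ ξ := by
            by_contra h2
            exact hin ⟨h.trans h1, not_le.1 h2⟩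
          exact mul_nonpos_of_nonneg_of_nonpos (by linarith) (by linarith)
        · have : ξ ≤ α := by
            by_contra h2
            exact hin ⟨not_le.1 h2, h1.trans h'⟩
          exact mul_nonpos_of_nonpos_of_nonneg (by linarith) (by linarith)
  rw [hL]
  by_cases hin : a < ξ ∧ ξ < b
  · have := relEnt_nonneg hl hc hin.1 hin.2 hk h h'
    rw [relEnt] at this
    linarith
  · rw [maxw0_eq_zero hl hab hin, zero_mul, sub_zero]
    linarith [dualEnt_nonneg hl hc hαβ hk h.le h'.le, kinK_nonneg hl hc ξ k a b]

/-! ### Superposition of the entropies `(v - k)₊` -/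

/-- The kinetic entropy of `S` in Riemann invariants. -/
def kinS (l c : ℝ) (S : ℝ → ℝ) (a b ξ : ℝ) : ℝ := ∫ v, phi l c a b ξ v * S v

/-- The kinetic entropy is linear in S and the plane is linear in its slopes, so the inequality
survives averaging in `k`; Fubini moves the average inside the kernel integral. An almost everywhere
inequality suffices, which disposes of `k = ξ`. -/
lemma kinS_subgradient_integral {l c α β : ℝ} {ν : Measure ℝ} [SFinite ν] {q : ℝ → ℝ → ℝ}
    {p₀ p₁ : ℝ → ℝ} (hp₀ : Integrable p₀ ν) (hp₁ : Integrable p₁ ν)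
    (hq : ∀ a b ξ, Integrable (fun x : ℝ × ℝ => phi l c a b ξ x.1 * q x.2 x.1) (volume.prod ν))
    (hineq : ∀ a b ξ, a < b → ∀ᵐ k ∂ν,
      kinS l c (q k) α β ξ - maxw0 l c ξ α β * (p₀ k + p₁ k * meanVel l ξ α β) ≤
        kinS l c (q k) a b ξ - maxw0 l c ξ a b * (p₀ k + p₁ k * meanVel l ξ a b))
    {a b : ℝ} (hab : a < b) (ξ : ℝ) :
    kinS l c (fun v => ∫ k, q k v ∂ν) α β ξ -
        maxw0 l c ξ α β * ((∫ k, p₀ k ∂ν) + (∫ k, p₁ k ∂ν) * meanVel l ξ α β) ≤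
      kinS l c (fun v => ∫ k, q k v ∂ν) a b ξ -
        maxw0 l c ξ a b * ((∫ k, p₀ k ∂ν) + (∫ k, p₁ k ∂ν) * meanVel l ξ a b) := by
  have hI : ∀ a b, Integrable (fun k => kinS l c (q k) a b ξ) ν := fun a b =>
    (hq a b ξ).integral_prod_right
  have hP : ∀ m w : ℝ, Integrable (fun k => m * (p₀ k + p₁ k * w)) ν := fun m w =>
    (hp₀.add (hp₁.mul_const w)).const_mul m
  have hS : ∀ a b m w, ∫ k, (kinS l c (q k) a b ξ - m * (p₀ k + p₁ k * w)) ∂ν =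
      kinS l c (fun v => ∫ k, q k v ∂ν) a b ξ -
        m * ((∫ k, p₀ k ∂ν) + (∫ k, p₁ k ∂ν) * w) := by
    intro a b m w
    rw [integral_sub (hI a b) (hP m w), integral_const_mul,
      integral_add hp₀ (hp₁.mul_const w), integral_mul_const]
    congr 1
    unfold kinS
    rw [integral_integral_swap (f := fun k v => phi l c a b ξ v * q k v) (hq a b ξ).swap]
    simp only [integral_const_mul]
  rw [← hS, ← hS]
  exact integral_mono_ae ((hI α β).sub (hP _ _)) ((hI a b).sub (hP _ _)) (hineq a b ξ hab)

/-- Only parameters `k` in a set `t` of finite measure contribute on the support of the kernel, so a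
constant on `t` times the kernel is an integrable majorant. -/
lemma integrable_phi_prod {l c : ℝ} (hl : 0 < l) (hc : 0 < c) {s t : Set ℝ} (hs : MeasurableSet s)
    (ht : MeasurableSet t) (htf : volume t ≠ ∞) {a b ξ : ℝ}
    {q : ℝ → ℝ → ℝ} (hqm : Measurable fun x : ℝ × ℝ => q x.2 x.1) {C : ℝ}
    (hC : ∀ k ∈ s, ∀ v, a < v → v < b → |q k v| ≤ C)
    (h0 : ∀ k ∈ s, k ∉ t → ∀ v, a < v → v < b → q k v = 0) :
    Integrable (fun x : ℝ × ℝ => phi l c a b ξ x.1 * q x.2 x.1)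
      (volume.prod (volume.restrict s)) := by
  have h1 : Integrable (t.indicator fun _ => C) (volume.restrict s) :=
    ((integrable_indicator_iff ht).2 (integrableOn_const htf)).restrict
  have h2 := (integrable_phi hl hc a b ξ).norm.mul_prod h1
  refine h2.mono' (((measurable_phi_right hl c a b ξ).comp measurable_fst).mul
    hqm).aestronglyMeasurable ?_
  have hs' : ∀ᵐ x : ℝ × ℝ ∂(volume.prod (volume.restrict s)), x.2 ∈ s :=
    Measure.quasiMeasurePreserving_snd.ae (ae_restrict_mem hs)
  filter_upwards [hs'] with x hx
  by_cases hv : (a < ξ ∧ ξ < b) ∧ (a < x.1 ∧ x.1 < b)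
  · rw [norm_mul]
    refine mul_le_mul_of_nonneg_left ?_ (norm_nonneg _)
    by_cases hk : x.2 ∈ t
    · rw [indicator_of_mem hk]; exact hC _ hx _ hv.2.1 hv.2.2
    · rw [indicator_of_notMem hk, h0 _ hx hk _ hv.2.1 hv.2.2, norm_zero]
  · simp [phi_eq_zero hv]

/-- The upper half of `sOmega` as a superposition of elementary entropies; the integrand is zero for
`k > v`. -/
lemma integral_Ioi_pos_part (w v : ℝ) :
    ∫ k in Ioi w, 2 * max (v - k) 0 = (max (v - w) 0) ^ 2 := by
  rcases le_total v w with h | h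
  · rw [max_eq_right (by linarith), setIntegral_congr_fun measurableSet_Ioi
      (g := fun _ => (0 : ℝ))]
    · simp
    · intro k hk
      simp only [max_eq_right (show v - k ≤ 0 by linarith [mem_Ioi.1 hk]), mul_zero]
  · rw [max_eq_left (by linarith), setIntegral_eq_of_subset_of_forall_sdiff_eq_zero
      (s := Ioc w v) measurableSet_Ioi (fun _ hk => hk.1), ← intervalIntegral.integral_of_le h,
      intervalIntegral.integral_eq_sub_of_hasDerivAt (f := fun k => -(v - k) ^ 2)]
    · ring
    · intro k hk
      rw [uIcc_of_le h] at hk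
      rw [max_eq_left (by linarith [hk.2])]
      have := (((hasDerivAt_id k).const_sub v).pow 2).neg
      exact this.congr_deriv (by simp)
    · exact Continuous.intervalIntegrable (by fun_prop) _ _
    · intro k hk
      have : v < k := by
        by_contra h'
        exact hk.2 ⟨hk.1, not_lt.1 h'⟩
      rw [max_eq_right (by linarith), mul_zero]

lemma integral_Iio_pos_part (w v : ℝ) :
    ∫ k in Iio w, 2 * max (k - v) 0 = (max (w - v) 0) ^ 2 := by
  rw [← integral_Iic_eq_integral_Iio]
  have h := integral_comp_neg_Iic w (fun k => 2 * max (-v - k) 0)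
  rw [integral_Ioi_pos_part] at h
  simpa [sub_neg_eq_add, add_comm, sub_eq_add_neg] using h

lemma continuous_entVar {l α β : ℝ} (hl : 0 < l) :
    (Continuous fun k => entVar0 l k α β) ∧ Continuous fun k => entVar1 l k α β := by
  have hz : Continuous fun k => zed k α β := by unfold zed; fun_prop
  have h1 : Continuous fun k => entVar1 l k α β := ((continuous_betaTail hl).comp hz).div_const _
  have h2 : Continuous fun k => posPow (l + 1) (1 - zed k α β ^ 2) :=
    (continuous_posPow (by linarith)).comp (by fun_prop)
  refine ⟨?_, h1⟩
  unfold entVar0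
  fun_prop

lemma continuous_sOmega (wmin wmax : ℝ) : Continuous (sOmega wmin wmax) := by
  unfold sOmega; fun_prop

/-- The slopes are integrals over `k` of entropy variables. As `(k - v)₊ = (v - k)₊ - (v - k)`, the
lower half uses `entVar0 + k` and `entVar1 - 1`. These vanish for `k ≤ α`, and the slopes of the
upper half vanish for `k ≥ β`, so the integrals converge. -/
lemma kinS_sOmega_subgradient {l c α β : ℝ} (hl : 0 < l) (hc : 0 < c) (hαβ : α < β)
    (wmin wmax : ℝ) : ∃ T₀ T₁ : ℝ, ∀ a b ξ, a < b →
      kinS l c (sOmega wmin wmax) α β ξ - maxw0 l c ξ α β * (T₀ + T₁ * meanVel l ξ α β) ≤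
        kinS l c (sOmega wmin wmax) a b ξ - maxw0 l c ξ a b * (T₀ + T₁ * meanVel l ξ a b) := by
  have hne : ∀ (s : Set ℝ) (ξ : ℝ), ∀ᵐ k ∂(volume.restrict s), k ≠ ξ := fun s ξ =>
    ae_restrict_of_ae (by simp [ae_iff])
  obtain ⟨hc0, hc1⟩ := continuous_entVar (α := α) (β := β) hl
  have hge : ∀ k, β ≤ k → entVar1 l k α β = 0 ∧ entVar0 l k α β = 0 := by
    intro k hk
    have h0 := entPair_of_ge hl hαβ hk 0
    have h1 := entPair_of_ge hl hαβ hk 1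
    simp only [entPair] at h0 h1
    constructor <;> linarith
  have hle : ∀ k, k ≤ α → entVar1 l k α β = 1 ∧ entVar0 l k α β = -k := by
    intro k hk
    have h0 := entPair_of_le hl hαβ hk 0
    have h1 := entPair_of_le hl hαβ hk 1
    simp only [entPair] at h0 h1
    constructor <;> linarith
  have hkin : ∀ k a b ξ, kinS l c (fun v => 2 * max (v - k) 0) a b ξ = 2 * kinK l c ξ k a b := by
    intro k a b ξ
    rw [kinS, kinK, ← integral_const_mul]
    congr 1; ext v; ring
  have hkin' : ∀ k a b ξ, a < b → kinS l c (fun v => 2 * max (k - v) 0) a b ξ =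
      2 * (kinK l c ξ k a b - maxw0 l c ξ a b * (meanVel l ξ a b - k)) := by
    intro k a b ξ hab
    rw [kinS, kinK, ← integral_phi_mul_sub hl hc hab, ← integral_sub
      (integrable_phi_mul_of_continuous hl hc a b ξ (by fun_prop))
      (integrable_phi_mul_of_continuous hl hc a b ξ (by fun_prop)), ← integral_const_mul]
    congr 1; ext v
    have : max (k - v) 0 = max (v - k) 0 - (v - k) := by
      rcases le_total v k with h | h
      · rw [max_eq_left (by linarith), max_eq_right (by linarith)]; ring
      · rw [max_eq_right (by linarith), max_eq_left (by linarith)]; ring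
    rw [this]; ring
  have hA := fun (a b : ℝ) (hab : a < b) (ξ : ℝ) => kinS_subgradient_integral (l := l) (c := c)
    (α := α) (β := β) (ν := volume.restrict (Ioi wmax)) (q := fun k v => 2 * max (v - k) 0)
    (p₀ := fun k => 2 * entVar0 l k α β) (p₁ := fun k => 2 * entVar1 l k α β)
    (by
      refine IntegrableOn.of_forall_sdiff_eq_zero (s := Icc wmax β)
        ((hc0.const_smul (2 : ℝ)).integrableOn_Icc) measurableSet_Ioi fun k hk => ?_
      have : β ≤ k := by
        by_contra h
        exact hk.2 ⟨le_of_lt hk.1, (not_le.1 h).le⟩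
      simp [(hge k this).2])
    (by
      refine IntegrableOn.of_forall_sdiff_eq_zero (s := Icc wmax β)
        ((hc1.const_smul (2 : ℝ)).integrableOn_Icc) measurableSet_Ioi fun k hk => ?_
      have : β ≤ k := by
        by_contra h
        exact hk.2 ⟨le_of_lt hk.1, (not_le.1 h).le⟩
      simp [(hge k this).1])
    (fun a b ξ => by
      refine integrable_phi_prod hl hc measurableSet_Ioi (t := Icc wmax b) measurableSet_Icc
        (by simp) (q := fun k v => 2 * max (v - k) 0)
        (by fun_prop) (C := 2 * max (b - wmax) 0) (fun k hk v h1 h2 => ?_)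
        (fun k hk hkt v h1 h2 => ?_)
      · rw [abs_of_nonneg (by positivity)]
        have := mem_Ioi.1 hk
        exact mul_le_mul_of_nonneg_left (max_le_max_right _ (by linarith)) (by norm_num)
      · have : b < k := by
          by_contra h
          exact hkt ⟨le_of_lt hk, not_lt.1 h⟩
        rw [max_eq_right (by linarith), mul_zero])
    (fun a b ξ hab => by
      filter_upwards [hne _ ξ] with k hk
      have := kinK_subgradient hl hc hab hk hαβ
      simp only [hkin]
      unfold entPair at this
      linarith) hab ξ
  have hB := fun (a b : ℝ) (hab : a < b) (ξ : ℝ) => kinS_subgradient_integral (l := l) (c := c)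
    (α := α) (β := β) (ν := volume.restrict (Iio wmin)) (q := fun k v => 2 * max (k - v) 0)
    (p₀ := fun k => 2 * (entVar0 l k α β + k)) (p₁ := fun k => 2 * (entVar1 l k α β - 1))
    (by
      refine IntegrableOn.of_forall_sdiff_eq_zero (s := Icc α wmin)
        (((hc0.add continuous_id).const_smul (2 : ℝ)).integrableOn_Icc) measurableSet_Iio
        fun k hk => ?_
      have : k ≤ α := by
        by_contra h
        exact hk.2 ⟨(not_le.1 h).le, le_of_lt hk.1⟩
      simp [(hle k this).2])
    (by
      refine IntegrableOn.of_forall_sdiff_eq_zero (s := Icc α wmin)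
        (((hc1.sub continuous_const).const_smul (2 : ℝ)).integrableOn_Icc) measurableSet_Iio
        fun k hk => ?_
      have : k ≤ α := by
        by_contra h
        exact hk.2 ⟨(not_le.1 h).le, le_of_lt hk.1⟩
      simp [(hle k this).1])
    (fun a b ξ => by
      refine integrable_phi_prod hl hc measurableSet_Iio (t := Icc a wmin) measurableSet_Icc
        (by simp) (q := fun k v => 2 * max (k - v) 0)
        (by fun_prop) (C := 2 * max (wmin - a) 0) (fun k hk v h1 h2 => ?_)
        (fun k hk hkt v h1 h2 => ?_)
      · rw [abs_of_nonneg (by positivity)]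
        have := mem_Iio.1 hk
        exact mul_le_mul_of_nonneg_left (max_le_max_right _ (by linarith)) (by norm_num)
      · have : k < a := by
          by_contra h
          exact hkt ⟨not_lt.1 h, le_of_lt hk⟩
        rw [max_eq_right (by linarith), mul_zero])
    (fun a b ξ hab => by
      filter_upwards [hne _ ξ] with k hk
      have := kinK_subgradient hl hc hab hk hαβ
      simp only [hkin' _ _ _ _ hab, hkin' _ _ _ _ hαβ]
      unfold entPair at this
      linarith) hab ξ
  simp only [integral_Ioi_pos_part] at hA
  simp only [integral_Iio_pos_part] at hB
  refine ⟨(∫ k in Ioi wmax, 2 * entVar0 l k α β) + ∫ k in Iio wmin, 2 * (entVar0 l k α β + k),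
    (∫ k in Ioi wmax, 2 * entVar1 l k α β) + ∫ k in Iio wmin, 2 * (entVar1 l k α β - 1),
    fun a b ξ hab => ?_⟩
  have hsplit : ∀ a b, kinS l c (sOmega wmin wmax) a b ξ =
      kinS l c (fun v => (max (v - wmax) 0) ^ 2) a b ξ +
        kinS l c (fun v => (max (wmin - v) 0) ^ 2) a b ξ := by
    intro a b
    unfold kinS
    rw [← integral_add (integrable_phi_mul_of_continuous hl hc a b ξ (by fun_prop))
      (integrable_phi_mul_of_continuous hl hc a b ξ (by fun_prop))]
    congr 1; ext v; rw [sOmega]; ring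
  rw [hsplit, hsplit]
  have h1 := hA a b hab ξ
  have h2 := hB a b hab ξ
  linarith

/-! ### The kinetic quantities in Riemann invariants -/

section params

variable {γ κ : ℝ}

lemma lam_pos (hγ₁ : 1 < γ) (hγ₃ : γ < 3) : 0 < lam γ := by
  have h1 : 0 < γ - 1 := by linarith
  unfold lam
  rw [sub_pos, div_lt_div_iff₀ (by norm_num) h1]
  linarith

lemma theta_eq (hγ₁ : 1 < γ) : theta γ = th (lam γ) := by
  have h1 : γ - 1 ≠ 0 := by linarith
  have h2 : 2 * lam γ + 1 = 2 / (γ - 1) := by unfold lam; ring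
  rw [th, h2, theta, one_div_div]

lemma jConst_eq : jConst γ = betaFull (lam γ) := by
  refine intervalIntegral.integral_congr fun z hz => ?_
  rw [uIcc_of_le (by norm_num)] at hz
  rw [posPow_of_nonneg]
  nlinarith [hz.1, hz.2]

lemma aConst_pos (hγ₁ : 1 < γ) (hκ : 0 < κ) : 0 < aConst γ κ := by
  have : 0 < γ - 1 := by linarith
  have : 0 < γ := by linarith
  unfold aConst; positivity

lemma cConst_pos (hγ₁ : 1 < γ) (hγ₃ : γ < 3) (hκ : 0 < κ) : 0 < cConst γ κ := by
  have h1 := aConst_pos hγ₁ hκ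
  have h2 := betaFull_pos (lam_pos hγ₁ hγ₃)
  rw [cConst, jConst_eq]
  positivity

/-- Half the difference of the Riemann invariants. -/
def rad (γ κ ρ : ℝ) : ℝ := aConst γ κ * ρ ^ theta γ

lemma rad_sq {ρ : ℝ} (hρ : 0 ≤ ρ) : rad γ κ ρ ^ 2 = aConst γ κ ^ 2 * ρ ^ (γ - 1) := by
  rw [rad, mul_pow, ← Real.rpow_natCast (ρ ^ theta γ), ← Real.rpow_mul hρ]
  congr 2
  unfold theta; push_cast; ring

lemma rad_pos (hγ₁ : 1 < γ) (hκ : 0 < κ) {ρ : ℝ} (hρ : 0 < ρ) : 0 < rad γ κ ρ :=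
  mul_pos (aConst_pos hγ₁ hκ) (Real.rpow_pos_of_pos hρ _)

lemma rad_nonneg (hγ₁ : 1 < γ) (hκ : 0 < κ) {ρ : ℝ} (hρ : 0 ≤ ρ) : 0 ≤ rad γ κ ρ :=
  mul_nonneg (aConst_pos hγ₁ hκ).le (Real.rpow_nonneg hρ _)

lemma rad_zero (hγ₁ : 1 < γ) : rad γ κ 0 = 0 := by
  rw [rad, Real.zero_rpow, mul_zero]
  unfold theta
  have : 0 < γ - 1 := by linarith
  positivity

/-- Every positive radius is attained. -/
lemma exists_rad_eq (hγ₁ : 1 < γ) (hκ : 0 < κ) {r : ℝ} (hr : 0 < r) :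
    ∃ ρ, 0 < ρ ∧ rad γ κ ρ = r := by
  have ha := aConst_pos hγ₁ hκ
  have ht : theta γ ≠ 0 := by unfold theta; have : 0 < γ - 1 := by linarith
                              positivity
  refine ⟨(r / aConst γ κ) ^ (1 / theta γ), by positivity, ?_⟩
  rw [rad, ← Real.rpow_mul (by positivity), one_div_mul_cancel ht, Real.rpow_one]
  field_simp

lemma rad_inj (hγ₁ : 1 < γ) (hκ : 0 < κ) {ρ ρ' : ℝ} (hρ : 0 ≤ ρ) (hρ' : 0 ≤ ρ')
    (h : rad γ κ ρ = rad γ κ ρ') : ρ = ρ' := by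
  have ht : theta γ ≠ 0 := by unfold theta; have : 0 < γ - 1 := by linarith
                              positivity
  exact (Real.rpow_left_inj hρ hρ' ht).1 (mul_left_cancel₀ (aConst_pos hγ₁ hκ).ne' h)

lemma omega1_eq (ρ u : ℝ) : omega1 γ κ ρ u = u - rad γ κ ρ := rfl

lemma omega2_eq (ρ u : ℝ) : omega2 γ κ ρ u = u + rad γ κ ρ := rfl

/-- With `r = rad γ κ ρ` one has `r² - (ξ - u)² = (ξ - ω₁)(ω₂ - ξ)`, and `u` is the midpoint of the
invariants. -/
lemma maxwellian_eq (hγ₁ : 1 < γ) {ρ : ℝ} (hρ : 0 ≤ ρ) (u ξ : ℝ) :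
    maxwellian γ κ ρ u ξ =
      (maxw0 (lam γ) (cConst γ κ) ξ (omega1 γ κ ρ u) (omega2 γ κ ρ u),
        meanVel (lam γ) ξ (omega1 γ κ ρ u) (omega2 γ κ ρ u) *
        maxw0 (lam γ) (cConst γ κ) ξ (omega1 γ κ ρ u) (omega2 γ κ ρ u)) := by
  have e1 : chi γ κ ρ (ξ - u) =
      maxw0 (lam γ) (cConst γ κ) ξ (omega1 γ κ ρ u) (omega2 γ κ ρ u) := by
    rw [chi, maxw0, posPow, ← rad_sq hρ, omega1_eq, omega2_eq]
    congr 3; ring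
  rw [maxwellian, e1, theta_eq hγ₁, meanVel, omega1_eq, omega2_eq]
  congr 2; ring

lemma entropyKernel_eq (hγ₁ : 1 < γ) (ρ u ξ v : ℝ) :
    entropyKernel γ κ ρ u ξ v =
      phi (lam γ) (cConst γ κ) (omega1 γ κ ρ u) (omega2 γ κ ρ u) ξ v := by
  rw [entropyKernel, phi, theta_eq hγ₁, jConst_eq]
  rfl

lemma kinEntropy_eq (hγ₁ : 1 < γ) (S : ℝ → ℝ) {f : ℝ × ℝ} (hf : f ≠ 0) (ξ : ℝ) :
    kinEntropy γ κ S f ξ =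
      kinS (lam γ) (cConst γ κ) S (kinOmega1 γ κ f ξ) (kinOmega2 γ κ f ξ) ξ := by
  rw [kinEntropy, if_neg hf, kinS]
  simp only [entropyKernel_eq hγ₁]
  rfl

lemma rad_kinRho (hγ₁ : 1 < γ) (hγ₃ : γ < 3) (hκ : 0 < κ) {f : ℝ × ℝ} (hf : 0 < f.1) (ξ : ℝ) :
    rad γ κ (kinRho γ κ f ξ) ^ 2 =
      (kinU γ f ξ - ξ) ^ 2 + (f.1 / cConst γ κ) ^ (1 / lam γ) := by
  have ha := aConst_pos hγ₁ hκ
  have hc := cConst_pos hγ₁ hγ₃ hκ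
  have h1 : γ - 1 ≠ 0 := by linarith
  have ht : 1 - theta γ ≠ 0 := by
    rw [theta_eq hγ₁]; linarith [th_lt_one (lam_pos hγ₁ hγ₃)]
  have e : kinU γ f ξ - ξ = (f.2 / f.1 - ξ) / (1 - theta γ) := by
    unfold kinU; field_simp; ring
  have hX : 0 ≤ ((f.2 / f.1 - ξ) / (1 - theta γ)) ^ 2 + (f.1 / cConst γ κ) ^ (1 / lam γ) := by
    positivity
  rw [rad_sq (by unfold kinRho; positivity), kinRho, Real.mul_rpow (by positivity) (by positivity),
    ← Real.rpow_mul ha.le, ← Real.rpow_mul hX, one_div_mul_cancel h1, Real.rpow_one, e,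
    div_mul_cancel₀ _ h1, ← Real.rpow_natCast, ← mul_assoc, ← Real.rpow_add ha]
  norm_num

lemma rad_kinRho_nonneg (hγ₁ : 1 < γ) (hγ₃ : γ < 3) (hκ : 0 < κ) {f : ℝ × ℝ} (hf : 0 < f.1)
    (ξ : ℝ) : 0 ≤ rad γ κ (kinRho γ κ f ξ) := by
  have ha := aConst_pos hγ₁ hκ
  have hc := cConst_pos hγ₁ hγ₃ hκ
  exact rad_nonneg hγ₁ hκ (by unfold kinRho; positivity)

/-- By `rad_kinRho` the difference `r² - (u - ξ)² = (f₀ / c) ^ (1/λ)` is positive, which puts `ξ`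
strictly between the invariants and returns `f₀`. Thus every nonzero value in D is a Maxwellian
value at `ξ`. -/
lemma kin_spec (hγ₁ : 1 < γ) (hγ₃ : γ < 3) (hκ : 0 < κ) {f : ℝ × ℝ} (hf : 0 < f.1) (ξ : ℝ) :
    (kinOmega1 γ κ f ξ < ξ ∧ ξ < kinOmega2 γ κ f ξ) ∧
      maxw0 (lam γ) (cConst γ κ) ξ (kinOmega1 γ κ f ξ) (kinOmega2 γ κ f ξ) = f.1 ∧
      meanVel (lam γ) ξ (kinOmega1 γ κ f ξ) (kinOmega2 γ κ f ξ) = f.2 / f.1 := by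
  have hl := lam_pos hγ₁ hγ₃
  have hc := cConst_pos hγ₁ hγ₃ hκ
  have hr := rad_kinRho hγ₁ hγ₃ hκ hf ξ
  have hr0 := rad_kinRho_nonneg hγ₁ hγ₃ hκ hf ξ
  have hq : 0 < (f.1 / cConst γ κ) ^ (1 / lam γ) := by positivity
  have h1 : |kinU γ f ξ - ξ| < rad γ κ (kinRho γ κ f ξ) := by
    rw [← abs_of_nonneg hr0]; exact sq_lt_sq.1 (by linarith)
  rw [abs_lt] at h1
  rw [kinOmega1, kinOmega2, omega1_eq, omega2_eq]
  refine ⟨⟨by linarith, by linarith⟩, ?_, ?_⟩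
  · have e : (ξ - (kinU γ f ξ - rad γ κ (kinRho γ κ f ξ))) *
        (kinU γ f ξ + rad γ κ (kinRho γ κ f ξ) - ξ) = (f.1 / cConst γ κ) ^ (1 / lam γ) := by
      linear_combination hr
    rw [maxw0, e, posPow_of_nonneg _ hq.le, ← Real.rpow_mul (by positivity),
      one_div_mul_cancel hl.ne', Real.rpow_one]
    field_simp
  · have ht : 1 - th (lam γ) ≠ 0 := by linarith [th_lt_one hl]
    rw [meanVel, kinU, theta_eq hγ₁]
    field_simp
    ring

lemma stateD_cases {f : ℝ × ℝ} (hf : f ∈ stateD) : 0 < f.1 ∨ f = 0 := by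
  rcases hf with h | h
  · exact Or.inl h
  · exact Or.inr (Prod.ext h.1 h.2)

lemma stateD_fst_nonneg {f : ℝ × ℝ} (hf : f ∈ stateD) : 0 ≤ f.1 := by
  rcases hf with h | h
  · exact h.le
  · exact h.1.ge

lemma omega1_lt_omega2 (hγ₁ : 1 < γ) (hκ : 0 < κ) {ρ : ℝ} (hρ : 0 < ρ) (u : ℝ) :
    omega1 γ κ ρ u < omega2 γ κ ρ u := by
  rw [omega1_eq, omega2_eq]; linarith [rad_pos hγ₁ hκ hρ]

lemma maxwellian_mem_stateD (hγ₁ : 1 < γ) (hγ₃ : γ < 3) (hκ : 0 < κ) {ρ : ℝ} (hρ : 0 ≤ ρ)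
    (u ξ : ℝ) : maxwellian γ κ ρ u ξ ∈ stateD := by
  have := maxw0_nonneg (l := lam γ) (cConst_pos hγ₁ hγ₃ hκ) ξ (omega1 γ κ ρ u) (omega2 γ κ ρ u)
  rw [maxwellian_eq hγ₁ hρ]
  rcases this.lt_or_eq with h | h
  · exact Or.inl h
  · refine Or.inr ⟨h.symm, ?_⟩
    simp only; rw [← h, mul_zero]

/-- The kinetic Riemann invariants of a Maxwellian are its macroscopic ones. -/
lemma kinOmega_maxwellian (hγ₁ : 1 < γ) (hγ₃ : γ < 3) (hκ : 0 < κ) {ρ : ℝ} (hρ : 0 < ρ)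
    {u ξ : ℝ} (h : omega1 γ κ ρ u < ξ ∧ ξ < omega2 γ κ ρ u) :
    kinOmega1 γ κ (maxwellian γ κ ρ u ξ) ξ = omega1 γ κ ρ u ∧
      kinOmega2 γ κ (maxwellian γ κ ρ u ξ) ξ = omega2 γ κ ρ u := by
  have hl := lam_pos hγ₁ hγ₃
  have hc := cConst_pos hγ₁ hγ₃ hκ
  have hpos := (maxw0_pos_iff (ξ := ξ) hl hc (omega1_lt_omega2 hγ₁ hκ hρ u)).2 h
  have hM := maxwellian_eq (κ := κ) hγ₁ hρ.le u ξ
  have hf : 0 < (maxwellian γ κ ρ u ξ).1 := by rw [hM]; exact hpos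
  obtain ⟨h1, h2, h3⟩ := kin_spec hγ₁ hγ₃ hκ hf ξ
  refine maxw_inj hl hc h.1 h.2 (h1.1.trans h1.2) (by rw [h2, hM]) ?_
  rw [h3, hM]
  simp only
  field_simp

lemma kinEntropy_maxwellian (hγ₁ : 1 < γ) (hγ₃ : γ < 3) (hκ : 0 < κ) {ρ : ℝ} (hρ : 0 < ρ)
    (S : ℝ → ℝ) (u ξ : ℝ) : kinEntropy γ κ S (maxwellian γ κ ρ u ξ) ξ =
      kinS (lam γ) (cConst γ κ) S (omega1 γ κ ρ u) (omega2 γ κ ρ u) ξ := by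
  have hl := lam_pos hγ₁ hγ₃
  have hc := cConst_pos hγ₁ hγ₃ hκ
  have hM := maxwellian_eq (κ := κ) hγ₁ hρ.le u ξ
  by_cases h : omega1 γ κ ρ u < ξ ∧ ξ < omega2 γ κ ρ u
  · have hpos := (maxw0_pos_iff (ξ := ξ) hl hc (omega1_lt_omega2 hγ₁ hκ hρ u)).2 h
    obtain ⟨h1, h2⟩ := kinOmega_maxwellian hγ₁ hγ₃ hκ hρ h
    rw [kinEntropy_eq hγ₁, h1, h2]
    intro h0
    rw [hM, Prod.ext_iff] at h0
    exact hpos.ne' h0.1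
  · rw [maxw0_eq_zero hl (omega1_lt_omega2 hγ₁ hκ hρ u) h, mul_zero] at hM
    rw [kinEntropy, if_pos (by rw [hM]; rfl)]
    refine (integral_eq_zero_of_ae (ae_of_all _ fun v => ?_)).symm
    simp only [phi_eq_zero fun h' => h h'.1, zero_mul, Pi.zero_apply]

lemma sOmega_nonneg (wmin wmax v : ℝ) : 0 ≤ sOmega wmin wmax v := by unfold sOmega; positivity

lemma kinS_nonneg {l c : ℝ} (hl : 0 < l) (hc : 0 < c) {S : ℝ → ℝ} (hS : ∀ v, 0 ≤ S v)
    (a b ξ : ℝ) : 0 ≤ kinS l c S a b ξ :=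
  integral_nonneg_of_ae <| by
    filter_upwards [phi_ae_nonneg hl hc a b ξ] with v hv using mul_nonneg hv (hS v)

/-- The kinetic entropy lies above its supporting plane at a Maxwellian, whose normal does not
depend on `ξ`. -/
lemma kinEntropy_subgradient (hγ₁ : 1 < γ) (hγ₃ : γ < 3) (hκ : 0 < κ) {ρ : ℝ} (hρ : 0 < ρ)
    (u wmin wmax : ℝ) : ∃ T₀ T₁ : ℝ, ∀ ξ, ∀ f ∈ stateD,
      kinEntropy γ κ (sOmega wmin wmax) (maxwellian γ κ ρ u ξ) ξ +
        (T₀ * (f.1 - (maxwellian γ κ ρ u ξ).1) + T₁ * (f.2 - (maxwellian γ κ ρ u ξ).2)) ≤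
      kinEntropy γ κ (sOmega wmin wmax) f ξ := by
  have hl := lam_pos hγ₁ hγ₃
  have hc := cConst_pos hγ₁ hγ₃ hκ
  obtain ⟨T₀, T₁, hT⟩ := kinS_sOmega_subgradient hl hc (omega1_lt_omega2 hγ₁ hκ hρ u) wmin wmax
  refine ⟨T₀, T₁, fun ξ f hf => ?_⟩
  rw [kinEntropy_maxwellian hγ₁ hγ₃ hκ hρ, maxwellian_eq hγ₁ hρ.le]
  rcases stateD_cases hf with h0 | h0
  · obtain ⟨h1, h2, h3⟩ := kin_spec hγ₁ hγ₃ hκ h0 ξ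
    have := hT _ _ ξ (h1.1.trans h1.2)
    rw [h2, h3] at this
    rw [kinEntropy_eq hγ₁ _ (fun h => by rw [h] at h0; exact h0.false)]
    have e : f.1 * (T₀ + T₁ * (f.2 / f.1)) = T₀ * f.1 + T₁ * f.2 := by field_simp
    simp only
    linarith
  -- The value `f = 0` is represented by any interval not containing `ξ`.
  · have := hT (ξ + 1) (ξ + 2) ξ (by linarith)
    have hn : ¬(ξ + 1 < ξ ∧ ξ < ξ + 2) := fun h => by linarith [h.1]
    have hz : kinS (lam γ) (cConst γ κ) (sOmega wmin wmax) (ξ + 1) (ξ + 2) ξ = 0 :=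
      integral_eq_zero_of_ae (ae_of_all _ fun v => by
        simp only [phi_eq_zero fun h' => hn h'.1, zero_mul, Pi.zero_apply])
    rw [hz, maxw0_eq_zero hl (by linarith) hn] at this
    rw [h0, kinEntropy, if_pos rfl]
    simp only [Prod.fst_zero, Prod.snd_zero]
    linarith

lemma kinEntropy_nonneg (hγ₁ : 1 < γ) (hγ₃ : γ < 3) (hκ : 0 < κ) {S : ℝ → ℝ} (hS : ∀ v, 0 ≤ S v)
    (f : ℝ × ℝ) (ξ : ℝ) : 0 ≤ kinEntropy γ κ S f ξ := by
  by_cases hf : f = 0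
  · rw [kinEntropy, if_pos hf]
  · rw [kinEntropy_eq hγ₁ _ hf]
    exact kinS_nonneg (lam_pos hγ₁ hγ₃) (cConst_pos hγ₁ hγ₃ hκ) hS _ _ _

/-! ### The kinetic energy -/

/-- Completing the square: after subtraction of a plane whose slopes come from `(r, u)`, a square in
the kinetic velocity and a Young-type function of `f₀ / c` remain. For `r = u = 0` this displays the
energy itself as a sum of nonnegative terms, increasing in `f₀` at fixed quotient. -/
lemma kinEnergy_eq (hγ₁ : 1 < γ) (hγ₃ : γ < 3) (hκ : 0 < κ) {f₀ : ℝ} (hf : 0 ≤ f₀)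
    (w ξ r u : ℝ) : kinEnergy γ κ (f₀, w * f₀) ξ -
        ((theta γ * r ^ 2 / 2 - u ^ 2 / 2) * f₀ + u * (w * f₀)) =
      (1 - theta γ) / 2 * f₀ * ((w - theta γ * ξ) / (1 - theta γ) - u) ^ 2 +
        theta γ * cConst γ κ / 2 * ((f₀ / cConst γ κ) ^ (1 + 1 / lam γ) / (1 + 1 / lam γ) -
          f₀ / cConst γ κ * (r ^ 2 - (ξ - u) ^ 2)) := by
  have hl := lam_pos hγ₁ hγ₃
  have hc := cConst_pos hγ₁ hγ₃ hκ
  have ht : 1 - theta γ ≠ 0 := by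
    rw [theta_eq hγ₁]; linarith [th_lt_one hl]
  have e1 : (w * f₀) ^ 2 / f₀ = w ^ 2 * f₀ := by
    rcases hf.eq_or_lt with h | h
    · simp [← h]
    · field_simp
  have e2 : (f₀ / cConst γ κ) ^ (1 + 1 / lam γ) =
      f₀ ^ (1 + 1 / lam γ) / (cConst γ κ * cConst γ κ ^ (1 / lam γ)) := by
    rw [Real.div_rpow hf hc.le, Real.rpow_add hc, Real.rpow_one]
  rw [kinEnergy, e2]
  simp only [e1]
  have : cConst γ κ ^ (1 / lam γ) ≠ 0 := (Real.rpow_pos_of_pos hc _).ne'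
  have : 1 + 1 / lam γ ≠ 0 := by positivity
  generalize f₀ ^ (1 + 1 / lam γ) = F at *
  generalize cConst γ κ ^ (1 / lam γ) = G at *
  generalize 1 + 1 / lam γ = L at *
  field_simp
  ring

/-- The exponents `1 + 1/l` and `l + 1` are conjugate; equality holds for `X = posPow l Y`, the
profile of a Maxwellian. -/
lemma young_posPow {l X : ℝ} (hl : 0 < l) (hX : 0 ≤ X) (Y : ℝ) :
    -(posPow (l + 1) Y / (l + 1)) ≤ X ^ (1 + 1 / l) / (1 + 1 / l) - X * Y := by
  have hconj : (1 + 1 / l).HolderConjugate (l + 1) := by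
    rw [Real.holderConjugate_iff]
    have : 0 < 1 / l := by positivity
    refine ⟨by linarith, ?_⟩
    field_simp
  have h := Real.young_inequality_of_nonneg hX (le_max_right Y 0) hconj
  have h2 : X * Y ≤ X * max Y 0 := mul_le_mul_of_nonneg_left (le_max_left _ _) hX
  unfold posPow
  linarith

/-- The slopes are the gradient of the macroscopic energy in mass and momentum. For them both parts
of `kinEnergy_eq` are minimal at the Maxwellian: the square vanishes and Young's inequality is an
equality. -/
lemma kinEnergy_subgradient (hγ₁ : 1 < γ) (hγ₃ : γ < 3) (hκ : 0 < κ) {ρ : ℝ} (hρ : 0 ≤ ρ)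
    (u : ℝ) : ∃ T₀ T₁ : ℝ, ∀ ξ, ∀ f ∈ stateD,
      kinEnergy γ κ (maxwellian γ κ ρ u ξ) ξ +
        (T₀ * (f.1 - (maxwellian γ κ ρ u ξ).1) + T₁ * (f.2 - (maxwellian γ κ ρ u ξ).2)) ≤
      kinEnergy γ κ f ξ := by
  have hl := lam_pos hγ₁ hγ₃
  have hc := cConst_pos hγ₁ hγ₃ hκ
  have ht := th_pos hl
  have ht1 := th_lt_one hl
  rw [← theta_eq hγ₁] at ht ht1
  refine ⟨theta γ * rad γ κ ρ ^ 2 / 2 - u ^ 2 / 2, u, fun ξ f hf => ?_⟩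
  obtain ⟨f₀, w, hf0, rfl⟩ : ∃ f₀ w : ℝ, 0 ≤ f₀ ∧ f = (f₀, w * f₀) := by
    rcases stateD_cases hf with h | h
    · exact ⟨f.1, f.2 / f.1, h.le, by rw [div_mul_cancel₀ _ h.ne']⟩
    · exact ⟨0, 0, le_rfl, by rw [h, mul_zero]; rfl⟩
  have h1 := kinEnergy_eq hγ₁ hγ₃ hκ hf0 w ξ (rad γ κ ρ) u
  have h2 := kinEnergy_eq hγ₁ hγ₃ hκ (maxw0_nonneg (l := lam γ) hc ξ (omega1 γ κ ρ u)
    (omega2 γ κ ρ u)) (meanVel (lam γ) ξ (omega1 γ κ ρ u) (omega2 γ κ ρ u)) ξ (rad γ κ ρ) u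
  rw [← maxwellian_eq hγ₁ hρ] at h2
  have hU : (meanVel (lam γ) ξ (omega1 γ κ ρ u) (omega2 γ κ ρ u) - theta γ * ξ) / (1 - theta γ) - u
      = 0 := by
    have : 1 - theta γ ≠ 0 := by linarith
    rw [meanVel, omega1_eq, omega2_eq, ← theta_eq hγ₁]
    field_simp
    ring
  have hX : maxw0 (lam γ) (cConst γ κ) ξ (omega1 γ κ ρ u) (omega2 γ κ ρ u) / cConst γ κ =
      posPow (lam γ) (rad γ κ ρ ^ 2 - (ξ - u) ^ 2) := by
    rw [maxw0, mul_div_cancel_left₀ _ hc.ne', omega1_eq, omega2_eq]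
    congr 1; ring
  rw [hU, hX] at h2
  have hy := young_posPow hl (div_nonneg hf0 hc.le) (rad γ κ ρ ^ 2 - (ξ - u) ^ 2)
  have hval : posPow (lam γ) (rad γ κ ρ ^ 2 - (ξ - u) ^ 2) ^ (1 + 1 / lam γ) / (1 + 1 / lam γ) -
      posPow (lam γ) (rad γ κ ρ ^ 2 - (ξ - u) ^ 2) * (rad γ κ ρ ^ 2 - (ξ - u) ^ 2) =
      -(posPow (lam γ + 1) (rad γ κ ρ ^ 2 - (ξ - u) ^ 2) / (lam γ + 1)) := by
    generalize rad γ κ ρ ^ 2 - (ξ - u) ^ 2 = Y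
    have e1 : posPow (lam γ) Y ^ (1 + 1 / lam γ) = posPow (lam γ + 1) Y := by
      unfold posPow
      rw [← Real.rpow_mul (le_max_right _ _)]
      congr 1; field_simp
    rw [e1, posPow_add_one hl]
    field_simp
    ring
  rw [hval] at h2
  have e1 : 0 ≤ (1 - theta γ) / 2 * f₀ * ((w - theta γ * ξ) / (1 - theta γ) - u) ^ 2 := by
    have : 0 < 1 - theta γ := by linarith
    positivity
  have e2 := mul_le_mul_of_nonneg_left hy (by positivity : 0 ≤ theta γ * cConst γ κ / 2)
  have e3 : (maxwellian γ κ ρ u ξ).2 = meanVel (lam γ) ξ (omega1 γ κ ρ u) (omega2 γ κ ρ u) *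
      (maxwellian γ κ ρ u ξ).1 := by rw [maxwellian_eq hγ₁ hρ]
  have e4 : (maxwellian γ κ ρ u ξ).1 =
      maxw0 (lam γ) (cConst γ κ) ξ (omega1 γ κ ρ u) (omega2 γ κ ρ u) := by
    rw [maxwellian_eq hγ₁ hρ]
  rw [e3, e4]
  simp only
  linarith

lemma kinEnergy_nonneg (hγ₁ : 1 < γ) (hγ₃ : γ < 3) (hκ : 0 < κ) {f : ℝ × ℝ} (hf : f ∈ stateD)
    (ξ : ℝ) : 0 ≤ kinEnergy γ κ f ξ := by
  have hl := lam_pos hγ₁ hγ₃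
  have hc := cConst_pos hγ₁ hγ₃ hκ
  have ht := th_pos hl
  have ht1 := th_lt_one hl
  rw [← theta_eq hγ₁] at ht ht1
  rcases stateD_cases hf with h | h
  · have := kinEnergy_eq hγ₁ hγ₃ hκ h.le (f.2 / f.1) ξ 0 0
    rw [div_mul_cancel₀ _ h.ne'] at this
    have e : kinEnergy γ κ f ξ = (1 - theta γ) / 2 * f.1 *
        ((f.2 / f.1 - theta γ * ξ) / (1 - theta γ) - 0) ^ 2 + theta γ * cConst γ κ / 2 *
        ((f.1 / cConst γ κ) ^ (1 + 1 / lam γ) / (1 + 1 / lam γ) + f.1 / cConst γ κ * ξ ^ 2) := by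
      have e' : kinEnergy γ κ (f.1, f.2) ξ = kinEnergy γ κ f ξ := rfl
      rw [e'] at this
      linear_combination this
    have : 0 < 1 - theta γ := by linarith
    rw [e]
    positivity
  · have h0 : (1 + 1 / lam γ) ≠ 0 := by positivity
    rw [h, kinEnergy]
    simp only [Prod.fst_zero, Prod.snd_zero, Real.zero_rpow h0]
    simp

/-! ### Integrated inequalities -/

/-- If two functions have the same integral, then so do their components in a fixed direction. -/
lemma integral_direction_eq_zero {ν : Measure ℝ} {p M : ℝ → ℝ × ℝ} (T₀ T₁ : ℝ)
    (hpi : Integrable p ν) (hMi : Integrable M ν) (heq : ∫ ξ, M ξ ∂ν = ∫ ξ, p ξ ∂ν) :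
    Integrable (fun ξ => T₀ * ((p ξ).1 - (M ξ).1) + T₁ * ((p ξ).2 - (M ξ).2)) ν ∧
      ∫ ξ, (T₀ * ((p ξ).1 - (M ξ).1) + T₁ * ((p ξ).2 - (M ξ).2)) ∂ν = 0 := by
  have hi0 : Integrable (fun ξ => (p ξ).1 - (M ξ).1) ν := hpi.fst.sub hMi.fst
  have hi1 : Integrable (fun ξ => (p ξ).2 - (M ξ).2) ν := hpi.snd.sub hMi.snd
  have h0 : ∫ ξ, (p ξ).1 - (M ξ).1 ∂ν = 0 := by
    rw [integral_sub hpi.fst hMi.fst, ← fst_integral hpi, ← fst_integral hMi, heq, sub_self]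
  have h1 : ∫ ξ, (p ξ).2 - (M ξ).2 ∂ν = 0 := by
    rw [integral_sub hpi.snd hMi.snd, ← snd_integral hpi, ← snd_integral hMi, heq, sub_self]
  refine ⟨(hi0.const_mul T₀).add (hi1.const_mul T₁), ?_⟩
  rw [integral_add (hi0.const_mul T₀) (hi1.const_mul T₁), integral_const_mul,
    integral_const_mul, h0, h1]
  ring

/-- Both functionals may be infinite, so the linear term `e` is split: its positive part is added on
the left and its negative part on the right. These have equal finite integrals and cancel. -/
lemma lintegral_le_of_subgradient {ν : Measure ℝ} {p M : ℝ → ℝ × ℝ} {hM hp : ℝ → ℝ} {T₀ T₁ : ℝ}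
    (hpi : Integrable p ν) (hMi : Integrable M ν) (heq : ∫ ξ, M ξ ∂ν = ∫ ξ, p ξ ∂ν)
    (hM0 : ∀ ξ, 0 ≤ hM ξ)
    (hle : ∀ᵐ ξ ∂ν, hM ξ + (T₀ * ((p ξ).1 - (M ξ).1) + T₁ * ((p ξ).2 - (M ξ).2)) ≤ hp ξ) :
    ∫⁻ ξ, ENNReal.ofReal (hM ξ) ∂ν ≤ ∫⁻ ξ, ENNReal.ofReal (hp ξ) ∂ν := by
  let e : ℝ → ℝ := fun ξ => T₀ * ((p ξ).1 - (M ξ).1) + T₁ * ((p ξ).2 - (M ξ).2)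
  obtain ⟨hei, he0⟩ : Integrable e ν ∧ ∫ ξ, e ξ ∂ν = 0 :=
    integral_direction_eq_zero T₀ T₁ hpi hMi heq
  have hfin : ∫⁻ ξ, ENNReal.ofReal (-e ξ) ∂ν ≠ ∞ := hei.neg.lintegral_lt_top.ne
  have hfin' : ∫⁻ ξ, ENNReal.ofReal (e ξ) ∂ν ≠ ∞ := hei.lintegral_lt_top.ne
  have hbal : ∫⁻ ξ, ENNReal.ofReal (e ξ) ∂ν = ∫⁻ ξ, ENNReal.ofReal (-e ξ) ∂ν := by
    have := integral_eq_lintegral_pos_part_sub_lintegral_neg_part hei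
    rw [he0] at this
    exact (ENNReal.toReal_eq_toReal_iff' hfin' hfin).1 (by linarith)
  have h1 : ∫⁻ ξ, ENNReal.ofReal (hM ξ) + ENNReal.ofReal (e ξ) ∂ν ≤
      ∫⁻ ξ, ENNReal.ofReal (hp ξ) + ENNReal.ofReal (-e ξ) ∂ν := by
    refine lintegral_mono_ae ?_
    filter_upwards [hle] with ξ hξ
    have hξ' : hM ξ + e ξ ≤ hp ξ := hξ
    rcases le_total 0 (e ξ) with h | h
    · rw [← ENNReal.ofReal_add (hM0 ξ) h]
      exact (ENNReal.ofReal_le_ofReal hξ').trans le_self_add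
    · rw [ENNReal.ofReal_of_nonpos h, add_zero]
      refine (ENNReal.ofReal_le_ofReal (by linarith : hM ξ ≤ hp ξ + -e ξ)).trans
        ENNReal.ofReal_add_le
  have hm : AEMeasurable (fun ξ => ENNReal.ofReal (-e ξ)) ν :=
    hei.aemeasurable.neg.ennreal_ofReal
  rw [lintegral_add_right' _ hei.aemeasurable.ennreal_ofReal, lintegral_add_right' _ hm,
    hbal] at h1
  exact (ENNReal.add_le_add_iff_right hfin).1 h1

end params

/-! ### Integration against the outgoing velocity measure -/

lemma integrable_muOut_iff {E : Type*} [NormedAddCommGroup E] [NormedSpace ℝ E] {f : ℝ → E} :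
    Integrable f muOut ↔ Integrable fun ξ => max ξ 0 • f ξ := by
  rw [muOut, integrable_withDensity_iff_integrable_smul' (by fun_prop)
    (ae_of_all _ fun _ => ENNReal.ofReal_lt_top), ← IntegrableOn,
    ← integrable_indicator_iff measurableSet_Ioi]
  refine iff_of_eq (congrArg (Integrable · volume) (funext fun ξ => ?_))
  rcases le_or_gt ξ 0 with h | h
  · rw [indicator_of_notMem (by simpa using h), max_eq_right h, zero_smul]
  · rw [indicator_of_mem (by simpa using h), max_eq_left h.le,
      ENNReal.toReal_ofReal (abs_nonneg _), abs_of_pos h]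

lemma integral_muOut {E : Type*} [NormedAddCommGroup E] [NormedSpace ℝ E] (f : ℝ → E) :
    ∫ ξ, f ξ ∂muOut = ∫ ξ, max ξ 0 • f ξ := by
  rw [muOut, integral_withDensity_eq_integral_toReal_smul (by fun_prop)
    (ae_of_all _ fun _ => ENNReal.ofReal_lt_top), ← integral_indicator measurableSet_Ioi]
  refine integral_congr_ae (ae_of_all _ fun ξ => ?_)
  rcases le_or_gt ξ 0 with h | h
  · simp only [indicator_of_notMem (show ξ ∉ Ioi 0 by simpa using h), max_eq_right h, zero_smul]
  · simp only [indicator_of_mem (show ξ ∈ Ioi 0 by simpa using h), max_eq_left h.le,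
      abs_of_pos h, ENNReal.toReal_ofReal h.le]

lemma muOut_ae_pos : ∀ᵐ ξ ∂muOut, 0 < ξ :=
  (withDensity_absolutelyContinuous _ _).ae_le (ae_restrict_mem measurableSet_Ioi)

/-- Continuous functions which agree almost everywhere agree on positive velocities. -/
lemma eqOn_of_ae_eq_muOut {E : Type*} [TopologicalSpace E] [T2Space E] {f g : ℝ → E}
    (hf : Continuous f) (hg : Continuous g) (h : f =ᵐ[muOut] g) : EqOn f g (Ioi 0) := by
  have h1 : ∀ᵐ ξ ∂volume.restrict (Ioi (0 : ℝ)), f ξ = g ξ := by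
    have := (ae_withDensity_iff (by fun_prop)).1 h
    filter_upwards [this, ae_restrict_mem measurableSet_Ioi] with ξ h1 h2
    refine h1 ?_
    simpa using (mem_Ioi.1 h2).ne'
  exact Measure.eqOn_open_of_ae_eq h1 isOpen_Ioi hf.continuousOn hg.continuousOn

/-! ### Maxwellians with prescribed radius and centre -/

/-- The Maxwellian as a function of `r = a ρ^θ` and `u`. -/
def radMaxw (l c r u ξ : ℝ) : ℝ × ℝ :=
  (c * posPow l (r ^ 2 - (ξ - u) ^ 2),
    ((1 - th l) * u + th l * ξ) * (c * posPow l (r ^ 2 - (ξ - u) ^ 2)))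

lemma maxwellian_eq_radMaxw {γ κ : ℝ} (hγ₁ : 1 < γ) {ρ : ℝ} (hρ : 0 ≤ ρ) (u ξ : ℝ) :
    maxwellian γ κ ρ u ξ = radMaxw (lam γ) (cConst γ κ) (rad γ κ ρ) u ξ := by
  have e1 : chi γ κ ρ (ξ - u) =
      cConst γ κ * posPow (lam γ) (rad γ κ ρ ^ 2 - (ξ - u) ^ 2) := by
    rw [chi, posPow, ← rad_sq hρ]
  rw [maxwellian, radMaxw, e1, theta_eq hγ₁]

section

variable {l c : ℝ} (hl : 0 < l) (hc : 0 < c)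
include hl

lemma continuous_radMaxw_uncurry :
    Continuous fun q : (ℝ × ℝ) × ℝ => radMaxw l c q.1.1 q.1.2 q.2 := by
  have := continuous_posPow hl
  unfold radMaxw
  fun_prop

lemma continuous_radMaxw (r u : ℝ) : Continuous (radMaxw l c r u) :=
  (continuous_radMaxw_uncurry hl).comp (by fun_prop : Continuous fun ξ : ℝ => ((r, u), ξ))

lemma radMaxw_eq_zero {r u ξ : ℝ} (h : |r| ≤ |ξ - u|) : radMaxw l c r u ξ = 0 := by
  rw [radMaxw, posPow_of_nonpos hl (by linarith [sq_le_sq.2 h]), mul_zero, mul_zero]; rfl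

lemma hasCompactSupport_radMaxw (r u : ℝ) : HasCompactSupport (radMaxw l c r u) :=
  HasCompactSupport.intro (isCompact_Icc (a := u - |r|) (b := u + |r|)) fun ξ hξ => by
    refine radMaxw_eq_zero hl (not_lt.1 fun h => hξ ?_)
    rw [abs_lt] at h
    exact ⟨by linarith [h.1], by linarith [h.2]⟩

lemma integrable_radMaxw (r u : ℝ) : Integrable (radMaxw l c r u) muOut := by
  rw [integrable_muOut_iff]
  exact ((continuous_id.max continuous_const).smul
    (continuous_radMaxw hl r u)).integrable_of_hasCompactSupport
    (hasCompactSupport_radMaxw hl r u).smul_left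

/-- The half-flux of a Maxwellian. -/
def radFlux (l c r u : ℝ) : ℝ × ℝ := ∫ ξ, radMaxw l c r u ξ ∂muOut

omit hl in
-- Monotonicity of the energy slopes `(θ r²/2 - u²/2, u)`: the first summand is a square times a
-- mass, the second pairs an increasing function with its argument.
lemma radMaxw_monotonicity (l c r u r' u' ξ : ℝ) :
    (th l * (r' ^ 2 - r ^ 2) / 2 - (u' ^ 2 - u ^ 2) / 2) *
        ((radMaxw l c r' u' ξ).1 - (radMaxw l c r u ξ).1) +
      (u' - u) * ((radMaxw l c r' u' ξ).2 - (radMaxw l c r u ξ).2) =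
    (1 - th l) / 2 * (u' - u) ^ 2 * ((radMaxw l c r u ξ).1 + (radMaxw l c r' u' ξ).1) +
      th l / 2 * ((r' ^ 2 - (ξ - u') ^ 2 - (r ^ 2 - (ξ - u) ^ 2)) *
        ((radMaxw l c r' u' ξ).1 - (radMaxw l c r u ξ).1)) := by
  simp only [radMaxw]; ring

omit hl in
lemma radMaxw_fst_nonneg (hc : 0 < c) (r u ξ : ℝ) : 0 ≤ (radMaxw l c r u ξ).1 :=
  mul_nonneg hc.le (posPow_nonneg _ _)

omit hl in
/-- If two functions have the same integral and their difference is nonnegative in a fixed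
direction, then it vanishes in this direction. -/
lemma ae_eq_zero_of_integral_eq {ν : Measure ℝ} {p M : ℝ → ℝ × ℝ} (T₀ T₁ : ℝ)
    (hpi : Integrable p ν) (hMi : Integrable M ν) (heq : ∫ ξ, M ξ ∂ν = ∫ ξ, p ξ ∂ν)
    (h : ∀ ξ, 0 ≤ T₀ * ((p ξ).1 - (M ξ).1) + T₁ * ((p ξ).2 - (M ξ).2)) :
    ∀ᵐ ξ ∂ν, T₀ * ((p ξ).1 - (M ξ).1) + T₁ * ((p ξ).2 - (M ξ).2) = 0 := by
  obtain ⟨hi, hz⟩ := integral_direction_eq_zero T₀ T₁ hpi hMi heq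
  exact (integral_eq_zero_iff_of_nonneg h hi).1 hz

lemma radMaxw_gap_nonneg (hc : 0 < c) (r u r' u' ξ : ℝ) :
    0 ≤ (r' ^ 2 - (ξ - u') ^ 2 - (r ^ 2 - (ξ - u) ^ 2)) *
      ((radMaxw l c r' u' ξ).1 - (radMaxw l c r u ξ).1) := by
  simp only [radMaxw, ← mul_sub]
  rcases le_total (r' ^ 2 - (ξ - u') ^ 2) (r ^ 2 - (ξ - u) ^ 2) with h | h
  · exact mul_nonneg_of_nonpos_of_nonpos (by linarith)
      (mul_nonpos_of_nonneg_of_nonpos hc.le (by linarith [posPow_mono hl h]))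
  · exact mul_nonneg (by linarith) (mul_nonneg hc.le (by linarith [posPow_mono hl h]))

/-- Each of the two nonnegative summands must vanish. The second forces equal masses; the first then
forces equal centres or zero mass. -/
lemma radMaxw_eq_of_direction (hc : 0 < c) {r u r' u' ξ : ℝ}
    (h : (1 - th l) / 2 * (u' - u) ^ 2 * ((radMaxw l c r u ξ).1 + (radMaxw l c r' u' ξ).1) +
      th l / 2 * ((r' ^ 2 - (ξ - u') ^ 2 - (r ^ 2 - (ξ - u) ^ 2)) *
        ((radMaxw l c r' u' ξ).1 - (radMaxw l c r u ξ).1)) = 0) :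
    radMaxw l c r u ξ = radMaxw l c r' u' ξ := by
  have ht := th_pos hl
  have ht1 : 0 < 1 - th l := by linarith [th_lt_one hl]
  have p1 := radMaxw_fst_nonneg (l := l) hc r u ξ
  have p2 := radMaxw_fst_nonneg (l := l) hc r' u' ξ
  have hB := mul_nonneg (half_pos ht).le (radMaxw_gap_nonneg hl hc r u r' u' ξ)
  have hA : 0 ≤ (1 - th l) / 2 * (u' - u) ^ 2 *
      ((radMaxw l c r u ξ).1 + (radMaxw l c r' u' ξ).1) :=
    mul_nonneg (mul_nonneg (half_pos ht1).le (sq_nonneg _)) (add_nonneg p1 p2)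
  have hA0 := le_antisymm (by linarith) hA
  have hB0 := (mul_eq_zero.1 (le_antisymm (by linarith) hB)).resolve_left (half_pos ht).ne'
  have e1 : (radMaxw l c r u ξ).1 = (radMaxw l c r' u' ξ).1 := by
    rcases mul_eq_zero.1 hB0 with h | h
    · simp only [radMaxw]; rw [sub_eq_zero.1 h]
    · linarith
  rcases mul_eq_zero.1 hA0 with h | h
  · rcases mul_eq_zero.1 h with h | h
    · linarith
    · have : u' = u := sub_eq_zero.1 ((pow_eq_zero_iff two_ne_zero).1 h)
      subst this
      exact Prod.ext e1 (by simp only [radMaxw] at e1 ⊢; rw [e1])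
  · have z1 : (radMaxw l c r u ξ).1 = 0 := by linarith
    have z2 : (radMaxw l c r' u' ξ).1 = 0 := by linarith
    simp only [radMaxw] at z1 z2 ⊢
    rw [z1, z2, mul_zero, mul_zero]

include hc

/-- The half-flux determines the Maxwellian on positive velocities. -/
lemma radMaxw_eqOn {r u r' u' : ℝ} (h : radFlux l c r u = radFlux l c r' u') :
    EqOn (radMaxw l c r u) (radMaxw l c r' u') (Ioi 0) := by
  refine eqOn_of_ae_eq_muOut (continuous_radMaxw hl r u) (continuous_radMaxw hl r' u') ?_
  have := ae_eq_zero_of_integral_eq (th l * (r' ^ 2 - r ^ 2) / 2 - (u' ^ 2 - u ^ 2) / 2) (u' - u)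
    (integrable_radMaxw (c := c) hl r' u') (integrable_radMaxw (c := c) hl r u) h fun ξ => by
      rw [radMaxw_monotonicity]
      have ht1 : 0 < 1 - th l := by linarith [th_lt_one hl]
      exact add_nonneg (mul_nonneg (mul_nonneg (half_pos ht1).le (sq_nonneg _))
        (add_nonneg (radMaxw_fst_nonneg hc r u ξ) (radMaxw_fst_nonneg hc r' u' ξ)))
        (mul_nonneg (half_pos (th_pos hl)).le (radMaxw_gap_nonneg hl hc r u r' u' ξ))
  filter_upwards [this] with ξ hξ
  rw [radMaxw_monotonicity] at hξ
  exact radMaxw_eq_of_direction hl hc hξ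

lemma radFlux_inj {r u r' u' : ℝ} (hr : 0 < r) (hr' : 0 < r') (hu : 0 < u + r)
    (h : radFlux l c r u = radFlux l c r' u') : r = r' ∧ u = u' := by
  have ht := th_lt_one hl
  -- A single positive velocity inside the support suffices: the quotient of the components gives
  -- `u`, then the mass gives `r`.
  obtain ⟨ξ, hξ0, hξ1⟩ : ∃ ξ, max 0 (u - r) < ξ ∧ ξ < u + r :=
    exists_between (max_lt hu (by linarith))
  have hξ := radMaxw_eqOn hl hc h (show ξ ∈ Ioi 0 from (le_max_left _ _).trans_lt hξ0)
  have h2 : u - r < ξ := (le_max_right _ _).trans_lt hξ0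
  have hpos : 0 < posPow l (r ^ 2 - (ξ - u) ^ 2) := posPow_pos l (by nlinarith)
  simp only [radMaxw, Prod.mk.injEq] at hξ
  obtain ⟨h3, h4⟩ := hξ
  have h5 := mul_left_cancel₀ hc.ne' h3
  rw [← h3] at h4
  have h6 := mul_right_cancel₀ (by positivity) h4
  have hu' : u = u' := mul_left_cancel₀ (by linarith : 1 - th l ≠ 0) (by linarith)
  subst hu'
  refine ⟨?_, rfl⟩
  have hp1 := (posPow_pos_iff hl).1 hpos
  have hp2 := (posPow_pos_iff hl).1 (h5 ▸ hpos)
  rw [posPow_of_nonneg _ hp1.le, posPow_of_nonneg _ hp2.le,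
    Real.rpow_left_inj hp1.le hp2.le hl.ne'] at h5
  exact (sq_eq_sq₀ hr.le hr'.le).1 (by linarith)

end

/-! ### The half-flux profile -/

/-- The mass flux of the normalized Maxwellian with centre `m`. -/
def massProfile (l m : ℝ) : ℝ := ∫ y, max (m + y) 0 * posPow l (1 - y ^ 2)

/-- The momentum flux of the normalized Maxwellian with centre `m`. -/
def momProfile (l m : ℝ) : ℝ := ∫ y, max (m + y) 0 * (m + th l * y) * posPow l (1 - y ^ 2)

lemma integral_eq_integral_shift_scale (G : ℝ → ℝ) {r : ℝ} (hr : 0 < r) (m : ℝ) :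
    ∫ ξ, G ξ = r * ∫ y, G (r * (m + y)) := by
  rw [integral_add_left_eq_self (fun x => G (r * x)) m, Measure.integral_comp_mul_left,
    abs_of_pos (inv_pos.2 hr), smul_eq_mul, mul_inv_cancel_left₀ hr.ne']

section

variable {l c : ℝ} (hl : 0 < l)
include hl

omit hl in
lemma posPow_scale {r : ℝ} (hr : 0 < r) (x : ℝ) :
    posPow l (r ^ 2 * x) = r ^ (2 * l) * posPow l x := by
  rw [posPow_mul _ _ (sq_nonneg r), ← Real.rpow_natCast, ← Real.rpow_mul hr.le]; norm_num

/-- The substitution `ξ = r (m + y)` extracts all powers of `r`, leaving profiles of the single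
parameter `m`. -/
lemma radFlux_eq {r : ℝ} (hr : 0 < r) (m : ℝ) :
    radFlux l c r (r * m) =
      (c * r ^ (2 * l + 2) * massProfile l m, c * r ^ (2 * l + 3) * momProfile l m) := by
  have hi := integrable_radMaxw (c := c) hl r (r * m)
  have e2 : r ^ (2 * l + 2) = r ^ 2 * r ^ (2 * l) := by
    rw [Real.rpow_add hr]; norm_num; ring
  have e3 : r ^ (2 * l + 3) = r ^ 3 * r ^ (2 * l) := by
    rw [Real.rpow_add hr, show (3 : ℝ) = ((3 : ℕ) : ℝ) by norm_num, Real.rpow_natCast]; ring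
  have hp : ∀ y, posPow l (r ^ 2 - (r * (m + y) - r * m) ^ 2) =
      r ^ (2 * l) * posPow l (1 - y ^ 2) := fun y => by
    rw [← posPow_scale hr]; congr 1; ring
  have hm : ∀ y, max (r * (m + y)) 0 = r * max (m + y) 0 := fun y => by
    rw [mul_max_of_nonneg _ _ hr.le, mul_zero]
  rw [radFlux]
  refine Prod.ext ?_ ?_
  · rw [fst_integral hi, integral_muOut, integral_eq_integral_shift_scale _ hr m]
    simp only [radMaxw, hp, hm, massProfile, smul_eq_mul]
    rw [e2, ← integral_const_mul, ← integral_const_mul]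
    congr 1; ext y; ring
  · rw [snd_integral hi, integral_muOut, integral_eq_integral_shift_scale _ hr m]
    simp only [radMaxw, hp, hm, momProfile, smul_eq_mul]
    rw [e3, ← integral_const_mul, ← integral_const_mul]
    congr 1; ext y; ring

lemma hasCompactSupport_weight : HasCompactSupport fun y : ℝ => posPow l (1 - y ^ 2) :=
  HasCompactSupport.intro (isCompact_Icc (a := (-1 : ℝ)) (b := 1)) fun y hy => by
    refine posPow_of_nonpos hl (not_lt.1 fun h => hy ?_)
    exact abs_le.1 (sq_le_one_iff_abs_le_one y |>.1 (by linarith))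

lemma integrable_mul_weight {F : ℝ → ℝ} (hF : Continuous F) :
    Integrable fun y => F y * posPow l (1 - y ^ 2) :=
  (hF.mul (continuous_weight hl)).integrable_of_hasCompactSupport
    (hasCompactSupport_weight hl).mul_left

lemma integral_mul_weight (F : ℝ → ℝ) :
    ∫ y, F y * posPow l (1 - y ^ 2) = ∫ y in (-1 : ℝ)..1, F y * posPow l (1 - y ^ 2) := by
  rw [intervalIntegral.integral_of_le (by norm_num), ← integral_Icc_eq_integral_Ioc]
  refine (setIntegral_eq_integral_of_forall_compl_eq_zero fun y hy => ?_).symm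
  rw [posPow_of_nonpos hl (not_lt.1 fun h => hy ?_), mul_zero]
  exact abs_le.1 (sq_le_one_iff_abs_le_one y |>.1 (by linarith))

lemma integral_mul_weight_mono {F G : ℝ → ℝ} (hF : Continuous F) (hG : Continuous G)
    (h : ∀ y ∈ Icc (-1 : ℝ) 1, F y ≤ G y) :
    ∫ y, F y * posPow l (1 - y ^ 2) ≤ ∫ y, G y * posPow l (1 - y ^ 2) := by
  refine integral_mono (integrable_mul_weight hl hF) (integrable_mul_weight hl hG) fun y => ?_
  by_cases hy : y ∈ Icc (-1 : ℝ) 1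
  · exact mul_le_mul_of_nonneg_right (h y hy) (posPow_nonneg _ _)
  · have : posPow l (1 - y ^ 2) = 0 := posPow_of_nonpos hl (not_lt.1 fun h =>
      hy (abs_le.1 (sq_le_one_iff_abs_le_one y |>.1 (by linarith))))
    simp only [this, mul_zero, le_refl]

lemma continuous_integral_mul_weight {F : ℝ → ℝ → ℝ} (hF : Continuous F.uncurry) :
    Continuous fun m => ∫ y, F m y * posPow l (1 - y ^ 2) := by
  simp only [integral_mul_weight hl]
  refine intervalIntegral.continuous_parametric_intervalIntegral_of_continuous'
    (f := fun m y => F m y * posPow l (1 - y ^ 2)) ?_ _ _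
  exact hF.mul ((continuous_weight hl).comp continuous_snd)

lemma continuous_massProfile : Continuous (massProfile l) :=
  continuous_integral_mul_weight hl (F := fun m y => max (m + y) 0) (by
    simp only [Function.uncurry_def]; fun_prop)

lemma continuous_momProfile : Continuous (momProfile l) :=
  continuous_integral_mul_weight hl (F := fun m y => max (m + y) 0 * (m + th l * y)) (by
    simp only [Function.uncurry_def]; fun_prop)

lemma massProfile_mono : Monotone (massProfile l) := fun m m' h =>
  integral_mul_weight_mono hl (F := fun y => max (m + y) 0) (G := fun y => max (m' + y) 0)
    (by fun_prop) (by fun_prop) fun y _ => max_le_max_right _ (by linarith)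

lemma massProfile_neg_one : massProfile l (-1) = 0 := by
  refine integral_eq_zero_of_ae (ae_of_all _ fun y => ?_)
  rcases le_total y 1 with h | h
  · simp only [max_eq_right (by linarith : -1 + y ≤ 0), zero_mul, Pi.zero_apply]
  · simp only [posPow_of_nonpos hl (by nlinarith : 1 - y ^ 2 ≤ 0), mul_zero, Pi.zero_apply]

lemma massProfile_pos {m : ℝ} (hm : -1 < m) : 0 < massProfile l m := by
  obtain ⟨y, hy1, hy2⟩ : ∃ y, max (-m) (-1) < y ∧ y < 1 :=
    exists_between (max_lt (by linarith) (by norm_num))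
  have h1 := (le_max_left _ _).trans_lt hy1
  have h2 := (le_max_right _ _).trans_lt hy1
  have hc : Continuous fun y => max (m + y) 0 * posPow l (1 - y ^ 2) :=
    ((continuous_const.add continuous_id).max continuous_const).mul (continuous_weight hl)
  refine hc.integral_pos_of_hasCompactSupport_nonneg_nonzero
    (hasCompactSupport_weight hl).mul_left
    (fun y => mul_nonneg (le_max_right _ _) (posPow_nonneg _ _)) (x := y) ?_
  exact (mul_pos (lt_max_of_lt_left (by linarith)) (posPow_pos l (by nlinarith))).ne'

lemma massProfile_le {m : ℝ} (hm : -1 < m) : massProfile l m ≤ (m + 1) * betaFull l := by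
  have e : (m + 1) * betaFull l = ∫ y, (fun _ => m + 1) y * posPow l (1 - y ^ 2) := by
    rw [integral_mul_weight hl, intervalIntegral.integral_const_mul]; rfl
  rw [e]
  exact integral_mul_weight_mono hl (by fun_prop) continuous_const fun y hy =>
    max_le (by linarith [hy.2]) (by linarith)

lemma momProfile_le (m : ℝ) : momProfile l m ≤ (m + th l) * massProfile l m := by
  have ht := th_pos hl
  rw [massProfile, ← integral_const_mul]
  simp only [← mul_assoc]
  refine integral_mul_weight_mono hl (F := fun y => max (m + y) 0 * (m + th l * y))
    (G := fun y => (m + th l) * max (m + y) 0) (by fun_prop) (by fun_prop) fun y hy => ?_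
  rw [mul_comm]
  exact mul_le_mul_of_nonneg_right (by nlinarith [hy.2]) (le_max_right _ _)

/-- Only velocities with `y ≥ -m` contribute, and there `m + θ y ≥ (1 - θ) m`. -/
lemma le_momProfile (m : ℝ) : (1 - th l) * m * massProfile l m ≤ momProfile l m := by
  have ht := th_pos hl
  rw [massProfile, ← integral_const_mul]
  simp only [← mul_assoc]
  refine integral_mul_weight_mono hl (F := fun y => (1 - th l) * m * max (m + y) 0)
    (G := fun y => max (m + y) 0 * (m + th l * y)) (by fun_prop) (by fun_prop) fun y hy => ?_
  rw [mul_comm]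
  rcases le_total (m + y) 0 with h | h
  · rw [max_eq_right h, zero_mul, zero_mul]
  · exact mul_le_mul_of_nonneg_left (by nlinarith) (le_max_right _ _)

end

/-! ### Inversion of the half-flux -/

/-- The scale-invariant quotient of momentum and mass flux. -/
def fluxRatio (l m : ℝ) : ℝ :=
  momProfile l m / massProfile l m ^ (1 + 1 / (2 * l + 2))

section

variable {l c : ℝ} (hl : 0 < l)
include hl

lemma fluxRatio_le {m : ℝ} (hm : -1 < m) :
    fluxRatio l m ≤ (m + th l) * massProfile l m ^ (-(1 / (2 * l + 2))) := by
  have hA := massProfile_pos hl hm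
  rw [fluxRatio, div_le_iff₀ (by positivity), mul_assoc, ← Real.rpow_add hA,
    show -(1 / (2 * l + 2)) + (1 + 1 / (2 * l + 2)) = 1 by ring, Real.rpow_one]
  exact momProfile_le hl m

lemma le_fluxRatio {m : ℝ} (hm : -1 < m) :
    (1 - th l) * m * massProfile l m ^ (-(1 / (2 * l + 2))) ≤ fluxRatio l m := by
  have hA := massProfile_pos hl hm
  rw [fluxRatio, le_div_iff₀ (by positivity), mul_assoc, ← Real.rpow_add hA,
    show -(1 / (2 * l + 2)) + (1 + 1 / (2 * l + 2)) = 1 by ring, Real.rpow_one]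
  exact le_momProfile hl m

/-- The mass profile grows at most linearly, so the ratio is at least of order `m ^ (1 - q)` with `q
= 1 / (2l + 2) < 1`. -/
lemma tendsto_fluxRatio_atTop : Tendsto (fluxRatio l) atTop atTop := by
  have ht1 : 0 < 1 - th l := by linarith [th_lt_one hl]
  have hJ := betaFull_pos hl
  have hq : 1 / (2 * l + 2) < 1 := by rw [div_lt_one (by linarith)]; linarith
  have hq0 : 0 < 1 / (2 * l + 2) := by positivity
  generalize hqd : 1 / (2 * l + 2) = q at *
  have h1 : Tendsto (fun m : ℝ => (1 - th l) * (2 * betaFull l) ^ (-q) * m ^ (1 - q)) atTop atTop :=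
    (tendsto_rpow_atTop (by linarith)).const_mul_atTop (by positivity)
  refine tendsto_atTop_mono' atTop ?_ h1
  filter_upwards [eventually_ge_atTop 1] with m hm
  have h0 : 0 < m := by linarith
  have h2 := le_fluxRatio hl (by linarith : -1 < m)
  rw [hqd] at h2
  refine le_trans ?_ h2
  have hA := massProfile_pos hl (by linarith : -1 < m)
  have h3 : massProfile l m ≤ 2 * betaFull l * m :=
    (massProfile_le hl (by linarith)).trans (by nlinarith)
  have h4 := Real.rpow_le_rpow_of_nonpos hA h3 (by linarith : -q ≤ 0)
  rw [Real.mul_rpow (by positivity) h0.le] at h4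
  rw [sub_eq_add_neg 1 q, Real.rpow_add h0, Real.rpow_one]
  have := mul_le_mul_of_nonneg_left h4 (by positivity : 0 ≤ (1 - th l) * m)
  linarith

/-- Near `m = -1` the mean `m + θ` is below `-(1 - θ)/2`, while the negative power of the vanishing
mass profile blows up. -/
lemma tendsto_fluxRatio_neg_one : Tendsto (fluxRatio l) (𝓝[>] (-1)) atBot := by
  have ht1 : 0 < 1 - th l := by linarith [th_lt_one hl]
  have hq0 : 0 < 1 / (2 * l + 2) := by positivity
  have h1 : Tendsto (massProfile l) (𝓝[>] (-1)) (𝓝[>] 0) := by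
    refine tendsto_nhdsWithin_iff.2 ⟨?_, ?_⟩
    · have := (continuous_massProfile hl).tendsto (-1)
      rw [massProfile_neg_one hl] at this
      exact this.mono_left nhdsWithin_le_nhds
    · filter_upwards [self_mem_nhdsWithin] with m hm using massProfile_pos hl hm
  have h2 : Tendsto (fun m => massProfile l m ^ (-(1 / (2 * l + 2)))) (𝓝[>] (-1)) atTop :=
    (tendsto_rpow_neg_nhdsGT_zero (by linarith)).comp h1
  have h3 : Tendsto (fun m => -((1 - th l) / 2) * massProfile l m ^ (-(1 / (2 * l + 2))))
      (𝓝[>] (-1)) atBot := h2.const_mul_atTop_of_neg (by linarith)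
  refine tendsto_atBot_mono' _ ?_ h3
  have h4 : ∀ᶠ m in 𝓝[>] (-1 : ℝ), m < -(1 + th l) / 2 :=
    mem_nhdsWithin_of_mem_nhds (Iio_mem_nhds (by linarith))
  filter_upwards [self_mem_nhdsWithin, h4] with m hm hm'
  refine (fluxRatio_le hl hm).trans (mul_le_mul_of_nonneg_right (by linarith) ?_)
  exact Real.rpow_nonneg (massProfile_pos hl hm).le _

/-- The radius is the one for which the mass flux `c r ^ (2l + 2) * massProfile l m` equals `f₀`;
the momentum flux is then a multiple of `fluxRatio l m`. -/
lemma radFlux_of_fluxRatio (hc : 0 < c) {m f₀ : ℝ} (hm : -1 < m) (hf : 0 < f₀) :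
    radFlux l c ((f₀ / (c * massProfile l m)) ^ (1 / (2 * l + 2)))
      ((f₀ / (c * massProfile l m)) ^ (1 / (2 * l + 2)) * m) =
      (f₀, c ^ (-(1 / (2 * l + 2))) * f₀ ^ (1 + 1 / (2 * l + 2)) * fluxRatio l m) := by
  have hA := massProfile_pos hl hm
  have hX : 0 < f₀ / (c * massProfile l m) := by positivity
  have h2 : 2 * l + 2 ≠ 0 := by positivity
  rw [radFlux_eq hl (by positivity), ← Real.rpow_mul hX.le, ← Real.rpow_mul hX.le,
    one_div_mul_cancel h2, Real.rpow_one,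
    show 1 / (2 * l + 2) * (2 * l + 3) = 1 + 1 / (2 * l + 2) by field_simp; ring]
  refine Prod.ext (by simp only; field_simp) ?_
  simp only
  rw [fluxRatio, Real.div_rpow hf.le (by positivity), Real.mul_rpow hc.le hA.le,
    Real.rpow_add hc, Real.rpow_one, Real.rpow_neg hc.le]
  have := (Real.rpow_pos_of_pos hA (1 + 1 / (2 * l + 2))).ne'
  have := (Real.rpow_pos_of_pos hc (1 / (2 * l + 2))).ne'
  generalize massProfile l m ^ (1 + 1 / (2 * l + 2)) = X1 at *
  generalize c ^ (1 / (2 * l + 2)) = X2 at *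
  generalize f₀ ^ (1 + 1 / (2 * l + 2)) = X3 at *
  field_simp

/-- After normalization to unit mass flux and `c = 1`, equal ratios mean equal half-fluxes, so
`radFlux_inj` applies. No derivative of the profiles is needed. -/
lemma fluxRatio_injOn : InjOn (fluxRatio l) (Ioi (-1)) := fun m hm m' hm' h => by
  have e1 := radFlux_of_fluxRatio (c := 1) hl one_pos hm one_pos
  have e2 := radFlux_of_fluxRatio (c := 1) hl one_pos hm' one_pos
  have hA := massProfile_pos hl hm
  have hA' := massProfile_pos hl hm'
  rw [← h, ← e1] at e2
  rw [mem_Ioi] at hm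
  have hR : 0 < (1 / (1 * massProfile l m)) ^ (1 / (2 * l + 2)) := by positivity
  obtain ⟨h1, h2⟩ := radFlux_inj hl one_pos hR (by positivity) (by nlinarith) e2.symm
  rw [← h1] at h2
  exact mul_left_cancel₀ hR.ne' h2

lemma continuousOn_fluxRatio : ContinuousOn (fluxRatio l) (Ioi (-1)) :=
  (continuous_momProfile hl).continuousOn.div
    ((continuous_massProfile hl).continuousOn.rpow_const fun _ hm =>
      Or.inl (massProfile_pos hl hm).ne')
    fun _ hm => (Real.rpow_pos_of_pos (massProfile_pos hl hm) _).ne'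

/-- The profile parameter is a continuous function of the flux ratio. -/
lemma exists_fluxRatio_inverse :
    ∃ G : ℝ → ℝ, Continuous G ∧ ∀ x, -1 < G x ∧ fluxRatio l (G x) = x := by
  -- The exponential reparametrizes `(-1, ∞)` by the whole line, where a continuous injection with
  -- these limits is an order isomorphism; its inverse is continuous.
  let h : ℝ → ℝ := fun s => fluxRatio l (Real.exp s - 1)
  have hgt : ∀ s, -1 < Real.exp s - 1 := fun s => by linarith [Real.exp_pos s]
  have hcont : Continuous h :=
    (continuousOn_fluxRatio hl).comp_continuous (by fun_prop) fun s => hgt s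
  have hinj : Function.Injective h := fun s s' hs =>
    Real.exp_injective (by linarith [fluxRatio_injOn hl (hgt s) (hgt s') hs])
  have htop : Tendsto h atTop atTop := (tendsto_fluxRatio_atTop hl).comp
    (tendsto_atTop_add_const_right _ _ Real.tendsto_exp_atTop)
  have hbot : Tendsto h atBot atBot := by
    refine (tendsto_fluxRatio_neg_one hl).comp (tendsto_nhdsWithin_iff.2 ⟨?_, ?_⟩)
    · simpa using Real.tendsto_exp_atBot.sub_const 1
    · exact Eventually.of_forall hgt
  have hmono : StrictMono h := by
    refine (hcont.strictMono_of_inj hinj).resolve_right fun hanti => ?_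
    obtain ⟨s, hs, hs0⟩ := ((htop.eventually_gt_atTop (h 0)).and (eventually_ge_atTop 0)).exists
    exact absurd (hanti.antitone hs0) (not_le.2 hs)
  let e := hmono.orderIsoOfSurjective h (hcont.surjective htop hbot)
  refine ⟨fun x => Real.exp (e.symm x) - 1, ?_, fun x => ⟨hgt _, ?_⟩⟩
  · exact (Real.continuous_exp.comp e.symm.continuous).sub continuous_const
  · exact e.apply_symm_apply x

/-- The parameters of the Maxwellian are continuous functions of its half-flux. -/
lemma exists_radFlux_inverse (hc : 0 < c) :
    ∃ Q : ℝ × ℝ → ℝ × ℝ, ContinuousOn Q {f | 0 < f.1} ∧ ∀ f : ℝ × ℝ, 0 < f.1 →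
      0 < (Q f).1 ∧ 0 < (Q f).2 + (Q f).1 ∧ radFlux l c (Q f).1 (Q f).2 = f := by
  obtain ⟨G, hG, hG'⟩ := exists_fluxRatio_inverse hl
  have hq0 : 0 < 1 / (2 * l + 2) := by positivity
  generalize hqd : 1 / (2 * l + 2) = q at *
  let m : ℝ × ℝ → ℝ := fun f => G (c ^ q * f.2 / f.1 ^ (1 + q))
  let R : ℝ × ℝ → ℝ := fun f => (f.1 / (c * massProfile l (m f))) ^ q
  have hm : ∀ f, -1 < m f := fun f => (hG' _).1
  have hA : ∀ f, 0 < massProfile l (m f) := fun f => massProfile_pos hl (hm f)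
  have hmc : ContinuousOn m {f | 0 < f.1} := by
    refine hG.comp_continuousOn (ContinuousOn.div (by fun_prop) ?_ ?_)
    · exact continuousOn_fst.rpow_const fun f hf => Or.inl (ne_of_gt hf)
    · exact fun f hf => (Real.rpow_pos_of_pos hf _).ne'
  have hRc : ContinuousOn R {f | 0 < f.1} := by
    refine ContinuousOn.rpow_const ?_ fun f hf => Or.inr hq0.le
    exact continuousOn_fst.div (continuousOn_const.mul
      ((continuous_massProfile hl).comp_continuousOn hmc)) fun f hf => by
        have := hA f; positivity
  refine ⟨fun f => (R f, R f * m f), hRc.prodMk (hRc.mul hmc), fun f hf => ?_⟩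
  have hR : 0 < R f := Real.rpow_pos_of_pos (div_pos hf (mul_pos hc (hA f))) _
  refine ⟨hR, by simp only; nlinarith [hm f], ?_⟩
  have h := radFlux_of_fluxRatio hl hc (hm f) hf
  rw [hqd] at h
  refine h.trans (Prod.ext rfl ?_)
  simp only
  rw [show fluxRatio l (m f) = _ from (hG' _).2, Real.rpow_neg hc.le]
  have := (Real.rpow_pos_of_pos hc q).ne'
  have := (Real.rpow_pos_of_pos hf (1 + q)).ne'
  field_simp

end

/-! ### Maxwellians as functions of their half-flux -/

section

variable {l c : ℝ} (hl : 0 < l)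
include hl

lemma continuous_toL1_radMaxw :
    Continuous fun q : ℝ × ℝ => (integrable_radMaxw (c := c) hl q.1 q.2).toL1 := by
  refine continuous_iff_continuousAt.2 fun q₀ => tendsto_iff_edist_tendsto_0.2 ?_
  simp only [Integrable.edist_toL1_toL1]
  have hcont := continuous_radMaxw_uncurry (c := c) hl
  -- All Maxwellians with parameters within distance `1` of `q₀` vanish for `|ξ| > N`; a multiple of
  -- the cut-off `ψ` below is a common majorant.
  obtain ⟨N, hN⟩ : ∃ N, N = |q₀.1| + |q₀.2| + 2 := ⟨_, rfl⟩
  have hN0 : 0 ≤ N := by rw [hN]; positivity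
  obtain ⟨C, hC⟩ : ∃ C, ∀ q ∈ Metric.closedBall q₀ 1, ∀ ξ ∈ Icc (-N) N,
      ‖radMaxw l c q.1 q.2 ξ‖ ≤ C := by
    have hK : IsCompact (Metric.closedBall q₀ 1 ×ˢ Icc (-N) N) :=
      (isCompact_closedBall q₀ 1).prod isCompact_Icc
    obtain ⟨C, hC⟩ := hK.exists_bound_of_continuousOn
      (f := fun q : (ℝ × ℝ) × ℝ => radMaxw l c q.1.1 q.1.2 q.2) hcont.continuousOn
    exact ⟨C, fun q hq ξ hξ => hC (q, ξ) (mk_mem_prod hq hξ)⟩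
  let ψ : ℝ → ℝ := fun ξ => max (N + 1 - |ξ|) 0
  have hψ : Integrable ψ muOut := by
    rw [integrable_muOut_iff]
    refine Continuous.integrable_of_hasCompactSupport (by fun_prop) ?_
    refine HasCompactSupport.intro (isCompact_Icc (a := -(N + 1)) (b := N + 1)) fun ξ hξ => ?_
    have h0 : ψ ξ = 0 := by
      refine max_eq_right ?_
      by_contra h
      exact hξ (abs_le.1 (by linarith))
    rw [h0, smul_zero]
  have hC0 : 0 ≤ C := (norm_nonneg (radMaxw l c q₀.1 q₀.2 0)).trans
    (hC q₀ (Metric.mem_closedBall_self zero_le_one) 0 ⟨neg_nonpos.2 hN0, hN0⟩)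
  have key : ∀ q ∈ Metric.closedBall q₀ 1, ∀ ξ, ‖radMaxw l c q.1 q.2 ξ‖ ≤ C * ψ ξ := by
    intro q hq ξ
    by_cases hξ : ξ ∈ Icc (-N) N
    · have h1 : 1 ≤ ψ ξ := le_max_of_le_left (by have := abs_le.2 hξ; linarith)
      exact (hC q hq ξ hξ).trans (by nlinarith)
    · rw [radMaxw_eq_zero hl, norm_zero]
      · exact mul_nonneg hC0 (le_max_right _ _)
      · have h2 : N < |ξ| := not_le.1 fun h => hξ (abs_le.1 h)
        rw [Metric.mem_closedBall, Prod.dist_eq, max_le_iff, Real.dist_eq, Real.dist_eq] at hq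
        have h3 := abs_sub_abs_le_abs_sub q.1 q₀.1
        have h4 := abs_sub_abs_le_abs_sub q.2 q₀.2
        have h5 := abs_sub_abs_le_abs_sub ξ q.2
        linarith [hq.1, hq.2]
  have hz : (0 : ℝ≥0∞) = ∫⁻ ξ, 0 ∂muOut := by simp
  rw [hz]
  refine tendsto_lintegral_filter_of_dominated_convergence
    (fun ξ => ENNReal.ofReal (2 * C * ψ ξ)) ?_ ?_ ?_ ?_
  · exact Eventually.of_forall fun q => ((continuous_radMaxw hl _ _).edist
      (continuous_radMaxw hl _ _)).measurable
  · filter_upwards [Metric.closedBall_mem_nhds q₀ one_pos] with q hq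
    refine ae_of_all _ fun ξ => ?_
    rw [edist_dist]
    refine ENNReal.ofReal_le_ofReal ((dist_le_norm_add_norm _ _).trans ?_)
    linarith [key q hq ξ, key q₀ (Metric.mem_closedBall_self zero_le_one) ξ]
  · exact (hψ.const_mul (2 * C)).lintegral_lt_top.ne
  · refine ae_of_all _ fun ξ => ?_
    refine tendsto_iff_edist_tendsto_0.1 (Continuous.tendsto
      (f := fun q : ℝ × ℝ => radMaxw l c q.1 q.2 ξ) ?_ q₀)
    exact hcont.comp (by fun_prop : Continuous fun q : ℝ × ℝ => (q, ξ))

/-- An affine bound for the modulus of the quotient of the components converts the `L¹` norm into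
the two components of the half-flux. -/
lemma integral_norm_radMaxw_le (hc : 0 < c) {r u K s : ℝ}
    (h : ∀ ξ, 0 < (radMaxw l c r u ξ).1 →
      |(1 - th l) * u + th l * ξ| ≤ K + s * ((1 - th l) * u + th l * ξ)) :
    ∫ ξ, ‖radMaxw l c r u ξ‖ ∂muOut ≤
      (1 + K) * (radFlux l c r u).1 + s * (radFlux l c r u).2 := by
  have hi := integrable_radMaxw (c := c) hl r u
  rw [radFlux, fst_integral hi, snd_integral hi, ← integral_const_mul, ← integral_const_mul,
    ← integral_add (hi.fst.const_mul _) (hi.snd.const_mul _)]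
  refine integral_mono hi.norm ((hi.fst.const_mul _).add (hi.snd.const_mul _)) fun ξ => ?_
  have h0 := radMaxw_fst_nonneg (l := l) hc r u ξ
  have e : (radMaxw l c r u ξ).2 = ((1 - th l) * u + th l * ξ) * (radMaxw l c r u ξ).1 := rfl
  have h1 : ‖radMaxw l c r u ξ‖ ≤ (radMaxw l c r u ξ).1 + |(radMaxw l c r u ξ).2| := by
    rw [Prod.norm_def, Real.norm_eq_abs, Real.norm_eq_abs, abs_of_nonneg h0]
    exact max_le (by linarith [abs_nonneg (radMaxw l c r u ξ).2]) (by linarith)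
  refine h1.trans ?_
  rw [e, abs_mul, abs_of_nonneg h0]
  rcases h0.eq_or_lt with h0 | h0
  · rw [← h0]; simp
  · have := mul_le_mul_of_nonneg_right (h ξ h0) h0.le
    linarith

/-- The `L¹` norm of a Maxwellian is small if its half-flux is small. -/
lemma integral_norm_radMaxw_le_of_flux (hc : 0 < c) {r u : ℝ} (hr : 0 < r) (hu : 0 < u + r) :
    ∫ ξ, ‖radMaxw l c r u ξ‖ ∂muOut ≤ (radFlux l c r u).1 + |(radFlux l c r u).2| +
      4 * ((radFlux l c r u).1 / (c * massProfile l (-th l))) ^ (1 / (2 * l + 2)) *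
        (radFlux l c r u).1 := by
  have ht := th_pos hl
  have ht1 := th_lt_one hl
  have hA := massProfile_pos hl (by linarith : -1 < -th l)
  have hF0 : 0 ≤ (radFlux l c r u).1 := by
    rw [radFlux, fst_integral (integrable_radMaxw hl r u)]
    exact integral_nonneg fun ξ => radMaxw_fst_nonneg hc r u ξ
  have hsupp : ∀ ξ, 0 < (radMaxw l c r u ξ).1 → |ξ - u| ≤ r := fun ξ hξ => by
    by_contra h
    rw [radMaxw_eq_zero hl (by rw [abs_of_pos hr]; exact (not_le.1 h).le)] at hξ
    exact hξ.false
  -- In the first case the quotient of the components is nonpositive on the whole support, so the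
  -- momentum flux controls it.
  rcases le_total u (-th l * r) with hcase | hcase
  · have := integral_norm_radMaxw_le hl hc (K := 0) (s := -1) (r := r) (u := u) fun ξ hξ => by
      have := abs_le.1 (hsupp ξ hξ)
      rw [abs_of_nonpos (by nlinarith)]; linarith
    have h2 := neg_abs_le (radFlux l c r u).2
    have : 0 ≤ 4 * ((radFlux l c r u).1 / (c * massProfile l (-th l))) ^ (1 / (2 * l + 2)) *
        (radFlux l c r u).1 := by positivity
    linarith
  -- In the second case the quotient is at least `-2r`, and `u / r ≥ -θ` bounds `r` by a power of
  -- the mass flux through monotonicity of `massProfile`.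
  · have := integral_norm_radMaxw_le hl hc (K := 4 * r) (s := 1) (r := r) (u := u) fun ξ hξ => by
      have := abs_le.1 (hsupp ξ hξ)
      have h3 : -(2 * r) ≤ (1 - th l) * u + th l * ξ := by nlinarith
      rw [abs_le]; constructor <;> linarith
    have hR : r ≤ ((radFlux l c r u).1 / (c * massProfile l (-th l))) ^ (1 / (2 * l + 2)) := by
      have e := radFlux_eq (c := c) hl hr (u / r)
      rw [mul_div_cancel₀ _ hr.ne'] at e
      have hmono := massProfile_mono hl (show -th l ≤ u / r by rwa [le_div_iff₀ hr])
      have h4 : r ^ (2 * l + 2) ≤ (radFlux l c r u).1 / (c * massProfile l (-th l)) := by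
        rw [le_div_iff₀ (by positivity), e]
        simp only
        have := mul_le_mul_of_nonneg_left hmono (by positivity : 0 ≤ c * r ^ (2 * l + 2))
        linarith
      have h5 := Real.rpow_le_rpow (by positivity) h4 (by positivity : 0 ≤ 1 / (2 * l + 2))
      rwa [← Real.rpow_mul hr.le, mul_one_div_cancel (by positivity), Real.rpow_one] at h5
    have h2 := le_abs_self (radFlux l c r u).2
    have := mul_le_mul_of_nonneg_right hR hF0
    linarith

omit hl in
lemma zero_mem_stateD : (0 : ℝ × ℝ) ∈ stateD := Or.inr ⟨rfl, rfl⟩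

/-- The Maxwellian with prescribed half-flux, as a continuous `L¹`-valued function on the
admissible states. -/
lemma exists_maxwellianOfFlux (hc : 0 < c) :
    ∃ 𝓜 : ℝ × ℝ → Lp (ℝ × ℝ) 1 muOut, ContinuousOn 𝓜 stateD ∧ ∀ f ∈ stateD,
      ∃ r u : ℝ, 0 ≤ r ∧ (0 < f.1 → 0 < r ∧ 0 < u + r) ∧
        𝓜 f =ᵐ[muOut] radMaxw l c r u ∧ radFlux l c r u = f := by
  classical
  obtain ⟨Q, hQc, hQ⟩ := exists_radFlux_inverse hl hc
  let L : ℝ × ℝ → Lp (ℝ × ℝ) 1 muOut := fun q => (integrable_radMaxw (c := c) hl q.1 q.2).toL1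
  have hLc : Continuous L := continuous_toL1_radMaxw hl
  have hzero : ∀ ξ, radMaxw l c 0 0 ξ = 0 := fun ξ => radMaxw_eq_zero hl (by simp)
  let 𝓜 : ℝ × ℝ → Lp (ℝ × ℝ) 1 muOut := fun f => if 0 < f.1 then L (Q f) else 0
  refine ⟨𝓜, fun f hf => ?_, fun f hf => ?_⟩
  · rcases stateD_cases hf with h | rfl
    · refine ContinuousAt.continuousWithinAt ?_
      have hopen : {f : ℝ × ℝ | 0 < f.1} ∈ 𝓝 f :=
        (isOpen_lt continuous_const continuous_fst).mem_nhds h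
      have h1 : ContinuousAt (fun f => L (Q f)) f :=
        hLc.continuousAt.comp (hQc.continuousAt hopen)
      refine h1.congr ?_
      filter_upwards [hopen] with f' hf' using (if_pos hf').symm
    -- Continuity at the vacuum does not come from the parameters `Q`, but from the norm bound,
    -- whose right side tends to zero.
    · have h0 : 𝓜 0 = 0 := if_neg (lt_irrefl _)
      rw [ContinuousWithinAt, h0, tendsto_zero_iff_norm_tendsto_zero]
      have hlim : Continuous fun f : ℝ × ℝ => f.1 + |f.2| +
          4 * (f.1 / (c * massProfile l (-th l))) ^ (1 / (2 * l + 2)) * f.1 := by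
        have : Continuous fun f : ℝ × ℝ =>
            (f.1 / (c * massProfile l (-th l))) ^ (1 / (2 * l + 2)) :=
          (continuous_fst.div_const _).rpow_const fun _ => Or.inr (by positivity)
        fun_prop
      have hlim0 := hlim.tendsto 0
      simp only [Prod.fst_zero, Prod.snd_zero, abs_zero, add_zero, mul_zero] at hlim0
      refine squeeze_zero' (Eventually.of_forall fun _ => norm_nonneg _) ?_
        (hlim0.mono_left nhdsWithin_le_nhds)
      filter_upwards [self_mem_nhdsWithin] with f hf
      rcases stateD_cases hf with h | rfl
      · obtain ⟨h1, h2, h3⟩ := hQ f h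
        have h4 := integral_norm_radMaxw_le_of_flux hl hc h1 h2
        rw [h3] at h4
        refine le_trans (le_of_eq ?_) h4
        rw [show 𝓜 f = L (Q f) from if_pos h, L1.norm_eq_integral_norm]
        exact integral_congr_ae ((integrable_radMaxw hl _ _).coeFn_toL1.fun_comp _)
      · rw [h0]; simp
  · rcases stateD_cases hf with h | rfl
    · obtain ⟨h1, h2, h3⟩ := hQ f h
      refine ⟨(Q f).1, (Q f).2, h1.le, fun _ => ⟨h1, h2⟩, ?_, h3⟩
      rw [show 𝓜 f = L (Q f) from if_pos h]
      exact (integrable_radMaxw hl _ _).coeFn_toL1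
    · refine ⟨0, 0, le_rfl, fun h => absurd h (lt_irrefl _), ?_, ?_⟩
      · rw [show 𝓜 0 = 0 from if_neg (lt_irrefl _)]
        filter_upwards [Lp.coeFn_zero (ℝ × ℝ) 1 muOut] with ξ hξ
        rw [hξ, hzero]; rfl
      · rw [radFlux]; simp only [hzero, integral_zero]

end

/-! ### The Maxwellian outflow -/

section

variable {γ κ : ℝ} (hγ₁ : 1 < γ) (hγ₃ : γ < 3) (hκ : 0 < κ)
include hγ₁

lemma maxwellian_eq_radMaxw' {ρ : ℝ} (hρ : 0 ≤ ρ) (u : ℝ) :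
    maxwellian γ κ ρ u = radMaxw (lam γ) (cConst γ κ) (rad γ κ ρ) u :=
  funext (maxwellian_eq_radMaxw hγ₁ hρ u)

lemma halfFlux_eq {ρ : ℝ} (hρ : 0 ≤ ρ) (u : ℝ) :
    halfFlux γ κ ρ u = radFlux (lam γ) (cConst γ κ) (rad γ κ ρ) u := by
  rw [halfFlux, radFlux, maxwellian_eq_radMaxw' hγ₁ hρ]

include hγ₃

lemma integrable_maxwellian {ρ : ℝ} (hρ : 0 ≤ ρ) (u : ℝ) :
    Integrable (maxwellian γ κ ρ u) muOut := by
  rw [maxwellian_eq_radMaxw' hγ₁ hρ]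
  exact integrable_radMaxw (lam_pos hγ₁ hγ₃) _ _

include hκ

lemma maxwellian_ae_eq {ρ u ρ' u' : ℝ} (hρ : 0 ≤ ρ) (hρ' : 0 ≤ ρ')
    (h : halfFlux γ κ ρ u = halfFlux γ κ ρ' u') :
    maxwellian γ κ ρ u =ᵐ[muOut] maxwellian γ κ ρ' u' := by
  rw [halfFlux_eq hγ₁ hρ, halfFlux_eq hγ₁ hρ'] at h
  rw [maxwellian_eq_radMaxw' hγ₁ hρ, maxwellian_eq_radMaxw' hγ₁ hρ']
  filter_upwards [muOut_ae_pos] with ξ hξ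
  exact radMaxw_eqOn (lam_pos hγ₁ hγ₃) (cConst_pos hγ₁ hγ₃ hκ) h hξ

lemma bijOn_halfFlux :
    Set.BijOn (fun q : ℝ × ℝ => halfFlux γ κ q.1 q.2)
      {q | 0 < q.1 ∧ 0 < omega2 γ κ q.1 q.2} {f : ℝ × ℝ | 0 < f.1} := by
  have hl := lam_pos hγ₁ hγ₃
  have hc := cConst_pos hγ₁ hγ₃ hκ
  refine ⟨fun q hq => ?_, fun q hq q' hq' h => ?_, fun f hf => ?_⟩
  · have hr := rad_pos hγ₁ hκ hq.1
    have hm : -1 < q.2 / rad γ κ q.1 := by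
      rw [lt_div_iff₀ hr]; have := hq.2; rw [omega2_eq] at this; linarith
    have e := radFlux_eq (c := cConst γ κ) hl hr (q.2 / rad γ κ q.1)
    rw [mul_div_cancel₀ _ hr.ne', ← halfFlux_eq hγ₁ hq.1.le] at e
    have hA := massProfile_pos hl hm
    simp only [mem_ofPred_eq, e]
    positivity
  · simp only at h
    rw [halfFlux_eq hγ₁ hq.1.le, halfFlux_eq hγ₁ hq'.1.le] at h
    obtain ⟨h1, h2⟩ := radFlux_inj hl hc (rad_pos hγ₁ hκ hq.1) (rad_pos hγ₁ hκ hq'.1) hq.2 h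
    exact Prod.ext (rad_inj hγ₁ hκ hq.1.le hq'.1.le h1) h2
  · obtain ⟨Q, -, hQ⟩ := exists_radFlux_inverse hl hc
    obtain ⟨h1, h2, h3⟩ := hQ f hf
    obtain ⟨ρ, hρ, hρr⟩ := exists_rad_eq hγ₁ hκ h1
    refine ⟨(ρ, (Q f).2), ⟨hρ, ?_⟩, ?_⟩
    · simp only [omega2_eq, hρr]; exact h2
    · simp only
      rw [halfFlux_eq hγ₁ hρ.le, hρr, h3]

lemma exists_outflowMap :
    ∃ 𝓜 : ℝ × ℝ → Lp (ℝ × ℝ) 1 muOut, ContinuousOn 𝓜 stateD ∧ ∀ f ∈ stateD,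
      ∃ ρ u : ℝ, 0 ≤ ρ ∧ 𝓜 f =ᵐ[muOut] maxwellian γ κ ρ u ∧ halfFlux γ κ ρ u = f := by
  obtain ⟨𝓜, hM, hM'⟩ := exists_maxwellianOfFlux (lam_pos hγ₁ hγ₃) (cConst_pos hγ₁ hγ₃ hκ)
  refine ⟨𝓜, hM, fun f hf => ?_⟩
  obtain ⟨r, u, hr, -, h1, h2⟩ := hM' f hf
  obtain ⟨ρ, hρ, hρr⟩ : ∃ ρ, 0 ≤ ρ ∧ rad γ κ ρ = r := by
    rcases hr.eq_or_lt with h | h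
    · exact ⟨0, le_rfl, by rw [rad_zero hγ₁, h]⟩
    · obtain ⟨ρ, h1, h2⟩ := exists_rad_eq hγ₁ hκ h
      exact ⟨ρ, h1.le, h2⟩
  refine ⟨ρ, u, hρ, ?_, ?_⟩
  · rw [maxwellian_eq_radMaxw' hγ₁ hρ, hρr]; exact h1
  · rw [halfFlux_eq hγ₁ hρ, hρr, h2]

omit hγ₁ hγ₃ hκ in
-- A vanishing mass integral forces `p₀ = 0` almost everywhere, hence `p = 0` by the definition of
-- D, and the momentum vanishes too.
lemma integral_mem_stateD {ν : Measure ℝ} {p : ℝ → ℝ × ℝ} (hp : Integrable p ν)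
    (h : ∀ᵐ ξ ∂ν, p ξ ∈ stateD) : ∫ ξ, p ξ ∂ν ∈ stateD := by
  have h0 : 0 ≤ᵐ[ν] fun ξ => (p ξ).1 := by filter_upwards [h] with ξ hξ using stateD_fst_nonneg hξ
  rcases (integral_nonneg_of_ae h0).lt_or_eq with h1 | h1
  · exact Or.inl (by rwa [fst_integral hp])
  · have h2 := (integral_eq_zero_iff_of_nonneg_ae h0 hp.fst).1 h1.symm
    have h3 : p =ᵐ[ν] 0 := by
      filter_upwards [h, h2] with ξ hξ hξ2
      exact (stateD_cases hξ).resolve_left fun h => h.ne' hξ2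
    rw [integral_congr_ae h3]
    simp only [Pi.zero_apply, integral_zero]
    exact zero_mem_stateD

omit hγ₁ hγ₃ hκ in
lemma L1D.integrable {ν : Measure ℝ} (g : L1D ν) : Integrable (fun ξ => g.1 ξ) ν :=
  L1.integrable_coeFn g.1

/-- The Maxwellian outflow is given by a continuous function of the half-flux. -/
lemma IsMaxwellianOutflow.eq_outflow {𝓜 : ℝ × ℝ → Lp (ℝ × ℝ) 1 muOut}
    (h𝓜 : ∀ f ∈ stateD, ∃ ρ u : ℝ, 0 ≤ ρ ∧ 𝓜 f =ᵐ[muOut] maxwellian γ κ ρ u ∧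
      halfFlux γ κ ρ u = f) {d : ℕ} {p h : Fin d → L1D muOut}
    (hph : IsMaxwellianOutflow γ κ p h) (i : Fin d) :
    (h i).1 = 𝓜 (∫ ξ, (p i).1 ξ ∂muOut) := by
  obtain ⟨ρ, u, hρ, h1, h2⟩ := hph i
  obtain ⟨ρ', u', hρ', h1', h2'⟩ := h𝓜 _ (integral_mem_stateD (L1D.integrable (p i)) (p i).2)
  refine Lp.ext ((Filter.EventuallyEq.trans h1 ?_).trans h1'.symm)
  exact maxwellian_ae_eq hγ₁ hγ₃ hκ hρ hρ' (h2.trans h2'.symm)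

/-- Uniqueness concerns the trace on `ξ > 0` only: for zero flux many pairs `(ρ, u)` give the same,
zero, outflow. -/
lemma existsUnique_maxwellianOutflow {d : ℕ} (p : Fin d → L1D muOut) :
    ∃! h : Fin d → L1D muOut, IsMaxwellianOutflow γ κ p h := by
  obtain ⟨𝓜, -, h𝓜⟩ := exists_outflowMap hγ₁ hγ₃ hκ
  have hD : ∀ i, ∫ ξ, (p i).1 ξ ∂muOut ∈ stateD := fun i =>
    integral_mem_stateD (L1D.integrable (p i)) (p i).2
  refine ⟨fun i => ⟨𝓜 (∫ ξ, (p i).1 ξ ∂muOut), ?_⟩, fun i => ?_, fun h hh => ?_⟩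
  · obtain ⟨ρ, u, hρ, h1, -⟩ := h𝓜 _ (hD i)
    filter_upwards [h1] with ξ hξ
    rw [hξ]
    exact maxwellian_mem_stateD hγ₁ hγ₃ hκ hρ u ξ
  · obtain ⟨ρ, u, hρ, h1, h2⟩ := h𝓜 _ (hD i)
    exact ⟨ρ, u, hρ, h1, h2⟩
  · exact funext fun i => Subtype.ext (hh.eq_outflow hγ₁ hγ₃ hκ h𝓜 i)

end

/-! ### Comparison of a flux with the Maxwellian flux -/

section

variable {γ κ : ℝ} (hγ₁ : 1 < γ) (hγ₃ : γ < 3) (hκ : 0 < κ) {d : ℕ}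
  {p h : Fin d → L1D muOut}

lemma totalFlux_mono {ν : Measure ℝ} {A : Fin d → ℝ} {H : Fin d → ℝ × ℝ → ℝ → ℝ}
    {g g' : Fin d → L1D ν}
    (hle : ∀ i, ∫⁻ ξ, ENNReal.ofReal (H i ((g i).1 ξ) ξ) ∂ν ≤
      ∫⁻ ξ, ENNReal.ofReal (H i ((g' i).1 ξ) ξ) ∂ν) :
    totalFlux A ν H g ≤ totalFlux A ν H g' :=
  Finset.sum_le_sum fun i _ => mul_le_mul_right (hle i) _

include hγ₁ hγ₃

/-- A quantity with supporting planes at the Maxwellians does not increase if a flux is replaced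
by the Maxwellian flux. -/
lemma IsMaxwellianOutflow.lintegral_le (hph : IsMaxwellianOutflow γ κ p h) (i : Fin d)
    {H : ℝ × ℝ → ℝ → ℝ}
    (hH0 : ∀ ρ u ξ, 0 ≤ ρ → 0 ≤ H (maxwellian γ κ ρ u ξ) ξ)
    (hH : ∀ ρ u, 0 ≤ ρ → ∃ T₀ T₁ : ℝ, ∀ ξ, ∀ f ∈ stateD,
      H (maxwellian γ κ ρ u ξ) ξ + (T₀ * (f.1 - (maxwellian γ κ ρ u ξ).1) +
        T₁ * (f.2 - (maxwellian γ κ ρ u ξ).2)) ≤ H f ξ) :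
    ∫⁻ ξ, ENNReal.ofReal (H ((h i).1 ξ) ξ) ∂muOut ≤
      ∫⁻ ξ, ENNReal.ofReal (H ((p i).1 ξ) ξ) ∂muOut := by
  obtain ⟨ρ, u, hρ, h1, h2⟩ := hph i
  obtain ⟨T₀, T₁, hT⟩ := hH ρ u hρ
  calc ∫⁻ ξ, ENNReal.ofReal (H ((h i).1 ξ) ξ) ∂muOut
      = ∫⁻ ξ, ENNReal.ofReal (H (maxwellian γ κ ρ u ξ) ξ) ∂muOut := by
        refine lintegral_congr_ae ?_
        filter_upwards [h1] with ξ hξ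
        rw [hξ]
    _ ≤ _ := by
        refine lintegral_le_of_subgradient (T₀ := T₀) (T₁ := T₁) (L1D.integrable (p i))
          (integrable_maxwellian hγ₁ hγ₃ hρ u) h2 (fun ξ => hH0 ρ u ξ hρ) ?_
        filter_upwards [(p i).2] with ξ hξ using hT ξ _ hξ

lemma maxwellian_zero (u ξ : ℝ) : maxwellian γ κ 0 u ξ = 0 := by
  rw [maxwellian_eq_radMaxw hγ₁ le_rfl, rad_zero hγ₁]
  exact radMaxw_eq_zero (lam_pos hγ₁ hγ₃) (by simp)

include hκ

/-- The mass is linear, with slopes `(1, 0)`, and fits the general scheme. -/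
lemma IsMaxwellianOutflow.mass_le (hph : IsMaxwellianOutflow γ κ p h) (A : Fin d → ℝ) :
    totalFlux A muOut (fun _ f _ => f.1) h ≤ totalFlux A muOut (fun _ f _ => f.1) p :=
  totalFlux_mono fun i => hph.lintegral_le hγ₁ hγ₃ i (H := fun f _ => f.1)
    (fun _ u ξ hρ => stateD_fst_nonneg (maxwellian_mem_stateD hγ₁ hγ₃ hκ hρ u ξ))
    fun _ _ _ => ⟨1, 0, fun ξ f _ => by linarith⟩

lemma IsMaxwellianOutflow.energy_le (hph : IsMaxwellianOutflow γ κ p h) (A : Fin d → ℝ) :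
    totalFlux A muOut (fun _ => kinEnergy γ κ) h ≤ totalFlux A muOut (fun _ => kinEnergy γ κ) p :=
  totalFlux_mono fun i => hph.lintegral_le hγ₁ hγ₃ i
    (fun _ u ξ hρ => kinEnergy_nonneg hγ₁ hγ₃ hκ (maxwellian_mem_stateD hγ₁ hγ₃ hκ hρ u ξ) ξ)
    fun _ u hρ => kinEnergy_subgradient hγ₁ hγ₃ hκ hρ u

lemma IsMaxwellianOutflow.entropy_le (hph : IsMaxwellianOutflow γ κ p h) (A : Fin d → ℝ)
    (wmin wmax : Fin d → ℝ) :
    totalFlux A muOut (fun i => kinEntropy γ κ (sOmega (wmin i) (wmax i))) h ≤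
      totalFlux A muOut (fun i => kinEntropy γ κ (sOmega (wmin i) (wmax i))) p :=
  totalFlux_mono fun i => hph.lintegral_le hγ₁ hγ₃ i
    (fun _ _ ξ _ => kinEntropy_nonneg hγ₁ hγ₃ hκ (sOmega_nonneg _ _) _ ξ)
    fun ρ u hρ => by
      -- The vacuum has no Riemann invariants `ω₁ < ω₂`; zero slopes work there because the entropy
      -- is nonnegative.
      rcases hρ.eq_or_lt with rfl | hρ
      · refine ⟨0, 0, fun ξ f _ => ?_⟩
        rw [maxwellian_zero hγ₁ hγ₃, kinEntropy, if_pos rfl]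
        have := kinEntropy_nonneg hγ₁ hγ₃ hκ (sOmega_nonneg (wmin i) (wmax i)) f ξ
        linarith
      · exact kinEntropy_subgradient hγ₁ hγ₃ hκ hρ u _ _

omit p h in
lemma FluxBounds.of_isMaxwellianCoupling {A : Fin d → ℝ} {wmin wmax : Fin d → ℝ} {b₀ bH : ℝ → ℝ}
    {Ψ Ψh : Coupling d} (hΨ : FluxBounds γ κ A wmin wmax b₀ bH Ψ)
    (hh : IsMaxwellianCoupling γ κ Ψ Ψh) : FluxBounds γ κ A wmin wmax b₀ bH Ψh where
  mass := by
    filter_upwards [hΨ.mass, ae_restrict_mem measurableSet_Ioi] with t ht ht0 g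
    exact ((hh t ht0 g).mass_le hγ₁ hγ₃ hκ A).trans (ht g)
  energy := by
    filter_upwards [hΨ.energy, ae_restrict_mem measurableSet_Ioi] with t ht ht0 g
    exact ((hh t ht0 g).energy_le hγ₁ hγ₃ hκ A).trans (ht g)
  invariance := by
    filter_upwards [hΨ.invariance, ae_restrict_mem measurableSet_Ioi] with t ht ht0 g
    exact ((hh t ht0 g).entropy_le hγ₁ hγ₃ hκ A wmin wmax).trans (ht g)

end

/-! ### Invariant data -/

lemma sOmega_eq_zero {wmin wmax v : ℝ} (h1 : wmin ≤ v) (h2 : v ≤ wmax) :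
    sOmega wmin wmax v = 0 := by
  rw [sOmega, max_eq_right (by linarith), max_eq_right (by linarith)]; norm_num

lemma sOmega_pos {wmin wmax v : ℝ} (h : v < wmin ∨ wmax < v) : 0 < sOmega wmin wmax v := by
  rw [sOmega]
  rcases h with h | h
  · have : 0 < max (wmin - v) 0 := lt_max_of_lt_left (by linarith)
    positivity
  · have : 0 < max (v - wmax) 0 := lt_max_of_lt_left (by linarith)
    positivity

lemma upsInt_pos {l z : ℝ} (hl : 0 < l) (hz : 1 < z) : 0 < upsInt l z :=
  intervalIntegral.intervalIntegral_pos_of_pos_on (intervalIntegrable_upsInt hl hz.le)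
    (fun y hy => Real.rpow_pos_of_pos (by nlinarith [hy.1]) _) hz

lemma phi_pos {l c a b ξ v : ℝ} (hl : 0 < l) (hc : 0 < c) (hξ : a < ξ ∧ ξ < b)
    (hv : a < v ∧ v < b) (hne : v ≠ ξ) : 0 < phi l c a b ξ v := by
  have h1 := upsInt_pos hl (one_lt_kernelArg hξ.1 hv.1 hne (max_lt hξ.2 hv.2))
  have h2 : 0 < |ξ - v| := abs_pos.2 (sub_ne_zero.2 hne.symm)
  have := th_pos hl
  have := betaFull_pos hl
  have : 0 < 1 - th l := by linarith [th_lt_one hl]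
  rw [phi, if_pos ⟨hξ, hv⟩]
  positivity

lemma kinS_sOmega_eq_zero {l c wmin wmax a b : ℝ} (h1 : wmin ≤ a) (h2 : b ≤ wmax) (ξ : ℝ) :
    kinS l c (sOmega wmin wmax) a b ξ = 0 := by
  refine integral_eq_zero_of_ae (ae_of_all _ fun v => ?_)
  by_cases h : a < v ∧ v < b
  · simp only [sOmega_eq_zero (h1.trans h.1.le) (h.2.le.trans h2), mul_zero, Pi.zero_apply]
  · simp only [phi_eq_zero fun h' => h h'.2, zero_mul, Pi.zero_apply]

/-- If an invariant leaves the prescribed interval, kernel and `sOmega` are both positive on a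
nondegenerate interval of `v`, up to the point `v = ξ`. -/
lemma kinS_sOmega_pos {l c wmin wmax a b ξ : ℝ} (hl : 0 < l) (hc : 0 < c) (hξ : a < ξ ∧ ξ < b)
    (h : a < wmin ∨ wmax < b) : 0 < kinS l c (sOmega wmin wmax) a b ξ := by
  have h0 : 0 ≤ᵐ[volume] fun v => phi l c a b ξ v * sOmega wmin wmax v := by
    filter_upwards [phi_ae_nonneg hl hc a b ξ] with v hv using
      mul_nonneg hv (sOmega_nonneg _ _ _)
  refine lt_of_le_of_ne (integral_nonneg_of_ae h0) fun he => ?_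
  have hz := (integral_eq_zero_iff_of_nonneg_ae h0
    (integrable_phi_mul_of_continuous hl hc a b ξ (continuous_sOmega _ _))).1 he.symm
  obtain ⟨α, β, hαβ, hsub⟩ : ∃ α β, α < β ∧ ∀ v ∈ Ioo α β, (a < v ∧ v < b) ∧
      (v < wmin ∨ wmax < v) := by
    rcases h with h | h
    · exact ⟨a, min wmin b, lt_min h (hξ.1.trans hξ.2), fun v hv => ⟨⟨hv.1, hv.2.trans_le
        (min_le_right _ _)⟩, Or.inl (hv.2.trans_le (min_le_left _ _))⟩⟩
    · exact ⟨max wmax a, b, max_lt h (hξ.1.trans hξ.2), fun v hv => ⟨⟨(le_max_right _ _).trans_lt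
        hv.1, hv.2⟩, Or.inr ((le_max_left _ _).trans_lt hv.1)⟩⟩
  have hne : ∀ᵐ v : ℝ, v ≠ ξ := by simp [ae_iff]
  have hnull : ∀ᵐ v : ℝ, v ∉ Ioo α β := by
    filter_upwards [hz, hne] with v hv hvξ hmem
    obtain ⟨h1, h2⟩ := hsub v hmem
    exact (mul_pos (phi_pos hl hc hξ h1 hvξ) (sOmega_pos h2)).ne' hv
  have := (ae_iff.1 hnull)
  simp only [not_not] at this
  rw [show {v | v ∈ Ioo α β} = Ioo α β from rfl, Real.volume_Ioo, ENNReal.ofReal_eq_zero] at this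
  linarith

lemma measurable_kinS {l : ℝ} (hl : 0 < l) (c : ℝ) {S : ℝ → ℝ} (hS : Measurable S) (a b : ℝ) :
    Measurable fun ξ => kinS l c S a b ξ := by
  have : StronglyMeasurable (Function.uncurry fun ξ v => phi l c a b ξ v * S v) :=
    ((measurable_phi hl c a b).mul (hS.comp measurable_snd)).stronglyMeasurable
  exact this.integral_prod_right.measurable

section

variable {γ κ : ℝ} (hγ₁ : 1 < γ) (hγ₃ : γ < 3) (hκ : 0 < κ)
include hγ₁

lemma kinEntropy_of_mem_invDomain {wmin wmax ξ : ℝ} {f : ℝ × ℝ}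
    (hf : f ∈ invDomain γ κ wmin wmax ξ) : kinEntropy γ κ (sOmega wmin wmax) f ξ = 0 := by
  by_cases h : f = 0
  · rw [kinEntropy, if_pos h]
  · rw [kinEntropy_eq hγ₁ _ h]
    have := hf.2.resolve_left h
    exact kinS_sOmega_eq_zero this.1 this.2.2 ξ

lemma totalFlux_entropy_eq_zero {d : ℕ} {A wmin wmax : Fin d → ℝ} {ν : Measure ℝ}
    {g : Fin d → L1D ν} (hg : g ∈ invariantData γ κ wmin wmax ν) :
    totalFlux A ν (fun i => kinEntropy γ κ (sOmega (wmin i) (wmax i))) g = 0 := by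
  refine Finset.sum_eq_zero fun i _ => ?_
  rw [lintegral_eq_zero_of_ae_eq_zero, mul_zero]
  filter_upwards [hg i] with ξ hξ
  rw [kinEntropy_of_mem_invDomain hγ₁ hξ, ENNReal.ofReal_zero]; rfl

include hγ₃ hκ

/-- A zero integral of a nonnegative entropy means a zero entropy almost everywhere. By
`kinS_sOmega_pos` this places the invariants in the interval wherever the Maxwellian is nonzero. -/
lemma maxwellian_mem_invDomain {wmin wmax ρ u : ℝ} (hρ : 0 ≤ ρ)
    (h : ∫⁻ ξ, ENNReal.ofReal (kinEntropy γ κ (sOmega wmin wmax) (maxwellian γ κ ρ u ξ) ξ) ∂muOut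
      = 0) : ∀ᵐ ξ ∂muOut, maxwellian γ κ ρ u ξ ∈ invDomain γ κ wmin wmax ξ := by
  have hl := lam_pos hγ₁ hγ₃
  have hc := cConst_pos hγ₁ hγ₃ hκ
  rcases hρ.eq_or_lt with rfl | hρ
  · refine ae_of_all _ fun ξ => ?_
    rw [maxwellian_zero hγ₁ hγ₃]
    exact ⟨zero_mem_stateD, Or.inl rfl⟩
  simp only [kinEntropy_maxwellian hγ₁ hγ₃ hκ hρ] at h
  rw [lintegral_eq_zero_iff
    (measurable_kinS hl _ (continuous_sOmega _ _).measurable _ _).ennreal_ofReal] at h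
  have hab := omega1_lt_omega2 hγ₁ hκ hρ u
  filter_upwards [h] with ξ hξ
  refine ⟨maxwellian_mem_stateD hγ₁ hγ₃ hκ hρ.le u ξ, ?_⟩
  by_cases hin : omega1 γ κ ρ u < ξ ∧ ξ < omega2 γ κ ρ u
  · right
    obtain ⟨h1, h2⟩ := kinOmega_maxwellian hγ₁ hγ₃ hκ hρ hin
    rw [h1, h2]
    by_contra hcon
    refine (ENNReal.ofReal_pos.2 (kinS_sOmega_pos (wmin := wmin) (wmax := wmax) hl hc hin ?_)).ne' hξ
    by_contra hcon'
    rw [not_or, not_lt, not_lt] at hcon'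
    exact hcon ⟨hcon'.1, hab.le, hcon'.2⟩
  · left
    rw [maxwellian_eq hγ₁ hρ.le, maxw0_eq_zero hl hab hin, mul_zero]
    rfl

/-- Invariant data are mapped to invariant data. -/
lemma FluxBounds.maps_invariantData {d : ℕ} {A : Fin d → ℝ} (hA : ∀ i, 0 < A i)
    {wmin wmax : Fin d → ℝ} {b₀ bH : ℝ → ℝ} {Ψ : Coupling d}
    (hΨ : FluxBounds γ κ A wmin wmax b₀ bH Ψ)
    (hM : ∀ t > 0, ∀ g, IsMaxwellian γ κ (Ψ t g)) :
    ∀ᵐ t ∂volume.restrict (Ioi 0), ∀ g ∈ invariantData γ κ wmin wmax muIn,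
      Ψ t g ∈ invariantData γ κ wmin wmax muOut := by
  filter_upwards [hΨ.invariance, ae_restrict_mem measurableSet_Ioi] with t ht ht0 g hg i
  have h1 := le_antisymm ((ht g).trans (totalFlux_entropy_eq_zero hγ₁ hg).le) zero_le
  have h2 := (Finset.sum_eq_zero_iff.1 h1) i (Finset.mem_univ i)
  have h3 := (mul_eq_zero.1 h2).resolve_left (ENNReal.ofReal_pos.2 (hA i)).ne'
  obtain ⟨ρ, u, hρ, h4⟩ := hM t ht0 g i
  have h5 : ∫⁻ ξ, ENNReal.ofReal
      (kinEntropy γ κ (sOmega (wmin i) (wmax i)) (maxwellian γ κ ρ u ξ) ξ) ∂muOut = 0 := by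
    rw [← h3]
    refine lintegral_congr_ae ?_
    filter_upwards [h4] with ξ hξ
    rw [hξ]
  filter_upwards [h4, maxwellian_mem_invDomain hγ₁ hγ₃ hκ hρ h5] with ξ hξ hξ2
  rwa [hξ]

end

/-! ### Dominated superposition operators -/

/-- A variant of the dominated convergence theorem for superposition operators: the domination is
by the arguments and the pointwise convergence is only required along convergent arguments. -/
lemma tendsto_lintegral_sub_of_dominated {α E F : Type*} [MeasurableSpace α] {μ : Measure α}
    [NormedAddCommGroup E] [NormedAddCommGroup F] {y : ℕ → α → E} {y' : α → E} {x : ℕ → α → F}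
    {x' : α → F} {C : ℝ≥0∞} (hC : C ≠ ∞)
    (hy : ∀ n, AEStronglyMeasurable (y n) μ) (hy' : AEStronglyMeasurable y' μ)
    (hx : ∀ n, AEStronglyMeasurable (x n) μ) (hx' : AEStronglyMeasurable x' μ)
    (hyi : ∫⁻ t, ‖y' t‖ₑ ∂μ ≠ ∞)
    (hxy : ∀ n, ∀ᵐ t ∂μ, ‖x n t‖ₑ ≤ C * ‖y n t‖ₑ) (hxy' : ∀ᵐ t ∂μ, ‖x' t‖ₑ ≤ C * ‖y' t‖ₑ)
    (hpt : ∀ᵐ t ∂μ, ∀ φ : ℕ → ℕ, Tendsto (fun n => y (φ n) t) atTop (𝓝 (y' t)) →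
      Tendsto (fun n => x (φ n) t) atTop (𝓝 (x' t)))
    (hlim : Tendsto (fun n => ∫⁻ t, ‖y n t - y' t‖ₑ ∂μ) atTop (𝓝 0)) :
    Tendsto (fun n => ∫⁻ t, ‖x n t - x' t‖ₑ ∂μ) atTop (𝓝 0) := by
  -- Convergence in `L¹` gives almost everywhere convergence only along a further subsequence, which
  -- is enough.
  refine tendsto_of_subseq_tendsto fun ns hns => ?_
  have hlim1 := hlim.comp hns
  have hmeas : TendstoInMeasure μ (fun n => y (ns n)) atTop y' := by
    refine tendstoInMeasure_of_tendsto_eLpNorm one_ne_zero (fun n => hy _) hy' ?_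
    simp only [eLpNorm_one_eq_lintegral_enorm]
    exact hlim1
  obtain ⟨ms, hms, hae⟩ := hmeas.exists_seq_tendsto_ae
  refine ⟨ms, ?_⟩
  have hlim2 : Tendsto (fun n => ∫⁻ t, ‖y (ns (ms n)) t - y' t‖ₑ ∂μ) atTop (𝓝 0) :=
    hlim1.comp hms.tendsto_atTop
  -- The `y n` have no common majorant; subtracting `C * ‖y n - y'‖` leaves a quantity dominated by
  -- `2 * C * ‖y'‖`, and the subtracted part tends to zero in the mean.
  let e : ℕ → α → ℝ≥0∞ := fun n t =>
    ‖x (ns (ms n)) t - x' t‖ₑ - C * ‖y (ns (ms n)) t - y' t‖ₑ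
  have he : Tendsto (fun n => ∫⁻ t, e n t ∂μ) atTop (𝓝 0) := by
    have hz : (0 : ℝ≥0∞) = ∫⁻ t, 0 ∂μ := by simp
    rw [hz]
    refine tendsto_lintegral_filter_of_dominated_convergence' (fun t => 2 * C * ‖y' t‖ₑ) ?_ ?_ ?_ ?_
    · exact Eventually.of_forall fun n => (((hx _).sub hx').enorm).sub
        (((hy _).sub hy').enorm.const_mul C)
    · refine Eventually.of_forall fun n => ?_
      filter_upwards [hxy (ns (ms n)), hxy'] with t h1 h2
      refine tsub_le_iff_right.2 ?_
      calc ‖x (ns (ms n)) t - x' t‖ₑ ≤ ‖x (ns (ms n)) t‖ₑ + ‖x' t‖ₑ := enorm_sub_le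
        _ ≤ C * ‖y (ns (ms n)) t‖ₑ + C * ‖y' t‖ₑ := add_le_add h1 h2
        _ ≤ C * (‖y (ns (ms n)) t - y' t‖ₑ + ‖y' t‖ₑ) + C * ‖y' t‖ₑ := by
            gcongr
            calc ‖y (ns (ms n)) t‖ₑ = ‖y (ns (ms n)) t - y' t + y' t‖ₑ := by rw [sub_add_cancel]
              _ ≤ _ := enorm_add_le _ _
        _ = 2 * C * ‖y' t‖ₑ + C * ‖y (ns (ms n)) t - y' t‖ₑ := by ring
    · rw [lintegral_const_mul' _ _ (ENNReal.mul_ne_top (by simp) hC)]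
      exact ENNReal.mul_ne_top (ENNReal.mul_ne_top (by simp) hC) hyi
    · filter_upwards [hpt, hae] with t h1 h2
      have h3 := tendsto_iff_edist_tendsto_0.1 (h1 (fun n => ns (ms n)) h2)
      simp only [edist_eq_enorm_sub] at h3
      exact tendsto_of_tendsto_of_tendsto_of_le_of_le tendsto_const_nhds h3
        (fun _ => zero_le) fun _ => tsub_le_self
  have hsum : Tendsto (fun n => ∫⁻ t, e n t ∂μ + C * ∫⁻ t, ‖y (ns (ms n)) t - y' t‖ₑ ∂μ)
      atTop (𝓝 0) := by
    simpa using he.add (ENNReal.Tendsto.const_mul hlim2 (Or.inr hC))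
  refine tendsto_of_tendsto_of_tendsto_of_le_of_le tendsto_const_nhds hsum
    (fun _ => zero_le) fun n => ?_
  have hm : AEMeasurable (fun t => C * ‖y (ns (ms n)) t - y' t‖ₑ) μ :=
    ((hy _).sub hy').enorm.const_mul C
  rw [← lintegral_const_mul' _ _ hC, ← lintegral_add_right' _ hm]
  exact lintegral_mono fun t => le_tsub_add

section

variable {ν ν' : Measure ℝ} {J : Set ℝ} (hJ : J = Ioi 0 ∨ J = Ici 0)
include hJ

lemma ae_restrict_of_pos {P : ℝ → Prop} (h : ∀ᵐ t ∂volume.restrict (Ioi (0 : ℝ)), P t) :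
    ∀ᵐ t ∂volume.restrict J, P t := by
  rcases hJ with rfl | rfl
  · exact h
  · rwa [← Measure.restrict_congr_set (Ioi_ae_eq_Ici (μ := volume))]

lemma isLocallyClosed_time : IsLocallyClosed J := by
  rcases hJ with rfl | rfl
  · exact isOpen_Ioi.isLocallyClosed
  · exact isClosed_Ici.isLocallyClosed

/-- Measurability of `x` in time is inherited from `y` through `x = N ∘ y`; `y` is measurable into
the subtype because the coercion is an embedding. -/
lemma aestronglyMeasurable_superposition {N : L1D ν → L1D ν'} (hN : Continuous N)
    {y : ℝ → L1D ν} {x : ℝ → L1D ν'} (hy : LocallyIntegrableOn (fun t => (y t).1) J)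
    (hx : ∀ᵐ t ∂volume.restrict (Ioi (0 : ℝ)), x t = N (y t)) :
    AEStronglyMeasurable (fun t => (x t).1) (volume.restrict J) := by
  have h1 : AEStronglyMeasurable y (volume.restrict J) :=
    IsEmbedding.subtypeVal.aestronglyMeasurable_comp_iff.1 hy.aestronglyMeasurable
  refine ((continuous_subtype_val.comp hN).comp_aestronglyMeasurable h1).congr ?_
  filter_upwards [ae_restrict_of_pos hJ hx] with t ht
  rw [ht]; rfl

/-- Dominated superposition operators preserve local integrability in time. -/
lemma locallyIntegrableOn_superposition {N : L1D ν → L1D ν'} (hN : Continuous N) {C : ℝ}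
    {y : ℝ → L1D ν} {x : ℝ → L1D ν'} (hy : LocallyIntegrableOn (fun t => (y t).1) J)
    (hx : ∀ᵐ t ∂volume.restrict (Ioi (0 : ℝ)), x t = N (y t))
    (hC : ∀ᵐ t ∂volume.restrict (Ioi (0 : ℝ)), ‖(x t).1‖ ≤ C * ‖(y t).1‖) :
    LocallyIntegrableOn (fun t => (x t).1) J := by
  refine (locallyIntegrableOn_iff (isLocallyClosed_time hJ)).2 fun K hK hKc => ?_
  have hyK := (locallyIntegrableOn_iff (isLocallyClosed_time hJ)).1 hy K hK hKc
  exact (hyK.norm.const_mul C).mono'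
    ((aestronglyMeasurable_superposition hJ hN hy hx).mono_measure (Measure.restrict_mono_set _ hK))
    (ae_mono (Measure.restrict_mono_set _ hK) (ae_restrict_of_pos hJ hC))

/-- Dominated superposition operators are continuous with respect to local convergence in time. -/
lemma tendsto_superposition {N : L1D ν → L1D ν'} (hN : Continuous N) {C : ℝ}
    {y : ℕ → ℝ → L1D ν} {y' : ℝ → L1D ν} {x : ℕ → ℝ → L1D ν'} {x' : ℝ → L1D ν'}
    (hy : ∀ n, LocallyIntegrableOn (fun t => (y n t).1) J)
    (hy' : LocallyIntegrableOn (fun t => (y' t).1) J)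
    (hx : ∀ n, ∀ᵐ t ∂volume.restrict (Ioi (0 : ℝ)), x n t = N (y n t))
    (hx' : ∀ᵐ t ∂volume.restrict (Ioi (0 : ℝ)), x' t = N (y' t))
    (hC : ∀ n, ∀ᵐ t ∂volume.restrict (Ioi (0 : ℝ)), ‖(x n t).1‖ ≤ C * ‖(y n t).1‖)
    (hC' : ∀ᵐ t ∂volume.restrict (Ioi (0 : ℝ)), ‖(x' t).1‖ ≤ C * ‖(y' t).1‖)
    {K : Set ℝ} (hK : K ⊆ J) (hKc : IsCompact K)
    (hlim : Tendsto (fun n => ∫⁻ t in K, ‖(y n t).1 - (y' t).1‖ₑ) atTop (𝓝 0)) :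
    Tendsto (fun n => ∫⁻ t in K, ‖(x n t).1 - (x' t).1‖ₑ) atTop (𝓝 0) := by
  have hle : volume.restrict K ≤ volume.restrict J := Measure.restrict_mono_set _ hK
  have hae : ∀ {P : ℝ → Prop}, (∀ᵐ t ∂volume.restrict (Ioi (0 : ℝ)), P t) →
      ∀ᵐ t ∂volume.restrict K, P t := fun h => ae_mono hle (ae_restrict_of_pos hJ h)
  have henorm : ∀ {a : Lp (ℝ × ℝ) 1 ν'} {b : Lp (ℝ × ℝ) 1 ν}, ‖a‖ ≤ C * ‖b‖ →
      ‖a‖ₑ ≤ ENNReal.ofReal C * ‖b‖ₑ := fun {a b} h => by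
    rw [← ofReal_norm, ← ofReal_norm,
      ← ENNReal.ofReal_mul' (norm_nonneg _)]
    exact ENNReal.ofReal_le_ofReal h
  refine tendsto_lintegral_sub_of_dominated (C := ENNReal.ofReal C) ENNReal.ofReal_ne_top
    (fun n => (hy n).aestronglyMeasurable.mono_measure hle)
    (hy'.aestronglyMeasurable.mono_measure hle)
    (fun n => (aestronglyMeasurable_superposition hJ hN (hy n) (hx n)).mono_measure hle)
    ((aestronglyMeasurable_superposition hJ hN hy' hx').mono_measure hle)
    ?_ (fun n => ?_) ?_ ?_ hlim
  · have := (locallyIntegrableOn_iff (isLocallyClosed_time hJ)).1 hy' K hK hKc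
    exact this.2.ne
  · filter_upwards [hae (hC n)] with t ht using henorm ht
  · filter_upwards [hae hC'] with t ht using henorm ht
  · filter_upwards [ae_all_iff.2 fun n => hae (hx n), hae hx'] with t h1 h2 φ hφ
    have h3 : Tendsto (fun n => y (φ n) t) atTop (𝓝 (y' t)) := tendsto_subtype_rng.2 hφ
    have h4 := (continuous_subtype_val.comp hN).continuousAt.tendsto.comp h3
    simp only [h1, h2]
    exact h4

end

/-! ### Continuity of the Maxwellian coupling on invariant data -/

section

variable {γ κ : ℝ} (hγ₁ : 1 < γ) (hγ₃ : γ < 3) (hκ : 0 < κ) {d : ℕ}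
include hγ₁ hγ₃ hκ

/-- The Maxwellian outflow is a continuous function of the flux in `L¹`. -/
lemma exists_continuous_outflow :
    ∃ N : L1D muOut → L1D muOut, Continuous N ∧ ∀ {d : ℕ} {p h : Fin d → L1D muOut},
      IsMaxwellianOutflow γ κ p h → ∀ i, h i = N (p i) := by
  obtain ⟨𝓜, hM, hM'⟩ := exists_outflowMap hγ₁ hγ₃ hκ
  have hD : ∀ p : L1D muOut, ∫ ξ, p.1 ξ ∂muOut ∈ stateD := fun p =>
    integral_mem_stateD (L1D.integrable p) p.2
  have hN : ∀ p : L1D muOut, ∀ᵐ ξ ∂muOut, 𝓜 (∫ ξ, p.1 ξ ∂muOut) ξ ∈ stateD := fun p => by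
    obtain ⟨ρ, u, hρ, h1, -⟩ := hM' _ (hD p)
    filter_upwards [h1] with ξ hξ
    rw [hξ]
    exact maxwellian_mem_stateD hγ₁ hγ₃ hκ hρ u ξ
  have hF : Continuous fun p : L1D muOut => ∫ ξ, p.1 ξ ∂muOut :=
    continuous_integral.comp continuous_subtype_val
  refine ⟨fun p => ⟨𝓜 (∫ ξ, p.1 ξ ∂muOut), hN p⟩,
    (hM.comp_continuous hF hD).subtype_mk _, fun hph i => Subtype.ext ?_⟩
  exact hph.eq_outflow hγ₁ hγ₃ hκ hM' i

/-- The quotient `f₁ / f₀` is a convex combination of `ξ` and the midpoint of the invariants, all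
lying in `[wmin, wmax]`. -/
lemma norm_le_of_mem_invDomain {wmin wmax ξ : ℝ} {f : ℝ × ℝ}
    (hf : f ∈ invDomain γ κ wmin wmax ξ) : ‖f‖ ≤ (1 + max |wmin| |wmax|) * f.1 := by
  have hl := lam_pos hγ₁ hγ₃
  have ht := th_pos hl
  have ht1 := th_lt_one hl
  rcases stateD_cases hf.1 with h | rfl
  · obtain ⟨h1, h2, h3⟩ := kin_spec hγ₁ hγ₃ hκ h ξ
    obtain ⟨h4, h5, h6⟩ := hf.2.resolve_left fun h' => by rw [h'] at h; exact h.false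
    have h7 : |f.2 / f.1| ≤ max |wmin| |wmax| := by
      rw [← h3, meanVel]
      refine abs_le_max_abs_abs ?_ ?_ <;> nlinarith
    rw [abs_div, abs_of_pos h, div_le_iff₀ h] at h7
    have h8 : 0 ≤ max |wmin| |wmax| * f.1 := (abs_nonneg _).trans h7
    rw [Prod.norm_def, Real.norm_eq_abs, Real.norm_eq_abs, abs_of_pos h]
    exact max_le (by linarith) (by linarith)
  · simp

/-- On the invariant domain the norm is controlled by the mass, and `h` and `p` have the same mass
flux. This linear bound replaces the superlinear one available in general. -/
lemma IsMaxwellianOutflow.norm_le {p h : Fin d → L1D muOut} (hph : IsMaxwellianOutflow γ κ p h)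
    {wmin wmax : Fin d → ℝ} (hh : h ∈ invariantData γ κ wmin wmax muOut) (i : Fin d) :
    ‖(h i).1‖ ≤ (1 + max |wmin i| |wmax i|) * ‖(p i).1‖ := by
  have hW : 0 ≤ 1 + max |wmin i| |wmax i| := by positivity
  obtain ⟨ρ, u, hρ, h1, h2⟩ := hph i
  have e : ∫ ξ, ((h i).1 ξ).1 ∂muOut = ∫ ξ, ((p i).1 ξ).1 ∂muOut := by
    rw [← fst_integral (L1D.integrable (h i)), ← fst_integral (L1D.integrable (p i)), ← h2,
      halfFlux, integral_congr_ae h1]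
  rw [L1.norm_eq_integral_norm, L1.norm_eq_integral_norm]
  calc ∫ ξ, ‖(h i).1 ξ‖ ∂muOut ≤ ∫ ξ, (1 + max |wmin i| |wmax i|) * ((h i).1 ξ).1 ∂muOut := by
        refine integral_mono_ae (L1D.integrable _).norm ((L1D.integrable _).fst.const_mul _) ?_
        filter_upwards [hh i] with ξ hξ using norm_le_of_mem_invDomain hγ₁ hγ₃ hκ hξ
    _ = (1 + max |wmin i| |wmax i|) * ∫ ξ, ((p i).1 ξ).1 ∂muOut := by
        rw [integral_const_mul, e]
    _ ≤ _ := by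
        refine mul_le_mul_of_nonneg_left ?_ hW
        refine integral_mono (L1D.integrable _).fst (L1D.integrable _).norm fun ξ => ?_
        exact (le_abs_self _).trans (norm_fst_le ((p i).1 ξ))

/-- The Maxwellian coupling inherits the continuity on invariant data. -/
lemma ContinuousCoupling.maxwellianCoupling {J : Set ℝ} (hJ : J = Ioi 0 ∨ J = Ici 0)
    {wmin wmax : Fin d → ℝ} {Ψ Ψh : Coupling d} (hΨ : ContinuousCoupling J univ Ψ)
    (hh : IsMaxwellianCoupling γ κ Ψ Ψh)
    (hinv : ∀ᵐ t ∂volume.restrict (Ioi 0), ∀ g ∈ invariantData γ κ wmin wmax muIn,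
      Ψh t g ∈ invariantData γ κ wmin wmax muOut) :
    ContinuousCoupling J (invariantData γ κ wmin wmax muIn) Ψh := by
  obtain ⟨N, hN, hN'⟩ := exists_continuous_outflow hγ₁ hγ₃ hκ
  have hx : ∀ (G : ℝ → Fin d → L1D muIn) (i : Fin d),
      ∀ᵐ t ∂volume.restrict (Ioi (0 : ℝ)), Ψh t (G t) i = N (Ψ t (G t) i) := fun G i => by
    filter_upwards [ae_restrict_mem measurableSet_Ioi] with t ht using hN' (hh t ht (G t)) i
  -- The only place where invariance of the data enters: it supplies the domination for the
  -- superposition operator.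
  have hC : ∀ (G : ℝ → Fin d → L1D muIn) (i : Fin d),
      (∀ᵐ t ∂volume.restrict (Ioi 0), G t ∈ invariantData γ κ wmin wmax muIn) →
      ∀ᵐ t ∂volume.restrict (Ioi (0 : ℝ)),
        ‖(Ψh t (G t) i).1‖ ≤ (1 + max |wmin i| |wmax i|) * ‖(Ψ t (G t) i).1‖ := fun G i hG => by
    filter_upwards [hinv, hG, ae_restrict_mem measurableSet_Ioi] with t h1 h2 h3
    exact (hh t h3 (G t)).norm_le hγ₁ hγ₃ hκ (h1 _ h2) i
  have huniv : ∀ G : ℝ → Fin d → L1D muIn, ∀ᵐ t ∂volume.restrict (Ioi (0 : ℝ)), G t ∈ univ :=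
    fun G => ae_of_all _ fun _ => mem_univ _
  refine ⟨fun G hG hGi i => ?_, fun G G' hG hGi hG' hGi' hlim K hK hKc i => ?_⟩
  · exact locallyIntegrableOn_superposition hJ hN (hΨ.isLocL1 G hG (huniv G) i) (hx G i)
      (hC G i hGi)
  · exact tendsto_superposition hJ hN (fun n => hΨ.isLocL1 (G n) (hG n) (huniv _) i)
      (hΨ.isLocL1 G' hG' (huniv _) i) (fun n => hx (G n) i) (hx G' i)
      (fun n => hC (G n) i (hGi n)) (hC G' i hGi') hK hKc
      (hΨ.tendsto G G' hG (fun n => huniv _) hG' (huniv _) hlim K hK hKc i)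

end

/-! ### Retraction onto the invariant domains -/

section

variable {γ κ : ℝ}

/-- Upper bound for `(f₀ / c) ^ (1 / λ)` on the kinetic invariant domain, as a function of `ξ` and
of the kinetic velocity. -/
def domainBound (wmin wmax ξ u : ℝ) : ℝ :=
  min (max (ξ - wmin) 0 * (2 * u - wmin - ξ)) (max (wmax - ξ) 0 * (wmax + ξ - 2 * u))

/-- Reduction of the density at fixed kinetic velocity to the kinetic invariant domain. -/
def domainMass (γ κ wmin wmax ξ : ℝ) (f : ℝ × ℝ) : ℝ :=
  min f.1 (cConst γ κ * posPow (lam γ) (domainBound wmin wmax ξ (kinU γ f ξ)))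

/-- Retraction onto the kinetic invariant domain. -/
def domainProj (γ κ wmin wmax ξ : ℝ) (f : ℝ × ℝ) : ℝ × ℝ :=
  (domainMass γ κ wmin wmax ξ f, f.2 / f.1 * domainMass γ κ wmin wmax ξ f)

/-- The truncations in `domainBound` matter: without them, two negative factors could make a product
positive for `ξ` outside the interval. -/
lemma domainBound_pos {wmin wmax ξ u : ℝ} (h : 0 < domainBound wmin wmax ξ u) :
    (wmin < ξ ∧ ξ < wmax) ∧ wmin < u ∧ u < wmax := by
  obtain ⟨h1, h2⟩ := lt_min_iff.1 h
  have h3 : 0 < max (ξ - wmin) 0 := (le_max_right _ _).lt_of_ne fun h0 => by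
    rw [← h0, zero_mul] at h1; exact h1.false
  have h4 : 0 < max (wmax - ξ) 0 := (le_max_right _ _).lt_of_ne fun h0 => by
    rw [← h0, zero_mul] at h2; exact h2.false
  have h5 := pos_of_mul_pos_right h1 h3.le
  have h6 := pos_of_mul_pos_right h2 h4.le
  have h7 := (lt_max_iff.1 h3).resolve_right (lt_irrefl _)
  have h8 := (lt_max_iff.1 h4).resolve_right (lt_irrefl _)
  exact ⟨⟨by linarith, by linarith⟩, by linarith, by linarith⟩

/-- The Riemann invariants of a centre and a radius are in an interval if and only if the density
does not exceed the bound. -/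
lemma riemann_mem_iff {wmin wmax ξ u r Y : ℝ} (hr : 0 ≤ r) (hY : 0 < Y)
    (hrY : r ^ 2 = (u - ξ) ^ 2 + Y) :
    (wmin ≤ u - r ∧ u + r ≤ wmax) ↔ Y ≤ domainBound wmin wmax ξ u := by
  have hin : |u - ξ| < r := by
    rw [← abs_of_nonneg hr]; exact sq_lt_sq.1 (by linarith)
  obtain ⟨hin1, hin2⟩ := abs_lt.1 hin
  constructor
  · rintro ⟨h1, h2⟩
    rw [domainBound, max_eq_left (by linarith), max_eq_left (by linarith)]
    -- Each bound is a difference of squares, e.g. `(ξ - wmin)(2u - wmin - ξ) = (u - wmin)² - (u -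
    -- ξ)²`, compared with `Y = r² - (u - ξ)²`.
    refine le_min ?_ ?_
    · nlinarith [mul_nonneg (by linarith : 0 ≤ u - wmin - r) (by linarith : 0 ≤ u - wmin + r)]
    · nlinarith [mul_nonneg (by linarith : 0 ≤ wmax - u - r) (by linarith : 0 ≤ wmax - u + r)]
  · intro h
    obtain ⟨⟨h1, h2⟩, h3, h4⟩ := domainBound_pos (hY.trans_le h)
    rw [domainBound, max_eq_left (by linarith), max_eq_left (by linarith)] at h
    obtain ⟨h5, h6⟩ := le_min_iff.1 h
    have h7 : r ≤ u - wmin := by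
      refine (sq_le_sq₀ hr (by linarith)).1 ?_
      rw [hrY]; linarith
    have h8 : r ≤ wmax - u := by
      refine (sq_le_sq₀ hr (by linarith)).1 ?_
      rw [hrY]; linarith
    exact ⟨by linarith, by linarith⟩

section

variable (hγ₁ : 1 < γ) (hγ₃ : γ < 3) (hκ : 0 < κ)
include hγ₁ hγ₃ hκ

lemma le_mul_posPow_iff {x T : ℝ} (hx : 0 < x) :
    (x / cConst γ κ) ^ (1 / lam γ) ≤ T ↔ x ≤ cConst γ κ * posPow (lam γ) T := by
  have hl := lam_pos hγ₁ hγ₃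
  have hc := cConst_pos hγ₁ hγ₃ hκ
  have hX : 0 < x / cConst γ κ := by positivity
  rw [← div_le_iff₀' hc]
  rcases le_or_gt T 0 with hT | hT
  · rw [posPow_of_nonpos hl hT]
    have := Real.rpow_pos_of_pos hX (1 / lam γ)
    exact ⟨fun h => by linarith, fun h => by linarith⟩
  · rw [posPow_of_nonneg _ hT.le, one_div, Real.rpow_inv_le_iff_of_pos hX.le hT.le hl]

/-- At fixed kinetic velocity, membership is an upper bound on `f₀` alone. Hence truncating `f₀` is
a retraction, and the bound is continuous in the velocity. -/
lemma mem_invDomain_iff {wmin wmax ξ : ℝ} {f : ℝ × ℝ} (hf : 0 < f.1) :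
    f ∈ invDomain γ κ wmin wmax ξ ↔
      f.1 ≤ cConst γ κ * posPow (lam γ) (domainBound wmin wmax ξ (kinU γ f ξ)) := by
  have hc := cConst_pos hγ₁ hγ₃ hκ
  have hf0 : f ≠ 0 := fun h => by rw [h] at hf; exact hf.false
  have hr := rad_kinRho_nonneg hγ₁ hγ₃ hκ hf ξ
  have hY : 0 < (f.1 / cConst γ κ) ^ (1 / lam γ) := by positivity
  rw [← le_mul_posPow_iff hγ₁ hγ₃ hκ hf, ← riemann_mem_iff hr hY (rad_kinRho hγ₁ hγ₃ hκ hf ξ)]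
  refine ⟨fun h => ?_, fun h => ⟨Or.inl hf, Or.inr ⟨h.1, ?_, h.2⟩⟩⟩
  · have := h.2.resolve_left hf0
    exact ⟨this.1, this.2.2⟩
  · rw [kinOmega1, kinOmega2, omega1_eq, omega2_eq]; linarith

lemma domainMass_nonneg {f : ℝ × ℝ} (hf : f ∈ stateD) (wmin wmax ξ : ℝ) :
    0 ≤ domainMass γ κ wmin wmax ξ f :=
  le_min (stateD_fst_nonneg hf) (mul_nonneg (cConst_pos hγ₁ hγ₃ hκ).le (posPow_nonneg _ _))

lemma domainProj_mem {f : ℝ × ℝ} (hf : f ∈ stateD) (wmin wmax ξ : ℝ) :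
    domainProj γ κ wmin wmax ξ f ∈ invDomain γ κ wmin wmax ξ := by
  rcases (domainMass_nonneg hγ₁ hγ₃ hκ hf wmin wmax ξ).eq_or_lt with h | h
  · have : domainProj γ κ wmin wmax ξ f = 0 := by rw [domainProj, ← h, mul_zero]; rfl
    rw [this]
    exact ⟨zero_mem_stateD, Or.inl rfl⟩
  · have hu : kinU γ (domainProj γ κ wmin wmax ξ f) ξ = kinU γ f ξ := by
      rw [kinU, kinU, domainProj]
      simp only
      rw [mul_div_cancel_right₀ _ h.ne']
    rw [mem_invDomain_iff hγ₁ hγ₃ hκ (show 0 < (domainProj γ κ wmin wmax ξ f).1 from h), hu]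
    exact min_le_right _ _

lemma domainProj_of_mem {wmin wmax ξ : ℝ} {f : ℝ × ℝ} (hf : f ∈ invDomain γ κ wmin wmax ξ) :
    domainProj γ κ wmin wmax ξ f = f := by
  rcases stateD_cases hf.1 with h | rfl
  · have := (mem_invDomain_iff hγ₁ hγ₃ hκ h).1 hf
    rw [domainProj, domainMass, min_eq_left this, div_mul_cancel₀ _ h.ne']
  · have h0 : domainMass γ κ wmin wmax ξ 0 = 0 := by
      rw [domainMass]
      exact min_eq_left (mul_nonneg (cConst_pos hγ₁ hγ₃ hκ).le (posPow_nonneg _ _))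
    rw [domainProj, h0, mul_zero]; rfl

lemma norm_domainProj_le {f : ℝ × ℝ} (hf : f ∈ stateD) (wmin wmax ξ : ℝ) :
    ‖domainProj γ κ wmin wmax ξ f‖ ≤ ‖f‖ := by
  have h0 := domainMass_nonneg hγ₁ hγ₃ hκ hf wmin wmax ξ
  have h1 : domainMass γ κ wmin wmax ξ f ≤ f.1 := min_le_left _ _
  rw [domainProj, Prod.norm_def, Prod.norm_def]
  refine max_le_max ?_ ?_
  · simp only [Real.norm_eq_abs]
    exact abs_le_abs_of_nonneg h0 h1
  · simp only [norm_mul, norm_div, Real.norm_eq_abs]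
    rcases stateD_cases hf with h | rfl
    · rw [abs_of_nonneg h0, abs_of_pos h, div_mul_eq_mul_div, div_le_iff₀ h]
      exact mul_le_mul_of_nonneg_left h1 (abs_nonneg _)
    · simp

/-- At fixed quotient `f₁ / f₀` the energy is increasing in `f₀`, as `kinEnergy_eq` with `r = u = 0`
shows. -/
lemma kinEnergy_domainProj_le {f : ℝ × ℝ} (hf : f ∈ stateD) (wmin wmax ξ : ℝ) :
    kinEnergy γ κ (domainProj γ κ wmin wmax ξ f) ξ ≤ kinEnergy γ κ f ξ := by
  have hl := lam_pos hγ₁ hγ₃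
  have hc := cConst_pos hγ₁ hγ₃ hκ
  have ht := th_pos hl
  have ht1 := th_lt_one hl
  rw [← theta_eq hγ₁] at ht ht1
  rcases stateD_cases hf with h | rfl
  · have h0 := domainMass_nonneg hγ₁ hγ₃ hκ hf wmin wmax ξ
    have h1 : domainMass γ κ wmin wmax ξ f ≤ f.1 := min_le_left _ _
    have e1 := kinEnergy_eq hγ₁ hγ₃ hκ h.le (f.2 / f.1) ξ 0 0
    have e2 := kinEnergy_eq hγ₁ hγ₃ hκ h0 (f.2 / f.1) ξ 0 0
    rw [div_mul_cancel₀ _ h.ne'] at e1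
    have e3 : kinEnergy γ κ (f.1, f.2) ξ = kinEnergy γ κ f ξ := rfl
    rw [e3] at e1
    have h2 : domainMass γ κ wmin wmax ξ f / cConst γ κ ≤ f.1 / cConst γ κ :=
      div_le_div_of_nonneg_right h1 hc.le
    have h3 := Real.rpow_le_rpow (by positivity) h2 (by positivity : 0 ≤ 1 + 1 / lam γ)
    have h4 := div_le_div_of_nonneg_right h3 (by positivity : 0 ≤ 1 + 1 / lam γ)
    have h5 := mul_le_mul_of_nonneg_right h2 (sq_nonneg ξ)
    have h6 : 0 ≤ (1 - theta γ) / 2 := by linarith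
    have h7 := mul_le_mul_of_nonneg_right (mul_le_mul_of_nonneg_left h1 h6)
      (sq_nonneg ((f.2 / f.1 - theta γ * ξ) / (1 - theta γ) - 0))
    have h8 := mul_le_mul_of_nonneg_left (add_le_add h4 h5)
      (by positivity : 0 ≤ theta γ * cConst γ κ / 2)
    rw [domainProj]
    linarith
  · rw [domainProj_of_mem hγ₁ hγ₃ hκ ⟨zero_mem_stateD, Or.inl rfl⟩]

lemma continuousOn_domainProj (wmin wmax ξ : ℝ) :
    ContinuousOn (domainProj γ κ wmin wmax ξ) stateD := by
  intro f hf
  rcases stateD_cases hf with h | rfl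
  · refine ContinuousAt.continuousWithinAt ?_
    have hdiv : ContinuousAt (fun f : ℝ × ℝ => f.2 / f.1) f :=
      continuousAt_snd.div continuousAt_fst h.ne'
    have hu : ContinuousAt (fun f : ℝ × ℝ => kinU γ f ξ) f := by
      unfold kinU; fun_prop
    have hb : Continuous (domainBound wmin wmax ξ) := by unfold domainBound; fun_prop
    have hm : ContinuousAt (domainMass γ κ wmin wmax ξ) f :=
      continuousAt_fst.min (continuousAt_const.mul
        (((continuous_posPow (lam_pos hγ₁ hγ₃)).comp hb).continuousAt.comp hu))
    exact hm.prodMk (hdiv.mul hm)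
  -- The quotient `f₁ / f₀` has no limit at the vacuum; continuity there comes from the norm bound.
  · have h0 : domainProj γ κ wmin wmax ξ 0 = 0 :=
      domainProj_of_mem hγ₁ hγ₃ hκ ⟨zero_mem_stateD, Or.inl rfl⟩
    rw [ContinuousWithinAt, h0, tendsto_zero_iff_norm_tendsto_zero]
    have hn : Tendsto (fun f : ℝ × ℝ => ‖f‖) (𝓝[stateD] 0) (𝓝 0) := by
      have := (continuous_norm (E := ℝ × ℝ)).tendsto 0
      rw [norm_zero] at this
      exact this.mono_left nhdsWithin_le_nhds
    refine squeeze_zero' (Eventually.of_forall fun _ => norm_nonneg _) ?_ hn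
    filter_upwards [self_mem_nhdsWithin] with f hf
      using norm_domainProj_le hγ₁ hγ₃ hκ hf wmin wmax ξ

omit hκ in
lemma measurable_domainProj (wmin wmax : ℝ) :
    Measurable fun q : ℝ × (ℝ × ℝ) => domainProj γ κ wmin wmax q.1 q.2 := by
  have hp := (continuous_posPow (lam_pos hγ₁ hγ₃)).measurable
  have hu : Measurable fun q : ℝ × (ℝ × ℝ) => kinU γ q.2 q.1 := by unfold kinU; fun_prop
  have hb : Measurable fun q : ℝ × (ℝ × ℝ) => domainBound wmin wmax q.1 (kinU γ q.2 q.1) := by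
    unfold domainBound; fun_prop
  have hm : Measurable fun q : ℝ × (ℝ × ℝ) => domainMass γ κ wmin wmax q.1 q.2 := by
    unfold domainMass
    exact (measurable_fst.comp measurable_snd).min ((hp.comp hb).const_mul _)
  unfold domainProj
  exact hm.prodMk (((measurable_snd.comp measurable_snd).div
    (measurable_fst.comp measurable_snd)).mul hm)

/-- The retraction onto the invariant data, as a map on `L¹`. -/
lemma exists_continuous_domainProj (wmin wmax : ℝ) (ν : Measure ℝ) :
    ∃ N : L1D ν → L1D ν, Continuous N ∧ (∀ g, ‖(N g).1‖ ≤ ‖g.1‖) ∧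
      ∀ g, (N g).1 =ᵐ[ν] fun ξ => domainProj γ κ wmin wmax ξ (g.1 ξ) := by
  have hmeas : ∀ g : L1D ν, AEStronglyMeasurable
      (fun ξ => domainProj γ κ wmin wmax ξ (g.1 ξ)) ν := fun g =>
    ((measurable_domainProj hγ₁ hγ₃ wmin wmax).comp_aemeasurable
      (aemeasurable_id.prodMk (Lp.stronglyMeasurable g.1).measurable.aemeasurable)).aestronglyMeasurable
  have hle : ∀ g : L1D ν, ∀ᵐ ξ ∂ν, ‖domainProj γ κ wmin wmax ξ (g.1 ξ)‖ ≤ ‖g.1 ξ‖ := fun g => by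
    filter_upwards [g.2] with ξ hξ using norm_domainProj_le hγ₁ hγ₃ hκ hξ wmin wmax ξ
  have hint : ∀ g : L1D ν, Integrable (fun ξ => domainProj γ κ wmin wmax ξ (g.1 ξ)) ν :=
    fun g => (L1D.integrable g).mono (hmeas g) (hle g)
  have hco : ∀ g : L1D ν, ((hint g).toL1 : ℝ → ℝ × ℝ) =ᵐ[ν]
      fun ξ => domainProj γ κ wmin wmax ξ (g.1 ξ) := fun g => (hint g).coeFn_toL1
  have hD : ∀ g : L1D ν, ∀ᵐ ξ ∂ν, ((hint g).toL1 : ℝ → ℝ × ℝ) ξ ∈ stateD := fun g => by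
    filter_upwards [hco g, g.2] with ξ h1 h2
    rw [h1]
    exact (domainProj_mem hγ₁ hγ₃ hκ h2 wmin wmax ξ).1
  refine ⟨fun g => ⟨(hint g).toL1, hD g⟩, ?_, fun g => ?_, hco⟩
  · refine Continuous.subtype_mk (SeqContinuous.continuous fun y y' hy => ?_) _
    have hy1 : Tendsto (fun n => (y n).1) atTop (𝓝 y'.1) := (tendsto_subtype_rng.1 hy)
    have hy2 : Tendsto (fun n => ∫⁻ ξ, ‖(y n).1 ξ - y'.1 ξ‖ₑ ∂ν) atTop (𝓝 0) := by
      have := tendsto_iff_edist_tendsto_0.1 hy1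
      simp only [Lp.edist_def, eLpNorm_one_eq_lintegral_enorm] at this
      exact this
    refine tendsto_iff_edist_tendsto_0.2 ?_
    simp only [Function.comp_apply, Integrable.edist_toL1_toL1]
    simp only [edist_eq_enorm_sub]
    have henorm : ∀ {a b : ℝ × ℝ}, ‖a‖ ≤ ‖b‖ → ‖a‖ₑ ≤ 1 * ‖b‖ₑ := fun {a b} h => by
      rw [one_mul]; exact enorm_le_iff_norm_le.2 h
    refine tendsto_lintegral_sub_of_dominated (C := 1) ENNReal.one_ne_top
      (fun n => (Lp.aestronglyMeasurable (y n).1)) (Lp.aestronglyMeasurable y'.1)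
      (fun n => hmeas (y n)) (hmeas y') (L1D.integrable y').2.ne (fun n => ?_) ?_ ?_ hy2
    · filter_upwards [hle (y n)] with ξ hξ using henorm hξ
    · filter_upwards [hle y'] with ξ hξ using henorm hξ
    · filter_upwards [ae_all_iff.2 fun n => (y n).2, y'.2] with ξ h1 h2 φ hφ
      refine (continuousOn_domainProj hγ₁ hγ₃ hκ wmin wmax ξ _ h2).tendsto.comp ?_
      exact tendsto_nhdsWithin_iff.2 ⟨hφ, Eventually.of_forall fun n => h1 _⟩
  · rw [L1.norm_eq_integral_norm, L1.norm_eq_integral_norm]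
    refine integral_mono_ae (L1.integrable_coeFn _).norm (L1D.integrable g).norm ?_
    filter_upwards [hco g, hle g] with ξ h1 h2
    rw [h1]; exact h2

end

end

/-! ### The modified Maxwellian coupling -/

section

variable {γ κ : ℝ} (hγ₁ : 1 < γ) (hγ₃ : γ < 3) (hκ : 0 < κ) {d : ℕ}
include hγ₁ hγ₃ hκ

/-- There is a continuous retraction of the data onto the invariant data which increases neither
the mass flux nor the energy flux. -/
lemma exists_dataRetraction (A wmin wmax : Fin d → ℝ) :
    ∃ N : Fin d → L1D muIn → L1D muIn, (∀ i, Continuous (N i)) ∧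
      (∀ i g, ‖(N i g).1‖ ≤ ‖g.1‖) ∧
      (∀ g : Fin d → L1D muIn, (fun i => N i (g i)) ∈ invariantData γ κ wmin wmax muIn) ∧
      (∀ g ∈ invariantData γ κ wmin wmax muIn, (fun i => N i (g i)) = g) ∧
      (∀ g : Fin d → L1D muIn, totalFlux A muIn (fun _ f _ => f.1) (fun i => N i (g i)) ≤
        totalFlux A muIn (fun _ f _ => f.1) g) ∧
      ∀ g : Fin d → L1D muIn, totalFlux A muIn (fun _ => kinEnergy γ κ) (fun i => N i (g i)) ≤
        totalFlux A muIn (fun _ => kinEnergy γ κ) g := by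
  choose N hN hnorm hco using fun i =>
    exists_continuous_domainProj hγ₁ hγ₃ hκ (wmin i) (wmax i) muIn
  refine ⟨N, hN, hnorm, fun g i => ?_, fun g hg => funext fun i => Subtype.ext (Lp.ext ?_),
    fun g => totalFlux_mono fun i => lintegral_mono_ae ?_,
    fun g => totalFlux_mono fun i => lintegral_mono_ae ?_⟩
  · filter_upwards [hco i (g i), (g i).2] with ξ h1 h2
    rw [h1]
    exact domainProj_mem hγ₁ hγ₃ hκ h2 _ _ ξ
  · filter_upwards [hco i (g i), hg i] with ξ h1 h2
    rw [h1]
    exact domainProj_of_mem hγ₁ hγ₃ hκ h2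
  · filter_upwards [hco i (g i)] with ξ h1
    rw [h1]
    exact ENNReal.ofReal_le_ofReal (min_le_left _ _)
  · filter_upwards [hco i (g i), (g i).2] with ξ h1 h2
    rw [h1]
    exact ENNReal.ofReal_le_ofReal (kinEnergy_domainProj_le hγ₁ hγ₃ hκ h2 _ _ ξ)

/-- A coupling with the flux bounds which is continuous on invariant data satisfies all
assumptions after a change outside the invariant data. -/
lemma exists_modified_coupling {A wmin wmax : Fin d → ℝ} {b₀ bH : ℝ → ℝ} {J : Set ℝ}
    (hJ : J = Ioi 0 ∨ J = Ici 0) {Ψ Ψh : Coupling d}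
    (hΨ : MacroscopicAssumptions γ κ A J wmin wmax b₀ bH Ψ)
    (hM : ∀ t > 0, ∀ g, IsMaxwellian γ κ (Ψh t g))
    (hb : FluxBounds γ κ A wmin wmax b₀ bH Ψh)
    (hc : ContinuousCoupling J (invariantData γ κ wmin wmax muIn) Ψh) :
    ∃ Ψc : Coupling d,
      (∀ t > 0, ∀ g ∈ invariantData γ κ wmin wmax muIn, Ψc t g = Ψh t g) ∧
      (∀ t > 0, ∀ g, IsMaxwellian γ κ (Ψc t g)) ∧
      MacroscopicAssumptions γ κ A J wmin wmax b₀ bH Ψc := by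
  obtain ⟨N, hN, hnorm, hinv, hid, hmass, henergy⟩ :=
    exists_dataRetraction hγ₁ hγ₃ hκ A wmin wmax
  have hNC : ∀ (G : ℝ → Fin d → L1D muIn) (i : Fin d),
      ∀ᵐ t ∂volume.restrict (Ioi (0 : ℝ)), ‖(N i (G t i)).1‖ ≤ 1 * ‖(G t i).1‖ := fun G i =>
    ae_of_all _ fun t => by rw [one_mul]; exact hnorm i _
  have hloc : ∀ G : ℝ → Fin d → L1D muIn, IsLocL1 J G → IsLocL1 J fun t i => N i (G t i) :=
    fun G hG i => locallyIntegrableOn_superposition hJ (hN i) (hG i)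
      (ae_of_all _ fun _ => rfl) (hNC G i)
  have hmem : ∀ G : ℝ → Fin d → L1D muIn, ∀ᵐ t ∂volume.restrict (Ioi (0 : ℝ)),
      (fun i => N i (G t i)) ∈ invariantData γ κ wmin wmax muIn := fun G =>
    ae_of_all _ fun t => hinv (G t)
  -- The given coupling is applied to the retracted data, which are always invariant; continuity on
  -- invariant data thus becomes continuity on all data.
  refine ⟨fun t g => Ψh t fun i => N i (g i), fun t _ g hg => congrArg (Ψh t) (hid g hg),
    fun t ht g => hM t ht _, hΨ.wmin_lt_wmax, hΨ.b₀_nonneg, hΨ.b₀_loc, hΨ.bH_nonneg, hΨ.bH_loc,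
    ⟨fun G hG _ => hc.isLocL1 _ (hloc G hG) (hmem G), fun G G' hG _ hG' _ hlim => ?_⟩,
    ⟨?_, ?_, ?_⟩⟩
  · exact hc.tendsto _ _ (fun n => hloc (G n) (hG n)) (fun n => hmem (G n)) (hloc G' hG')
      (hmem G') fun K hK hKc i => tendsto_superposition hJ (hN i) (fun n => hG n i) (hG' i)
        (fun n => ae_of_all _ fun _ => rfl) (ae_of_all _ fun _ => rfl) (fun n => hNC (G n) i)
        (hNC G' i) hK hKc (hlim K hK hKc i)
  · filter_upwards [hb.mass] with t ht g
    exact (ht _).trans (add_le_add_left (hmass g) _)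
  · filter_upwards [hb.energy] with t ht g
    exact (ht _).trans (add_le_add_left (henergy g) _)
  · filter_upwards [hb.invariance] with t ht g
    refine (ht _).trans ?_
    -- The retracted data carry no entropy flux, so the bound holds however large the entropy flux
    -- of `g` is.
    rw [totalFlux_entropy_eq_zero hγ₁ (hinv g)]
    exact zero_le

end

end

end IsentropicNetwork

open IsentropicNetwork

theorem mainTheorem6 (γ κ : ℝ) (hγ₁ : 1 < γ) (hγ₃ : γ < 3) (hκ : 0 < κ)
    (d : ℕ) (A : Fin d → ℝ) (hA : ∀ i, 0 < A i) (Ψ : Coupling d) :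
    -- the half-flux is a bijection from the states with `ρ > 0`, `ω₂ > 0` onto `{f₀ > 0}`
    Set.BijOn (fun q : ℝ × ℝ => halfFlux γ κ q.1 q.2)
      {q | 0 < q.1 ∧ 0 < omega2 γ κ q.1 q.2} {f : ℝ × ℝ | 0 < f.1} ∧
    -- the Maxwellian coupling is well defined
    (∀ t > 0, ∀ g : Fin d → L1D muIn, ∃! h : Fin d → L1D muOut,
      IsMaxwellianOutflow γ κ (Ψ t g) h) ∧
    -- inheritance of the assumptions of the macroscopic existence theorem
    ∀ Ψh : Coupling d, IsMaxwellianCoupling γ κ Ψ Ψh →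
      ∀ J : Set ℝ, (J = Set.Ioi 0 ∨ J = Set.Ici 0) →
      ∀ (wmin wmax : Fin d → ℝ) (b₀ bH : ℝ → ℝ),
        MacroscopicAssumptions γ κ A J wmin wmax b₀ bH Ψ →
        -- the inequalities hold for all incoming data
        FluxBounds γ κ A wmin wmax b₀ bH Ψh ∧
        -- data in the invariant domains are mapped to data in the invariant domains
        (∀ᵐ t ∂MeasureTheory.volume.restrict (Set.Ioi 0),
          ∀ g ∈ invariantData γ κ wmin wmax muIn,
            Ψh t g ∈ invariantData γ κ wmin wmax muOut) ∧
        -- continuity on data in the invariant domains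
        ContinuousCoupling J (invariantData γ κ wmin wmax muIn) Ψh ∧
        -- after a change outside the invariant domains all assumptions hold on all data
        ∃ Ψc : Coupling d,
          (∀ t > 0, ∀ g ∈ invariantData γ κ wmin wmax muIn, Ψc t g = Ψh t g) ∧
          (∀ t > 0, ∀ g, IsMaxwellian γ κ (Ψc t g)) ∧
          MacroscopicAssumptions γ κ A J wmin wmax b₀ bH Ψc := by
  refine ⟨bijOn_halfFlux hγ₁ hγ₃ hκ,
    fun t _ g => existsUnique_maxwellianOutflow hγ₁ hγ₃ hκ (Ψ t g),
    fun Ψh hh J hJ wmin wmax b₀ bH hΨ => ?_⟩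
  have hM : ∀ t > 0, ∀ g, IsMaxwellian γ κ (Ψh t g) := fun t ht g i => by
    obtain ⟨ρ, u, hρ, h, -⟩ := hh t ht g i
    exact ⟨ρ, u, hρ, h⟩
  have hb := hΨ.bounds.of_isMaxwellianCoupling hγ₁ hγ₃ hκ hh
  -- Invariance of the outflow has to precede continuity, whose domination relies on it.
  have hinv := hb.maps_invariantData hγ₁ hγ₃ hκ hA hM
  have hc := hΨ.continuous.maxwellianCoupling hγ₁ hγ₃ hκ hJ hh hinv
  exact ⟨hb, hinv, hc, exists_modified_coupling hγ₁ hγ₃ hκ hJ hΨ hM hb hc⟩
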